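/- A \emph{WQO} is a quasi-ordered set $(X,\le)$ in which every infinite sequence $(x_i)$ has $i<j$ with $x_i\le x_j$. An \emph{ideal} is a non-empty, downwards-closed, directed subset; $\mathrm{Idl}(X)$ is the set of ideals; filters are the sets $\uparrow x$. Suppose $X$ and $\mathrm{Idl}(X)$ come with data structures, i.e. recursive sets of names (natural numbers) together with surjective maps from names onto $X$, resp. onto $\mathrm{Idl}(X)$. Upwards-closed (resp. downwards-closed) sets are represented by finite lists of names of elements (resp. ideals), denoting the union of the corresponding filters $\uparrow x$ (resp. ideals). The WQO $X$ is \emph{ideally effective} if the following are computable on names: (OD) whether $x\le y$; (ID) whether $I\subseteq J$; (PI) $x\mapsto\downarrow x$; (CF) $x\mapsto X\setminus\uparrow x$; (IF) $(x,y)\mapsto\uparrow x\,\cap\uparrow y$; (CI) $I\mapsto X\setminus I$; (II) $(I,J)\mapsto I\cap J$. A \emph{presentation} of $X$ consists of programs deciding the two sets of names, programs for the seven operations, a finite list (XI) of names of ideals with union $X$, and a finite list (XF) of names of elements whose filters have union $X$. Let $X^*$ be the set of finite sequences over $X$, with $x_1\cdots x_n\le_* y_1\cdots y_m$ iff there are $p_1<\dots<p_n$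 in $\{1,\dots,m\}$ with $x_i\le y_{p_i}$ for all $i$. An \emph{atom} is a set $D^*\subseteq X^*$ with $D\subseteq X$ downwards-closed, or $I+\epsilon=\{x: x\in I\}\cup\{\epsilon\}$ with $I\in\mathrm{Idl}(X)$. Products of sets of sequences are taken for concatenation. An element of $X^*$ is represented by the list of names of its letters, and an ideal of $X^*$ by a list of atoms whose product it is, where $I+\epsilon$ is represented by a name of $I$ and $D^*$ by a list of names of ideals with union $D$. \textbf{Theorem.} With these representations, the sequence extension $X\mapsto(X^*,\le_*)$ is an ideally effective constructor: (1) if $X$ is a WQO then so is $X^*$; (2) if $X$ is ideally effective then so is $X^*$ (in particular the products of atoms are exactly the ideals of $X^*$); (3) there is one computable function that maps every presentation of every ideally effective WQO $X$ to a presentation of $X^*$, including the decompositions (XI) and (XF) of $X^*$. Moreover, for every WQO $X$, writing $\uparrow$ for upward closure, $\neg$ for complement, $I,J$ for ideals of $X$, $D,E$ for downwards-closed subsets of $X$, $A,B$ for atoms, and $P,Q$ for ideals of $X^*$: (ID) $I+\epsilon\subseteq J+\epsilon\iff I\subseteq J$; $I+\epsilon\subseteq D^*\iff I\subseteq D$;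 $D^*\subseteq E^*\iff D\subseteq E$; $D^*\subseteq I+\epsilon\iff D=\emptyset$. Further, $\{\epsilon\}\subseteq P$; $A\cdot P\subseteq\{\epsilon\}\iff A=\emptyset^*$ and $P\subseteq\{\epsilon\}$; if $A\not\subseteq B$ then $A P\subseteq B Q\iff A P\subseteq Q$; if $A=I+\epsilon\subseteq B=J+\epsilon$ then $AP\subseteq BQ\iff P\subseteq Q$; in the other cases with $A\subseteq B$, $AP\subseteq BQ\iff P\subseteq BQ$. The recursive procedure given by these equivalences correctly decides inclusion of a product of $m$ atoms in a product of $n$ atoms, with at most $m+n$ inclusion tests between downwards-closed subsets of $X$. (CF) $\neg\uparrow\epsilon=\emptyset$, $\neg\uparrow x=(X\setminus\uparrow x)^*$, and $\neg\uparrow xv=(X\setminus\uparrow x)^*\cdot(X+\epsilon)\cdot\neg\uparrow v$ for $v\neq\epsilon$, where $X+\epsilon$ is the set of sequences of length at most one. (II) $\{\epsilon\}\cap Q=P\cap\{\epsilon\}=\{\epsilon\}$; $D^*P\cap E^*Q=(D\cap E)^*\cdot[(D^*P\cap Q)\cup(P\cap E^*Q)]$; $(I+\epsilon)P\cap(J+\epsilon)Q=((I+\epsilon)P\cap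 Q)\cup(P\cap(J+\epsilon)Q)\cup((I\cap J)+\epsilon)(P\cap Q)$; $D^*P\cap(I+\epsilon)Q=(P\cap(I+\epsilon)Q)\cup((D\cap I)+\epsilon)(D^*P\cap Q)$, where $S+\epsilon=\{x:x\in S\}\cup\{\epsilon\}$ for every $S\subseteq X$. (IF) $\uparrow v\cap\uparrow\epsilon=\uparrow\epsilon\cap\uparrow v=\uparrow v$; $\uparrow xv\cap\uparrow yw=\uparrow x\cdot(\uparrow v\cap\uparrow yw)\cup\uparrow y\cdot(\uparrow xv\cap\uparrow w)\cup[x,y]\cdot(\uparrow v\cap\uparrow w)$, where $[x,y]$ is the set of sequences in $X^*$ having a letter $z$ with $z\ge x$ and $z\ge y$; and $\uparrow u\cdot\uparrow v=\uparrow uv$. (CI) If $X\setminus D=\bigcup_i\uparrow a_i$ (finite union) then $\neg D^*=\bigcup_i\uparrow a_i$ in $X^*$; if $X\setminus I=\bigcup_i\uparrow b_i$ and $X=\bigcup_k\uparrow c_k$ (finite unions) then $\neg(I+\epsilon)=\bigcup_i\uparrow b_i\cup\bigcup_{k,l}\uparrow c_kc_l$ in $X^*$. On upwards-closed subsets of $X^*$,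 the operation $U\odot V:=\neg(\neg U\cdot\neg V)$ has upwards-closed values, is associative, and distributes over binary unions on both sides; $\uparrow v\odot\uparrow\epsilon=\uparrow\epsilon\odot\uparrow v=X^*$; $\uparrow va\odot\uparrow bw=\uparrow vabw\cup\uparrow v\cdot[a,b]\cdot\uparrow w$; and $\neg(A_1\cdots A_n)=\neg A_1\odot\cdots\odot\neg A_n$ for all atoms $A_1,\dots,A_n$ (for $n=0$ the right-hand side is $\neg\{\epsilon\}$). -/

import Mathlib

universe u

namespace IdealEff

open Nat.Partrec (Code)

/-! ## Ideally effective well-quasi-orders -/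

/-- Data structures for a quasi-order `X` and for its set of ideals. A natural number `n` is the
name of an element if `elt n` is `some x` (it then denotes `x`), and the name of a subset of `X` if
`idl n` is `some I`. An object may have several names. -/
structure DataStructures (X : Type u) where
  elt : ℕ → Option X
  idl : ℕ → Option (Set X)

namespace DataStructures

variable {X : Type u}

/-- The subset of `X` denoted by a list of names of ideals: their union. -/
def down (D : DataStructures X) (l : List ℕ) : Option (Set X) :=
  (l.mapM D.idl).map fun L => {x | ∃ I ∈ L, x ∈ I}

/-- The subset of `X` denoted by a list of names of elements: the union of the principal filters
that they generate. -/
def up [Preorder X] (D : DataStructures X) (l : List ℕ) : Option (Set X) :=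
  (l.mapM D.elt).map fun L => {y | ∃ x ∈ L, x ≤ y}

/-- On input `n`, the procedure `f` halts and answers correctly (`1` for yes, `0` for no) whether
`P` holds. -/
def Answers (f : ℕ →. ℕ) (n : ℕ) (P : Prop) : Prop :=
  (P → 1 ∈ f n) ∧ (¬ P → 0 ∈ f n)

/-- Every element of `X` has a name, and the named subsets of `X` are exactly its ideals. -/
structure Exact [Preorder X] (D : DataStructures X) : Prop where
  elt : ∀ x : X, ∃ n, D.elt n = some x
  idl : ∀ I : Set X, (∃ n, D.idl n = some I) ↔ Order.IsIdeal I

/-- `f` decides the set of names of elements. -/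
def DecElt (D : DataStructures X) (f : ℕ →. ℕ) : Prop :=
  ∀ n, Answers f n ((D.elt n).isSome = true)

/-- `f` decides the set of names of ideals. -/
def DecIdl (D : DataStructures X) (f : ℕ →. ℕ) : Prop :=
  ∀ n, Answers f n ((D.idl n).isSome = true)

/-- (OD) `f` decides the ordering. -/
def OD [Preorder X] (D : DataStructures X) (f : ℕ →. ℕ) : Prop :=
  ∀ m n x y, D.elt m = some x → D.elt n = some y → Answers f (Nat.pair m n) (x ≤ y)

/-- (ID) `f` decides inclusion of ideals. -/
def ID (D : DataStructures X) (f : ℕ →. ℕ) : Prop :=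
  ∀ m n I J, D.idl m = some I → D.idl n = some J → Answers f (Nat.pair m n) (I ⊆ J)

/-- (PI) `f` computes principal ideals. -/
def PI [Preorder X] (D : DataStructures X) (f : ℕ →. ℕ) : Prop :=
  ∀ n x, D.elt n = some x → ∃ i ∈ f n, D.idl i = some (Set.Iic x)

/-- (CF) `f` computes complements of (principal) filters, as finite unions of ideals. -/
def CF [Preorder X] (D : DataStructures X) (f : ℕ →. ℕ) : Prop :=
  ∀ n x, D.elt n = some x →
    ∃ l : List ℕ, Encodable.encode l ∈ f n ∧ D.down l = some (Set.Ici x)ᶜ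

/-- (IF) `f` computes intersections of (principal) filters, as finite unions of filters. -/
def IF [Preorder X] (D : DataStructures X) (f : ℕ →. ℕ) : Prop :=
  ∀ m n x y, D.elt m = some x → D.elt n = some y →
    ∃ l : List ℕ, Encodable.encode l ∈ f (Nat.pair m n) ∧ D.up l = some (Set.Ici x ∩ Set.Ici y)

/-- (CI) `f` computes complements of ideals, as finite unions of filters. -/
def CI [Preorder X] (D : DataStructures X) (f : ℕ →. ℕ) : Prop :=
  ∀ n I, D.idl n = some I →
    ∃ l : List ℕ, Encodable.encode l ∈ f n ∧ D.up l = some Iᶜ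

/-- (II) `f` computes intersections of ideals, as finite unions of ideals. -/
def II (D : DataStructures X) (f : ℕ →. ℕ) : Prop :=
  ∀ m n I J, D.idl m = some I → D.idl n = some J →
    ∃ l : List ℕ, Encodable.encode l ∈ f (Nat.pair m n) ∧ D.down l = some (I ∩ J)

/-- `X`, with the data structures `D`, is an ideally effective well-quasi-order. -/
structure IdeallyEffective [Preorder X] (D : DataStructures X) : Prop where
  wqo : WellQuasiOrderedLE X
  exact : D.Exact
  decElt : ∃ f, Nat.Partrec f ∧ D.DecElt f
  decIdl : ∃ f, Nat.Partrec f ∧ D.DecIdl f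
  od : ∃ f, Nat.Partrec f ∧ D.OD f
  id : ∃ f, Nat.Partrec f ∧ D.ID f
  pi : ∃ f, Nat.Partrec f ∧ D.PI f
  cf : ∃ f, Nat.Partrec f ∧ D.CF f
  if' : ∃ f, Nat.Partrec f ∧ D.IF f
  ci : ∃ f, Nat.Partrec f ∧ D.CI f
  ii : ∃ f, Nat.Partrec f ∧ D.II f

end DataStructures

/-- A presentation, as a finite object: programs that recognise the names of elements and of
ideals, programs for the seven operations, and two lists of names. -/
structure Presentation where
  decElt : Code
  decIdl : Code
  od : Code
  id : Code
  pi : Code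
  cf : Code
  if' : Code
  ci : Code
  ii : Code
  xi : List ℕ
  xf : List ℕ

/-- A presentation is a tuple; this is used to encode presentations as natural numbers. -/
def Presentation.equivProd : Presentation ≃
    Code × Code × Code × Code × Code × Code × Code × Code × Code × List ℕ × List ℕ where
  toFun p := (p.decElt, p.decIdl, p.od, p.id, p.pi, p.cf, p.if', p.ci, p.ii, p.xi, p.xf)
  invFun t := ⟨t.1, t.2.1, t.2.2.1, t.2.2.2.1, t.2.2.2.2.1, t.2.2.2.2.2.1, t.2.2.2.2.2.2.1,
    t.2.2.2.2.2.2.2.1, t.2.2.2.2.2.2.2.2.1, t.2.2.2.2.2.2.2.2.2.1, t.2.2.2.2.2.2.2.2.2.2⟩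
  left_inv _ := rfl
  right_inv _ := rfl

instance : Primcodable Presentation :=
  Primcodable.ofEquiv _ Presentation.equivProd

/-- `p` is a presentation of the well-quasi-order `X` with the data structures `D`. -/
structure IsPresentation {X : Type u} [Preorder X] (D : DataStructures X) (p : Presentation) :
    Prop where
  wqo : WellQuasiOrderedLE X
  exact : D.Exact
  decElt : D.DecElt p.decElt.eval
  decIdl : D.DecIdl p.decIdl.eval
  od : D.OD p.od.eval
  id : D.ID p.id.eval
  pi : D.PI p.pi.eval
  cf : D.CF p.cf.eval
  if' : D.IF p.if'.eval
  ci : D.CI p.ci.eval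
  ii : D.II p.ii.eval
  xi : D.down p.xi = some Set.univ
  xf : D.up p.xf = some Set.univ

/-- A unary order-theoretic constructor, together with its choice of data structures. -/
structure Constructor where
  carrier : Type u → Type u
  order : (X : Type u) → [Preorder X] → Preorder (carrier X)
  data : (X : Type u) → DataStructures X → DataStructures (carrier X)

/-- The constructor `C` is ideally effective: it preserves well-quasi-orders and ideal
effectiveness, and one algorithm turns every presentation of every `X` into one of `C[X]`. -/
structure Constructor.IdeallyEffective (C : Constructor.{u}) : Prop where
  preserves_wqo : ∀ (X : Type u) [Preorder X], WellQuasiOrderedLE X →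
    @WellQuasiOrderedLE (C.carrier X) (C.order X).toLE
  preserves_effective : ∀ (X : Type u) [Preorder X] (D : DataStructures X),
    D.IdeallyEffective → @DataStructures.IdeallyEffective (C.carrier X) (C.order X) (C.data X D)
  uniform : ∃ F : Presentation → Presentation, Computable F ∧
    ∀ (X : Type u) [Preorder X] (D : DataStructures X) (p : Presentation),
      IsPresentation D p → @IsPresentation (C.carrier X) (C.order X) (C.data X D) (F p)

/-! ## The sequence extension -/

/-- Finite sequences over `X`. This is a type synonym of `List X`, since `List X` carries the
lexicographic ordering. -/
def SeqExt (X : Type u) : Type u := List X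

/-- Sequences are ordered by embedding: `u ≤ v` if `u` is pointwise below a subsequence of `v`. -/
instance (X : Type u) [Preorder X] : Preorder (SeqExt X) where
  le u v := List.SublistForall₂ (α := X) (β := X) (· ≤ ·) u v
  le_refl u := refl_of (List.SublistForall₂ (α := X) (β := X) (· ≤ ·)) u
  le_trans _ _ _ := trans_of (List.SublistForall₂ (α := X) (β := X) (· ≤ ·))

namespace SeqExt

variable {X : Type u}

/-- The set containing only the empty sequence. -/
def eps (X : Type u) : Set (SeqExt X) := {w : List X | w = []}

/-- The principal filter generated by a sequence. -/
def fil [Preorder X] (w : List X) : Set (SeqExt X) := Set.Ici (α := SeqExt X) w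

/-- Product of two sets of sequences, for concatenation. -/
def prod (U V : Set (SeqExt X)) : Set (SeqExt X) :=
  {w : List X | ∃ u v : List X, u ∈ U ∧ v ∈ V ∧ w = u ++ v}

/-- The sequences all of whose elements are in `D`. -/
def star (D : Set X) : Set (SeqExt X) := {w : List X | ∀ x ∈ w, x ∈ D}

/-- `I + ε`: the empty sequence, and the sequences of length one whose element is in `I`. -/
def opt (I : Set X) : Set (SeqExt X) := {w : List X | w = [] ∨ ∃ x ∈ I, w = [x]}

/-- The upwards-closed set of sequences generated by the length-one sequences with element in
`S`. -/
def upLetters [Preorder X] (S : Set X) : Set (SeqExt X) := {w | ∃ x ∈ S, w ∈ fil [x]}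

/-- The complement of the product of the complements. -/
def odot (U V : Set (SeqExt X)) : Set (SeqExt X) := (prod Uᶜ Vᶜ)ᶜ

end SeqExt

/-- Expressions for atoms, over a type `δ` of descriptions of subsets of `X`. -/
inductive Atom (δ : Type u) : Type u
  | opt (I : δ) : Atom δ
  | star (D : δ) : Atom δ

namespace Atom

variable {X : Type u}

/-- The atom `I + ε` or `D*`, as a set of sequences. -/
def den : Atom (Set X) → Set (SeqExt X)
  | opt I => SeqExt.opt I
  | star D => SeqExt.star D

/-- `I` is an ideal, resp. `D` is downwards-closed. -/
def Valid [Preorder X] : Atom (Set X) → Prop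
  | opt I => Order.IsIdeal I
  | star D => IsLowerSet D

/-- The product of a list of atoms. -/
def prod (P : List (Atom (Set X))) : Set (SeqExt X) :=
  P.foldr (fun A S => SeqExt.prod A.den S) (SeqExt.eps X)

/-- A search for the leftmost embedding of a product of atoms into another, calling a procedure
`sub` for inclusion tests, where `e` describes the empty set. It returns its answer and the number
of calls of `sub`. -/
def inclTest {δ : Type u} (e : δ) (sub : δ → δ → Bool) :
    List (Atom δ) → List (Atom δ) → Bool × ℕ
  | [], _ => (true, 0)
  | opt _ :: _, [] => (false, 0)
  | star D :: P, [] =>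
    if sub D e then ((inclTest e sub P []).1, (inclTest e sub P []).2 + 1) else (false, 1)
  | opt I :: P, opt J :: Q =>
    if sub I J then ((inclTest e sub P Q).1, (inclTest e sub P Q).2 + 1)
    else ((inclTest e sub (opt I :: P) Q).1, (inclTest e sub (opt I :: P) Q).2 + 1)
  | opt I :: P, star D :: Q =>
    if sub I D then ((inclTest e sub P (star D :: Q)).1, (inclTest e sub P (star D :: Q)).2 + 1)
    else ((inclTest e sub (opt I :: P) Q).1, (inclTest e sub (opt I :: P) Q).2 + 1)
  | star D :: P, star E :: Q =>
    if sub D E then ((inclTest e sub P (star E :: Q)).1, (inclTest e sub P (star E :: Q)).2 + 1)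
    else ((inclTest e sub (star D :: P) Q).1, (inclTest e sub (star D :: P) Q).2 + 1)
  | star D :: P, opt I :: Q =>
    if sub D e then ((inclTest e sub P (opt I :: Q)).1, (inclTest e sub P (opt I :: Q)).2 + 1)
    else ((inclTest e sub (star D :: P) Q).1, (inclTest e sub (star D :: P) Q).2 + 1)
termination_by P Q => P.length + Q.length

end Atom

/-- The atom named by a name of an ideal `I` (it is `I + ε`) or by a list of names of ideals with
union `D` (it is `D*`). -/
def DataStructures.atom {X : Type u} (D : DataStructures X) : ℕ ⊕ List ℕ → Option (Atom (Set X))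
  | Sum.inl i => (D.idl i).map Atom.opt
  | Sum.inr l => (D.down l).map Atom.star

/-- A sequence is represented by the list of (names of) its elements, an ideal of sequences by a
list of (names of) atoms, of which it is the product. -/
def DataStructures.seq {X : Type u} (D : DataStructures X) : DataStructures (SeqExt X) where
  elt n := (Encodable.decode (α := List ℕ) n).bind fun l => l.mapM D.elt
  idl n := (Encodable.decode (α := List (ℕ ⊕ List ℕ)) n).bind fun l =>
    (l.mapM D.atom).map Atom.prod

/-- The sequence extension, ordered by embedding. -/
def sequenceExtension : Constructor.{u} where
  carrier X := SeqExt X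
  order _ := inferInstance
  data _ D := D.seq

end IdealEff

open IdealEff

/-!
The sequence extension of an ideally effective well-quasi-order is ideally effective.

*Order theory.* Whether a sequence lies in `D* P` or in `(I + ε) P` is decided by its first letter
(`cons_mem_star_prod`, `cons_mem_opt_prod`), and so is embedding (`cons_emb_cons`). The formulas for
intersections and for complements of filters follow by induction on sequences. For inclusions, the
point is `prod_subset_prod_of_not_subset`: if `A ⊄ B`, every sequence in `A P` has an extension in
`A P` that cannot use the atom `B`; here directedness of ideals is needed. For complements of
ideals, `w ∈ U ⊙ V` means that for every splitting `w = u v` one has `u ∈ U` or `v ∈ V`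
(`mem_odot`), and `fil_odot_fil` considers the letter that completes the leftmost embedding of `va`.

That `X*` is a well-quasi-order is Higman's lemma, which Mathlib has. Lower sets of `X*` are finite
intersections of complements of principal filters. As these complements are finite unions of
products of atoms, and such unions are closed under intersection, every lower set is a finite union
of products of atoms (`isProds_of_isLowerSet`). An ideal contained in a finite union of lower sets
is contained in one of them, and so the ideals are exactly the products of atoms
(`isIdeal_iff_exists_prod`).

*Computability.* The programs of a presentation are partial, and the algorithms for `X*` call them
inside recursions on lists. To reduce this to primitive recursion, every algorithm is given a
resource bound `k` and calls the programs through `Nat.Partrec.Code.evaln k`. The result is a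
primitive recursive function of the presentation, the bound and the input, with values in `Option`.
`Computes` says that these values are eventually defined, always agree, and satisfy a specification,
and it is stable under sequencing, mapping over lists and recursion on two lists
(`Computes.bind`, `Computes.mapM`, `Computes.listRec₂`). An unbounded search for a sufficient bound
and the s-m-n theorem then give, computably in the presentation, a program that meets the
specification (`exists_uniform_code`). The specifications of the algorithms are consequences of the
formulas from order theory (`computes_seqIncl`, `computes_seqCF`, `computes_seqIF`,
`computes_seqII`, `computes_seqCI`).
-/

namespace IdealEff

open Filter Encodable
open Nat.Partrec (Code)

namespace SeqExt

/-! ### Products of sets of sequences -/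

section Basic

variable {X : Type u}

/-- A list, seen as an element of the type synonym `SeqExt`. -/
def mk (w : List X) : SeqExt X := w

theorem ext_mk {U V : Set (SeqExt X)} (h : ∀ w : List X, mk w ∈ U ↔ mk w ∈ V) : U = V :=
  Set.ext h

theorem subset_mk {U V : Set (SeqExt X)} (h : ∀ w : List X, mk w ∈ U → mk w ∈ V) : U ⊆ V :=
  fun w hw => h w hw

theorem append_mem_prod {U V : Set (SeqExt X)} {u v : List X} (hu : mk u ∈ U) (hv : mk v ∈ V) :
    mk (u ++ v) ∈ prod U V := ⟨u, v, hu, hv, rfl⟩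

theorem nil_mem_star (D : Set X) : mk [] ∈ star D := by
  intro x hx; cases hx

theorem nil_mem_opt (D : Set X) : mk [] ∈ opt D := Or.inl rfl

theorem singleton_mem_opt {D : Set X} {x : X} : mk [x] ∈ opt D ↔ x ∈ D := by
  constructor
  · rintro (h | ⟨y, hy, h⟩)
    · cases h
    · cases h; exact hy
  · intro h; exact Or.inr ⟨x, h, rfl⟩

theorem cons_mem_star {D : Set X} {x : X} {w : List X} :
    mk (x :: w) ∈ star D ↔ x ∈ D ∧ mk w ∈ star D := List.forall_mem_cons

theorem prod_mono {U U' V V' : Set (SeqExt X)} (hU : U ⊆ U') (hV : V ⊆ V') :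
    prod U V ⊆ prod U' V' := by
  rintro w ⟨u, v, hu, hv, rfl⟩
  exact ⟨u, v, hU hu, hV hv, rfl⟩

theorem subset_prod_left {U V : Set (SeqExt X)} (hU : mk [] ∈ U) : V ⊆ prod U V :=
  fun w hw => ⟨[], w, hU, hw, rfl⟩

theorem subset_prod_right {U V : Set (SeqExt X)} (hV : mk [] ∈ V) : U ⊆ prod U V :=
  fun w hw => ⟨w, [], hw, hV, (List.append_nil w).symm⟩

theorem prod_assoc (U V W : Set (SeqExt X)) : prod (prod U V) W = prod U (prod V W) := by
  refine ext_mk fun w => ?_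
  constructor
  · rintro ⟨_, c, ⟨a, b, ha, hb, rfl⟩, hc, rfl⟩
    exact ⟨a, b ++ c, ha, ⟨b, c, hb, hc, rfl⟩, List.append_assoc _ _ _⟩
  · rintro ⟨a, _, ha, ⟨b, c, hb, hc, rfl⟩, rfl⟩
    exact ⟨a ++ b, c, ⟨a, b, ha, hb, rfl⟩, hc, (List.append_assoc _ _ _).symm⟩

theorem eps_prod (U : Set (SeqExt X)) : prod (eps X) U = U := by
  refine ext_mk fun w => ?_
  constructor
  · rintro ⟨a, b, ha, hb, rfl⟩
    cases (show a = [] from ha)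
    exact hb
  · intro h; exact ⟨[], w, rfl, h, rfl⟩

theorem prod_eps (U : Set (SeqExt X)) : prod U (eps X) = U := by
  refine ext_mk fun w => ?_
  constructor
  · rintro ⟨a, b, ha, hb, rfl⟩
    cases (show b = [] from hb)
    exact (List.append_nil a).symm ▸ ha
  · intro h; exact ⟨w, [], h, rfl, (List.append_nil w).symm⟩

theorem prod_union (U V W : Set (SeqExt X)) : prod U (V ∪ W) = prod U V ∪ prod U W := by
  refine ext_mk fun w => ?_
  constructor
  · rintro ⟨a, b, ha, hb | hb, rfl⟩
    exacts [Or.inl ⟨a, b, ha, hb, rfl⟩, Or.inr ⟨a, b, ha, hb, rfl⟩]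
  · rintro (⟨a, b, ha, hb, rfl⟩ | ⟨a, b, ha, hb, rfl⟩)
    exacts [⟨a, b, ha, Or.inl hb, rfl⟩, ⟨a, b, ha, Or.inr hb, rfl⟩]

theorem star_empty : star (∅ : Set X) = eps X := by
  refine ext_mk fun w => ?_
  exact List.eq_nil_iff_forall_not_mem.symm

/-- Membership in a product `D* P` is decided by looking at the first letter. -/
theorem cons_mem_star_prod {D : Set X} {P : Set (SeqExt X)} {x : X} {w : List X} :
    mk (x :: w) ∈ prod (star D) P ↔ mk (x :: w) ∈ P ∨ x ∈ D ∧ mk w ∈ prod (star D) P := by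
  constructor
  · rintro ⟨u, v, hu, hv, h⟩
    cases u with
    | nil => exact Or.inl (h ▸ hv)
    | cons y u =>
      obtain ⟨rfl, rfl⟩ := List.cons.inj h
      have hu := cons_mem_star.1 hu
      exact Or.inr ⟨hu.1, u, v, hu.2, hv, rfl⟩
  · rintro (h | ⟨hx, u, v, hu, hv, rfl⟩)
    · exact subset_prod_left (nil_mem_star D) h
    · exact ⟨x :: u, v, cons_mem_star.2 ⟨hx, hu⟩, hv, rfl⟩

theorem nil_mem_prod {U V : Set (SeqExt X)} :
    mk [] ∈ prod U V ↔ mk [] ∈ U ∧ mk [] ∈ V := by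
  constructor
  · rintro ⟨u, v, hu, hv, h⟩
    obtain ⟨rfl, rfl⟩ := List.append_eq_nil_iff.1 h.symm
    exact ⟨hu, hv⟩
  · rintro ⟨h, h'⟩; exact ⟨[], [], h, h', rfl⟩

/-- Membership in a product `(I + ε) P` is decided by looking at the first letter. -/
theorem cons_mem_opt_prod {D : Set X} {P : Set (SeqExt X)} {x : X} {w : List X} :
    mk (x :: w) ∈ prod (opt D) P ↔ mk (x :: w) ∈ P ∨ x ∈ D ∧ mk w ∈ P := by
  constructor
  · rintro ⟨u, v, rfl | ⟨y, hy, rfl⟩, hv, h⟩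
    · exact Or.inl (h ▸ hv)
    · obtain ⟨rfl, rfl⟩ := List.cons.inj h
      exact Or.inr ⟨hy, hv⟩
  · rintro (h | ⟨hx, h⟩)
    · exact subset_prod_left (nil_mem_opt D) h
    · exact ⟨[x], w, singleton_mem_opt.2 hx, h, rfl⟩

theorem nil_mem_star_prod {D : Set X} {P : Set (SeqExt X)} :
    mk [] ∈ prod (star D) P ↔ mk [] ∈ P := by
  simp [nil_mem_prod, nil_mem_star]

theorem nil_mem_opt_prod {D : Set X} {P : Set (SeqExt X)} :
    mk [] ∈ prod (opt D) P ↔ mk [] ∈ P := by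
  simp [nil_mem_prod, nil_mem_opt]

theorem star_prod_star_prod_subset {D E : Set X} (h : D ⊆ E) (P : Set (SeqExt X)) :
    prod (star D) (prod (star E) P) ⊆ prod (star E) P := by
  rw [← prod_assoc]
  refine prod_mono ?_ subset_rfl
  rintro _ ⟨u, v, hu, hv, rfl⟩ x hx
  rcases List.mem_append.1 hx with hx | hx
  exacts [h (hu x hx), hv x hx]

theorem opt_subset_star {D E : Set X} (h : D ⊆ E) : opt D ⊆ star E := by
  rintro w (rfl | ⟨x, hx, rfl⟩)
  · exact nil_mem_star E
  · exact cons_mem_star.2 ⟨h hx, nil_mem_star E⟩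

/-- The summand `S` on the right-hand side matters only if the union is empty. -/
theorem opt_iUnion_prod {ι : Type*} (L : List ι) (I : ι → Set X) (S : Set (SeqExt X)) :
    prod (opt {x | ∃ i ∈ L, x ∈ I i}) S = S ∪ {w | ∃ i ∈ L, w ∈ prod (opt (I i)) S} := by
  refine ext_mk fun w => ?_
  constructor
  · rintro ⟨u, v, hu, hv, rfl⟩
    rcases hu with hu | ⟨x, ⟨i, hi, hx⟩, hu⟩ <;> subst hu
    · exact Or.inl hv
    · exact Or.inr ⟨i, hi, [x], v, singleton_mem_opt.2 hx, hv, rfl⟩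
  · rintro (h | ⟨i, hi, u, v, hu, hv, rfl⟩)
    · exact subset_prod_left (nil_mem_opt _) h
    · rcases hu with hu | ⟨x, hx, hu⟩ <;> subst hu
      · exact subset_prod_left (nil_mem_opt _) hv
      · exact ⟨[x], v, singleton_mem_opt.2 ⟨i, hi, hx⟩, hv, rfl⟩

/-! ### Inclusion of atoms -/

theorem star_subset_star {D E : Set X} : star D ⊆ star E ↔ D ⊆ E := by
  constructor
  · intro h x hx
    have h1 : mk [x] ∈ star D := cons_mem_star.2 ⟨hx, nil_mem_star D⟩
    exact (cons_mem_star.1 (h h1)).1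
  · exact fun h w hw x hx => h (hw x hx)

theorem opt_subset_opt {I J : Set X} : opt I ⊆ opt J ↔ I ⊆ J := by
  constructor
  · intro h x hx
    exact singleton_mem_opt.1 (h (singleton_mem_opt.2 hx))
  · rintro h w (rfl | ⟨x, hx, rfl⟩)
    · exact nil_mem_opt J
    · exact singleton_mem_opt.2 (h hx)

theorem opt_subset_star_iff {I D : Set X} : opt I ⊆ star D ↔ I ⊆ D := by
  refine ⟨fun h x hx => ?_, opt_subset_star⟩
  exact (cons_mem_star.1 (h (singleton_mem_opt.2 hx))).1

theorem star_subset_opt {D I : Set X} : star D ⊆ opt I ↔ D = ∅ := by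
  constructor
  · intro h
    refine Set.eq_empty_of_forall_notMem fun x hx => ?_
    have h1 : mk [x, x] ∈ star D :=
      cons_mem_star.2 ⟨hx, cons_mem_star.2 ⟨hx, nil_mem_star D⟩⟩
    rcases h h1 with h | ⟨y, _, h⟩ <;> cases h
  · rintro rfl
    rw [star_empty]
    exact fun w hw => Or.inl hw

/-! ### Intersection of ideals -/

theorem star_prod_inter_star_prod (D E : Set X) (P Q : Set (SeqExt X)) :
    prod (star D) P ∩ prod (star E) Q =
      prod (star (D ∩ E)) ((prod (star D) P ∩ Q) ∪ (P ∩ prod (star E) Q)) := by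
  apply Set.Subset.antisymm
  · rintro w
    induction w with
    | nil =>
      rintro ⟨h, h'⟩
      exact nil_mem_star_prod.2 (Or.inl ⟨h, nil_mem_star_prod.1 h'⟩)
    | cons x w ih =>
      rintro ⟨h, h'⟩
      refine cons_mem_star_prod.2 ?_
      rcases cons_mem_star_prod.1 h with h1 | h1
      · exact Or.inl (Or.inr ⟨h1, h'⟩)
      rcases cons_mem_star_prod.1 h' with h2 | h2
      · exact Or.inl (Or.inl ⟨h, h2⟩)
      exact Or.inr ⟨⟨h1.1, h2.1⟩, ih ⟨h1.2, h2.2⟩⟩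
  · rw [prod_union]
    have hD := star_prod_star_prod_subset (Set.inter_subset_left : D ∩ E ⊆ D) P
    have hE := star_prod_star_prod_subset (Set.inter_subset_right : D ∩ E ⊆ E) Q
    refine Set.union_subset (Set.subset_inter ?_ ?_) (Set.subset_inter ?_ ?_)
    · exact (prod_mono subset_rfl Set.inter_subset_left).trans hD
    · exact (prod_mono subset_rfl
        (Set.inter_subset_right.trans (subset_prod_left (nil_mem_star E)))).trans hE
    · exact (prod_mono subset_rfl
        (Set.inter_subset_left.trans (subset_prod_left (nil_mem_star D)))).trans hD
    · exact (prod_mono subset_rfl Set.inter_subset_right).trans hE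

theorem opt_prod_inter_opt_prod (I J : Set X) (P Q : Set (SeqExt X)) :
    prod (opt I) P ∩ prod (opt J) Q =
      (prod (opt I) P ∩ Q) ∪ (P ∩ prod (opt J) Q) ∪ prod (opt (I ∩ J)) (P ∩ Q) := by
  refine ext_mk fun w => ?_
  rcases w with _ | ⟨x, w⟩
  · have h1 := nil_mem_opt_prod (D := I) (P := P)
    have h2 := nil_mem_opt_prod (D := J) (P := Q)
    have h3 := nil_mem_opt_prod (D := I ∩ J) (P := P ∩ Q)
    simp only [Set.mem_union, Set.mem_inter_iff] at *
    tauto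
  · have h1 := cons_mem_opt_prod (D := I) (P := P) (x := x) (w := w)
    have h2 := cons_mem_opt_prod (D := J) (P := Q) (x := x) (w := w)
    have h3 := cons_mem_opt_prod (D := I ∩ J) (P := P ∩ Q) (x := x) (w := w)
    simp only [Set.mem_union, Set.mem_inter_iff] at *
    tauto

theorem star_prod_inter_opt_prod (D I : Set X) (P Q : Set (SeqExt X)) :
    prod (star D) P ∩ prod (opt I) Q =
      (P ∩ prod (opt I) Q) ∪ prod (opt (D ∩ I)) (prod (star D) P ∩ Q) := by
  refine ext_mk fun w => ?_
  rcases w with _ | ⟨x, w⟩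
  · have h1 := nil_mem_star_prod (D := D) (P := P)
    have h2 := nil_mem_opt_prod (D := I) (P := Q)
    have h3 := nil_mem_opt_prod (D := D ∩ I) (P := prod (star D) P ∩ Q)
    simp only [Set.mem_union, Set.mem_inter_iff] at *
    tauto
  · have h1 := cons_mem_star_prod (D := D) (P := P) (x := x) (w := w)
    have h2 := cons_mem_opt_prod (D := I) (P := Q) (x := x) (w := w)
    have h3 := cons_mem_opt_prod (D := D ∩ I) (P := prod (star D) P ∩ Q) (x := x) (w := w)
    simp only [Set.mem_union, Set.mem_inter_iff] at *
    tauto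

/-! ### The operation `⊙` on sets of sequences -/

theorem odot_assoc (U V W : Set (SeqExt X)) : odot (odot U V) W = odot U (odot V W) := by
  simp only [odot, compl_compl, prod_assoc]

theorem mem_odot {U V : Set (SeqExt X)} {w : List X} :
    mk w ∈ odot U V ↔ ∀ u v : List X, w = u ++ v → mk u ∈ U ∨ mk v ∈ V := by
  constructor
  · intro h u v hw
    by_contra! hc
    exact h ⟨u, v, hc.1, hc.2, hw⟩
  · rintro h ⟨u, v, hu, hv, hw⟩
    exact (h u v hw).elim hu hv

theorem odot_univ (U : Set (SeqExt X)) : odot U Set.univ = Set.univ :=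
  Set.eq_univ_of_forall fun _ => mem_odot.2 fun _ _ _ => Or.inr trivial

theorem univ_odot (U : Set (SeqExt X)) : odot Set.univ U = Set.univ :=
  Set.eq_univ_of_forall fun _ => mem_odot.2 fun _ _ _ => Or.inl trivial

theorem empty_odot {V : Set (SeqExt X)} (hV : mk [] ∉ V) : odot ∅ V = ∅ :=
  Set.eq_empty_of_forall_notMem fun w hw =>
    (mem_odot.1 hw w [] (List.append_nil _).symm).elim id hV

theorem odot_empty {U : Set (SeqExt X)} (hU : mk [] ∉ U) : odot U ∅ = ∅ :=
  Set.eq_empty_of_forall_notMem fun w hw => (mem_odot.1 hw [] w rfl).elim hU id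

end Basic

section Order

variable {X : Type u} [Preorder X]

/-! ### The embedding ordering -/

/-- The embedding relation on lists, which is the ordering of `SeqExt X`. -/
abbrev Emb (u v : List X) : Prop := List.SublistForall₂ (· ≤ ·) u v

theorem le_def {u v : List X} :
    mk u ≤ mk v ↔ Emb u v := Iff.rfl

theorem mem_fil {w t : List X} :
    mk t ∈ fil w ↔ Emb w t := Iff.rfl

theorem emb_refl (u : List X) : Emb u u :=
  refl_of (List.SublistForall₂ (α := X) (β := X) (· ≤ ·)) u

theorem emb_trans {u v w : List X} (h : Emb u v)
    (h' : Emb v w) : Emb u w :=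
  trans_of (List.SublistForall₂ (α := X) (β := X) (· ≤ ·)) h h'

theorem emb_nil {u : List X} : Emb u ([] : List X) ↔ u = [] := by
  constructor
  · intro h; cases h; rfl
  · rintro rfl; exact .nil

theorem cons_emb_cons {x y : X} {v w : List X} :
    Emb (x :: v) (y :: w) ↔
      x ≤ y ∧ Emb v w ∨ Emb (x :: v) w := by
  constructor
  · intro h
    cases h with
    | cons h h' => exact Or.inl ⟨h, h'⟩
    | cons_right h => exact Or.inr h
  · rintro (⟨h, h'⟩ | h)
    exacts [.cons h h', .cons_right h]

theorem emb_of_sublist {u v : List X} (h : u.Sublist v) : Emb u v :=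
  List.sublistForall₂_iff.2 ⟨u, List.forall₂_refl u, h⟩

theorem emb_of_cons_emb {x : X} {v w : List X} (h : Emb (x :: v) w) :
    Emb v w :=
  emb_trans (emb_of_sublist (List.sublist_cons_self x v)) h

theorem emb_append {u u' v v' : List X} (h : Emb u u')
    (h' : Emb v v') :
    Emb (u ++ v) (u' ++ v') := by
  induction h with
  | nil =>
    exact emb_trans h' (emb_of_sublist (List.sublist_append_right _ _))
  | cons h _ ih => exact .cons h ih
  | cons_right _ ih => exact .cons_right ih

/-- What embeds in a concatenation splits accordingly. -/
theorem emb_append_right {u v w : List X} (h : Emb u (v ++ w)) :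
    ∃ u₁ u₂, u = u₁ ++ u₂ ∧ Emb u₁ v ∧
      Emb u₂ w := by
  induction v generalizing u with
  | nil => exact ⟨[], u, rfl, .nil, h⟩
  | cons x v ih =>
    cases h with
    | nil => exact ⟨[], [], rfl, .nil, .nil⟩
    | cons hx h =>
      obtain ⟨u₁, u₂, rfl, h1, h2⟩ := ih h
      exact ⟨_ :: u₁, u₂, rfl, .cons hx h1, h2⟩
    | cons_right h =>
      obtain ⟨u₁, u₂, rfl, h1, h2⟩ := ih h
      exact ⟨u₁, u₂, rfl, .cons_right h1, h2⟩

/-- A concatenation embeds in `w` only by splitting `w`. -/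
theorem append_emb {u v w : List X} (h : Emb (u ++ v) w) :
    ∃ w₁ w₂, w = w₁ ++ w₂ ∧ Emb u w₁ ∧
      Emb v w₂ := by
  induction w generalizing u with
  | nil =>
    obtain ⟨rfl, rfl⟩ := List.append_eq_nil_iff.1 (emb_nil.1 h)
    exact ⟨[], [], rfl, .nil, .nil⟩
  | cons y w ih =>
    cases u with
    | nil => exact ⟨[], y :: w, rfl, .nil, h⟩
    | cons x u =>
      rcases cons_emb_cons.1 h with ⟨hx, h⟩ | h
      · obtain ⟨w₁, w₂, rfl, h1, h2⟩ := ih h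
        exact ⟨y :: w₁, w₂, rfl, .cons hx h1, h2⟩
      · obtain ⟨w₁, w₂, rfl, h1, h2⟩ := ih (u := x :: u) h
        exact ⟨y :: w₁, w₂, rfl, .cons_right h1, h2⟩

theorem singleton_emb {x : X} {w : List X} :
    Emb [x] w ↔ ∃ y ∈ w, x ≤ y := by
  induction w with
  | nil => simp [emb_nil]
  | cons y w ih =>
    rw [cons_emb_cons, ih]
    simp [List.SublistForall₂.nil]

theorem append_singleton_emb {a z : X} {v s : List X}
    (h : Emb (v ++ [a]) (s ++ [z])) :
    Emb (v ++ [a]) s ∨ Emb v s ∧ a ≤ z := by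
  obtain ⟨p, q, hpq, hp, hq⟩ := emb_append_right h
  rcases List.eq_nil_or_concat' q with rfl | ⟨q, b, rfl⟩
  · rw [List.append_nil] at hpq; subst hpq; exact Or.inl hp
  · rw [← List.append_assoc] at hpq
    obtain ⟨rfl, h2⟩ := List.append_inj' hpq rfl
    obtain rfl : a = b := by simpa using h2
    cases q with
    | nil =>
      right
      rw [List.nil_append, singleton_emb] at hq
      obtain ⟨y, hy, hay⟩ := hq
      rw [List.mem_singleton] at hy
      exact ⟨by simpa using hp, hy ▸ hay⟩
    | cons c q =>
      rcases cons_emb_cons.1 hq with ⟨_, h⟩ | h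
      · exact absurd (emb_nil.1 h) (by simp)
      · exact absurd (emb_nil.1 h) (by simp)

theorem isLowerSet_eps : IsLowerSet (eps X) := by
  intro a b h hb
  cases (show a = ([] : List X) from hb)
  exact emb_nil.1 h

theorem isLowerSet_prod {U V : Set (SeqExt X)} (hU : IsLowerSet U) (hV : IsLowerSet V) :
    IsLowerSet (prod U V) := by
  rintro _ b h ⟨u, v, hu, hv, rfl⟩
  obtain ⟨u', v', rfl, h1, h2⟩ := emb_append_right (le_def.1 h)
  exact ⟨u', v', hU h1 hu, hV h2 hv, rfl⟩

theorem isUpperSet_fil (w : List X) : IsUpperSet (fil w) := isUpperSet_Ici _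

theorem isLowerSet_star {D : Set X} (hD : IsLowerSet D) : IsLowerSet (star D) := by
  intro w v h hw
  induction (le_def.1 h) with
  | nil => exact nil_mem_star D
  | cons h' h'' ih =>
    have hw := cons_mem_star.1 hw
    exact cons_mem_star.2 ⟨hD h' hw.1, ih h'' hw.2⟩
  | cons_right h' ih => exact ih h' (cons_mem_star.1 hw).2

theorem isLowerSet_opt {D : Set X} (hD : IsLowerSet D) : IsLowerSet (opt D) := by
  rintro w v h (rfl | ⟨x, hx, rfl⟩)
  · exact Or.inl (emb_nil.1 h)
  · cases (le_def.1 h) with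
    | nil => exact nil_mem_opt D
    | cons h' h'' =>
      obtain rfl := emb_nil.1 h''
      exact singleton_mem_opt.2 (hD h' hx)
    | cons_right h' => exact Or.inl (emb_nil.1 h')

theorem mem_of_cons_mem {P : Set (SeqExt X)} (hP : IsLowerSet P) {x : X} {w : List X}
    (h : mk (x :: w) ∈ P) : mk w ∈ P :=
  hP (le_def.2 (emb_of_sublist (List.sublist_cons_self x w))) h

theorem nil_mem_of_ideal {P : Set (SeqExt X)} (hP : Order.IsIdeal P) : mk [] ∈ P := by
  obtain ⟨w, hw⟩ := hP.Nonempty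
  exact hP.IsLowerSet (le_def.2 .nil) hw

theorem eps_subset_of_ideal {P : Set (SeqExt X)} (hP : Order.IsIdeal P) : eps X ⊆ P := by
  intro w hw
  cases (show w = ([] : List X) from hw)
  exact nil_mem_of_ideal hP

theorem fil_nil : fil ([] : List X) = Set.univ := Set.eq_univ_of_forall fun _ => .nil

theorem fil_prod_fil (u v : List X) : prod (fil u) (fil v) = fil (u ++ v) := by
  refine ext_mk fun w => ?_
  constructor
  · rintro ⟨a, b, ha, hb, rfl⟩; exact emb_append ha hb
  · intro h
    obtain ⟨a, b, rfl, ha, hb⟩ := append_emb (mem_fil.1 h)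
    exact ⟨a, b, ha, hb, rfl⟩

/-! ### Complement of a filter -/

theorem compl_fil_singleton (x : X) : (fil [x])ᶜ = star (Set.Ici x)ᶜ := by
  refine ext_mk fun w => ?_
  rw [Set.mem_compl_iff, mem_fil, singleton_emb]
  simp only [not_exists, not_and]
  rfl

theorem compl_fil_cons (x : X) {v : List X} (hv : v ≠ []) :
    (fil (x :: v))ᶜ = prod (star (Set.Ici x)ᶜ) (prod (opt Set.univ) (fil v)ᶜ) := by
  refine ext_mk fun w => ?_
  have hN : IsLowerSet (fil v)ᶜ := (isUpperSet_fil v).compl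
  induction w with
  | nil =>
    have h1 : mk [] ∈ (fil (x :: v))ᶜ := fun h => by cases emb_nil.1 (mem_fil.1 h)
    have h2 : mk [] ∈ (fil v)ᶜ := fun h => hv (emb_nil.1 (mem_fil.1 h))
    exact iff_of_true h1 (nil_mem_star_prod.2 (nil_mem_opt_prod.2 h2))
  | cons y w ih =>
    have h1 := cons_mem_star_prod (D := (Set.Ici x)ᶜ) (P := prod (opt Set.univ) (fil v)ᶜ)
      (x := y) (w := w)
    have h2 := cons_mem_opt_prod (D := Set.univ) (P := (fil v)ᶜ) (x := y) (w := w)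
    have h3 : mk (y :: w) ∈ (fil v)ᶜ → mk w ∈ (fil v)ᶜ := mem_of_cons_mem hN
    have h4 := cons_emb_cons (x := x) (y := y) (v := v) (w := w)
    have h5 : Emb (x :: v) w → Emb v w :=
      emb_of_cons_emb
    simp only [Set.mem_compl_iff, mem_fil, Set.mem_univ, true_and, Set.mem_Ici] at *
    rw [h1, h2, h4]
    tauto

/-- A variant of the two preceding formulas that needs no case distinction. -/
theorem compl_fil_cons_eq_union (x : X) (v : List X) :
    (fil (x :: v))ᶜ = star (Set.Ici x)ᶜ ∪
      prod (star (Set.Ici x)ᶜ) (prod (opt Set.univ) (fil v)ᶜ) := by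
  by_cases hv : v = []
  · subst hv
    have h : prod (star (Set.Ici x)ᶜ) (prod (opt Set.univ) ∅) = ∅ :=
      Set.eq_empty_of_forall_notMem fun _ ⟨_, _, _, ⟨_, _, _, h, _⟩, _⟩ => h
    rw [fil_nil, Set.compl_univ, h, Set.union_empty, compl_fil_singleton]
  · rw [compl_fil_cons x hv, eq_comm, Set.union_eq_right]
    have h : mk [] ∈ (fil v)ᶜ := fun h => hv (emb_nil.1 (mem_fil.1 h))
    exact subset_prod_right (nil_mem_opt_prod.2 h)

/-! ### Intersection of filters -/

theorem isUpperSet_upLetters (S : Set X) : IsUpperSet (upLetters S) := by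
  rintro a b h ⟨x, hx, ha⟩
  exact ⟨x, hx, isUpperSet_fil _ h ha⟩

theorem cons_mem_prod_of_mem {U V : Set (SeqExt X)} (hU : IsUpperSet U) {x : X} {w : List X}
    (h : mk w ∈ prod U V) : mk (x :: w) ∈ prod U V := by
  obtain ⟨u, v, hu, hv, rfl⟩ := h
  exact ⟨x :: u, v, hU (le_def.2 (emb_of_sublist (List.sublist_cons_self x u))) hu, hv, rfl⟩

theorem prod_subset_right_of_isUpperSet {U V : Set (SeqExt X)} (hV : IsUpperSet V) :
    prod U V ⊆ V := by
  rintro _ ⟨u, v, _, hv, rfl⟩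
  exact hV (le_def.2 (emb_of_sublist (List.sublist_append_right u v))) hv

theorem fil_cons_inter_fil_cons (x y : X) (v w : List X) :
    fil (x :: v) ∩ fil (y :: w) =
      prod (fil [x]) (fil v ∩ fil (y :: w)) ∪ prod (fil [y]) (fil (x :: v) ∩ fil w) ∪
        prod (upLetters (Set.Ici x ∩ Set.Ici y)) (fil v ∩ fil w) := by
  have hx : ∀ z : X, x ≤ z → mk [z] ∈ fil [x] := fun z h => List.SublistForall₂.cons h .nil
  have hy : ∀ z : X, y ≤ z → mk [z] ∈ fil [y] := fun z h => List.SublistForall₂.cons h .nil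
  apply Set.Subset.antisymm
  · intro t
    induction t with
    | nil => rintro ⟨h, _⟩; cases emb_nil.1 (mem_fil.1 h)
    | cons z t ih =>
      rintro ⟨h1, h2⟩
      rcases cons_emb_cons.1 (mem_fil.1 h1) with ⟨hxz, hv⟩ | hv <;>
        rcases cons_emb_cons.1 (mem_fil.1 h2) with ⟨hyz, hw⟩ | hw
      · exact Or.inr ⟨[z], t, ⟨z, ⟨hxz, hyz⟩, emb_refl _⟩, ⟨hv, hw⟩, rfl⟩
      · exact Or.inl (Or.inl ⟨[z], t, hx z hxz, ⟨hv, hw⟩, rfl⟩)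
      · exact Or.inl (Or.inr ⟨[z], t, hy z hyz, ⟨hv, hw⟩, rfl⟩)
      · rcases ih ⟨hv, hw⟩ with (h | h) | h
        · exact Or.inl (Or.inl (cons_mem_prod_of_mem (isUpperSet_fil _) h))
        · exact Or.inl (Or.inr (cons_mem_prod_of_mem (isUpperSet_fil _) h))
        · exact Or.inr (cons_mem_prod_of_mem (isUpperSet_upLetters _) h)
  · have key : ∀ (z : X) (u : List X), prod (fil [z]) (fil u) = fil (z :: u) :=
      fun z u => fil_prod_fil [z] u
    refine Set.union_subset (Set.union_subset ?_ ?_) ?_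
    · refine Set.subset_inter ?_ ?_
      · rw [← key x v]; exact prod_mono subset_rfl Set.inter_subset_left
      · exact (prod_mono subset_rfl Set.inter_subset_right).trans
          (prod_subset_right_of_isUpperSet (isUpperSet_fil _))
    · refine Set.subset_inter ?_ ?_
      · exact (prod_mono subset_rfl Set.inter_subset_left).trans
          (prod_subset_right_of_isUpperSet (isUpperSet_fil _))
      · rw [← key y w]; exact prod_mono subset_rfl Set.inter_subset_right
    · refine Set.subset_inter ?_ ?_
      · rw [← key x v]
        exact prod_mono (fun t ⟨s, hs, ht⟩ => emb_trans (.cons hs.1 .nil) ht)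
          Set.inter_subset_left
      · rw [← key y w]
        exact prod_mono (fun t ⟨s, hs, ht⟩ => emb_trans (.cons hs.2 .nil) ht)
          Set.inter_subset_right

/-! ### Complement of an ideal -/

/-- The set `S` is a set of generators of the complement of `D`. -/
theorem compl_star {D : Set X} {S : Set X} (h : Dᶜ = {y | ∃ a ∈ S, a ≤ y}) :
    (star D)ᶜ = {w | ∃ a ∈ S, w ∈ fil [a]} := by
  have h' : ∀ y, y ∉ D ↔ ∃ a ∈ S, a ≤ y := fun y => Set.ext_iff.1 h y
  refine ext_mk fun w => ?_
  constructor
  · intro hw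
    have : ∃ y ∈ (show List X from w), y ∉ D := by
      by_contra! hc; exact hw hc
    obtain ⟨y, hy, hyD⟩ := this
    obtain ⟨a, ha, hay⟩ := (h' y).1 hyD
    exact ⟨a, ha, singleton_emb.2 ⟨y, hy, hay⟩⟩
  · rintro ⟨a, ha, haw⟩ hw
    obtain ⟨y, hy, hay⟩ := singleton_emb.1 (mem_fil.1 haw)
    exact (h' y).2 ⟨a, ha, hay⟩ (hw y hy)

/-- The complement of `I + ε` consists of the sequences that have a letter outside `I` and of those
of length at least two; the latter are generated by the pairs of generators of `X`. -/
theorem compl_opt {I : Set X} {S T : Set X} (h : Iᶜ = {y | ∃ b ∈ S, b ≤ y})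
    (hT : Set.univ = {y | ∃ c ∈ T, c ≤ y}) :
    (opt I)ᶜ = {w | ∃ b ∈ S, w ∈ fil [b]} ∪ {w | ∃ c ∈ T, ∃ d ∈ T, w ∈ fil [c, d]} := by
  have h' : ∀ y, y ∉ I ↔ ∃ a ∈ S, a ≤ y := fun y => Set.ext_iff.1 h y
  have hT' : ∀ y, ∃ c ∈ T, c ≤ y := fun y => (Set.ext_iff.1 hT y).1 trivial
  refine ext_mk fun w => ⟨fun hw => ?_, ?_⟩
  · rcases w with _ | ⟨y, _ | ⟨z, w⟩⟩
    · exact (hw (nil_mem_opt I)).elim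
    · obtain ⟨b, hb, hby⟩ := (h' y).1 fun hy => hw (singleton_mem_opt.2 hy)
      exact Or.inl ⟨b, hb, .cons hby .nil⟩
    · obtain ⟨c, hc, hcy⟩ := hT' y
      obtain ⟨d, hd, hdz⟩ := hT' z
      exact Or.inr ⟨c, hc, d, hd, .cons hcy (.cons hdz .nil)⟩
  · rintro (⟨b, hb, hw⟩ | ⟨c, _, d, _, hw⟩) (hn | ⟨y, hy, hn⟩)
    · cases (show w = [] from hn)
      cases emb_nil.1 (mem_fil.1 hw)
    · cases (show w = [y] from hn)
      obtain ⟨z, hz, hbz⟩ := singleton_emb.1 (mem_fil.1 hw)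
      rw [List.mem_singleton] at hz
      exact (h' y).2 ⟨b, hb, hz ▸ hbz⟩ hy
    · cases (show w = [] from hn)
      cases emb_nil.1 (mem_fil.1 hw)
    · cases (show w = [y] from hn)
      rcases cons_emb_cons.1 (mem_fil.1 hw) with ⟨_, h⟩ | h <;> cases emb_nil.1 h

theorem isUpperSet_odot {U V : Set (SeqExt X)} (hU : IsUpperSet U) (hV : IsUpperSet V) :
    IsUpperSet (odot U V) :=
  (isLowerSet_prod hU.compl hV.compl).compl

/-- If one splitting of a sequence refutes membership in `U ⊙ W` and another one refutes
membership in `V ⊙ W`, then the one that is further to the left refutes membership in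
`(U ∪ V) ⊙ W`, because its left part lies outside both `U` and `V`. -/
theorem union_odot {U V W : Set (SeqExt X)} (hU : IsUpperSet U) (hV : IsUpperSet V) :
    odot (U ∪ V) W = odot U W ∪ odot V W := by
  refine ext_mk fun w => ⟨fun h => ?_, ?_⟩
  · by_contra hc
    rw [Set.mem_union, mem_odot, mem_odot] at hc
    push Not at hc
    obtain ⟨⟨a, b, rfl, ha, hb⟩, c, d, hcd, hc, hd⟩ := hc
    rcases List.append_eq_append_iff.1 hcd with ⟨t, rfl, rfl⟩ | ⟨t, rfl, rfl⟩
    · rcases mem_odot.1 h a (t ++ d) rfl with (h | h) | h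
      · exact ha h
      · exact hc (hV (le_def.2 (emb_of_sublist (List.sublist_append_left a t))) h)
      · exact hb h
    · rcases mem_odot.1 h c (t ++ b) hcd with (h | h) | h
      · exact ha (hU (le_def.2 (emb_of_sublist (List.sublist_append_left c t))) h)
      · exact hc h
      · exact hd h
  · rintro (h | h) <;> refine mem_odot.2 fun u v hw => ?_
    · exact (mem_odot.1 h u v hw).imp Or.inl id
    · exact (mem_odot.1 h u v hw).imp Or.inr id

theorem odot_union {U V W : Set (SeqExt X)} (hU : IsUpperSet U) (hV : IsUpperSet V) :
    odot W (U ∪ V) = odot W U ∪ odot W V := by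
  refine ext_mk fun w => ⟨fun h => ?_, ?_⟩
  · by_contra hc
    rw [Set.mem_union, mem_odot, mem_odot] at hc
    push Not at hc
    obtain ⟨⟨a, b, rfl, ha, hb⟩, c, d, hcd, hc, hd⟩ := hc
    rcases List.append_eq_append_iff.1 hcd with ⟨t, rfl, rfl⟩ | ⟨t, rfl, rfl⟩
    · rcases mem_odot.1 h (a ++ t) d hcd with h | h | h
      · exact hc h
      · exact hb (hU (le_def.2 (emb_of_sublist (List.sublist_append_right t d))) h)
      · exact hd h
    · rcases mem_odot.1 h (c ++ t) b rfl with h | h | h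
      · exact ha h
      · exact hb h
      · exact hd (hV (le_def.2 (emb_of_sublist (List.sublist_append_right t b))) h)
  · rintro (h | h) <;> refine mem_odot.2 fun u v hw => ?_
    · exact (mem_odot.1 h u v hw).imp id Or.inl
    · exact (mem_odot.1 h u v hw).imp id Or.inr

/-- Finite unions that may be empty; then the assumption `[] ∉ V` is needed. -/
theorem iUnion_odot {ι : Type*} (L : List ι) {U : ι → Set (SeqExt X)} {V : Set (SeqExt X)}
    (hU : ∀ i ∈ L, IsUpperSet (U i)) (hV : mk [] ∉ V) :
    odot {w | ∃ i ∈ L, w ∈ U i} V = {w | ∃ i ∈ L, w ∈ odot (U i) V} := by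
  induction L with
  | nil => simpa using empty_odot hV
  | cons i L ih =>
    rw [List.forall_mem_cons] at hU
    have h : {w | ∃ j ∈ i :: L, w ∈ U j} = U i ∪ {w | ∃ j ∈ L, w ∈ U j} := by
      ext w; simp
    have h' : IsUpperSet {w | ∃ j ∈ L, w ∈ U j} :=
      fun _ _ hab ⟨j, hj, ha⟩ => ⟨j, hj, hU.2 j hj hab ha⟩
    rw [h, union_odot hU.1 h', ih hU.2]
    ext w
    simp

/-- Finite unions that may be empty; then the assumption `[] ∉ U` is needed. -/
theorem odot_iUnion {ι : Type*} (L : List ι) {V : ι → Set (SeqExt X)} {U : Set (SeqExt X)}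
    (hV : ∀ i ∈ L, IsUpperSet (V i)) (hU : mk [] ∉ U) :
    odot U {w | ∃ i ∈ L, w ∈ V i} = {w | ∃ i ∈ L, w ∈ odot U (V i)} := by
  induction L with
  | nil => simpa using odot_empty hU
  | cons i L ih =>
    rw [List.forall_mem_cons] at hV
    have h : {w | ∃ j ∈ i :: L, w ∈ V j} = V i ∪ {w | ∃ j ∈ L, w ∈ V j} := by
      ext w; simp
    have h' : IsUpperSet {w | ∃ j ∈ L, w ∈ V j} :=
      fun _ _ hab ⟨j, hj, ha⟩ => ⟨j, hj, hV.2 j hj hab ha⟩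
    rw [h, odot_union hV.1 h', ih hV.2]
    ext w
    simp

/-- Splitting of `t` at the letter `z` that completes the leftmost embedding of `u`. -/
theorem exists_shortest_prefix {u t : List X} (hu : u ≠ []) (h : Emb u t) :
    ∃ s z r, t = s ++ z :: r ∧ Emb u (s ++ [z]) ∧ ¬ Emb u s := by
  induction t using List.reverseRecOn with
  | nil => exact (hu (emb_nil.1 h)).elim
  | append_singleton t z ih =>
    by_cases h' : Emb u t
    · obtain ⟨s, y, r, rfl, h1, h2⟩ := ih h'
      exact ⟨s, y, r ++ [z], by simp, h1, h2⟩
    · exact ⟨t, z, [], rfl, h, h'⟩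

/-- For the inclusion from left to right, the sequence is split right before and right after the
letter that completes the leftmost embedding of `va`. -/
theorem fil_odot_fil (a b : X) (v w : List X) :
    odot (fil (v ++ [a])) (fil (b :: w)) =
      fil (v ++ [a, b] ++ w) ∪
        prod (fil v) (prod (upLetters (Set.Ici a ∩ Set.Ici b)) (fil w)) := by
  refine ext_mk fun t => ⟨fun h => ?_, ?_⟩
  · have ht : Emb (v ++ [a]) t := by
      refine (mem_odot.1 h t [] (List.append_nil t).symm).resolve_right fun h' => ?_
      cases emb_nil.1 (mem_fil.1 h')
    obtain ⟨s, z, r, rfl, h1, h2⟩ := exists_shortest_prefix (by simp) ht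
    obtain ⟨hv, haz⟩ := (append_singleton_emb h1).resolve_left h2
    have h3 := (mem_odot.1 h s (z :: r) rfl).resolve_left h2
    rcases cons_emb_cons.1 (mem_fil.1 h3) with ⟨hbz, hw⟩ | hw
    · exact Or.inr ⟨s, z :: r, hv, ⟨[z], r, ⟨z, ⟨haz, hbz⟩, emb_refl _⟩, hw, rfl⟩, rfl⟩
    · left
      have := emb_append h1 hw
      simpa [mem_fil] using this
  · rintro (h | ⟨p, _, hp, ⟨m, q, ⟨z, ⟨haz, hbz⟩, hm⟩, hq, rfl⟩, rfl⟩)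
    · -- a splitting of a sequence above `vabw` splits `vabw`, and either `va` lies in the first
      -- part or `bw` lies in the second one
      refine mem_odot.2 fun t₁ t₂ ht => ?_
      subst ht
      obtain ⟨p, q, hpq, hp, hq⟩ := emb_append_right (mem_fil.1 h)
      have hpq' : (v ++ [a]) ++ (b :: w) = p ++ q := by simpa using hpq
      rcases List.append_eq_append_iff.1 hpq' with ⟨r, rfl, _⟩ | ⟨r, _, rfl⟩
      · exact Or.inl (emb_trans (emb_of_sublist (List.sublist_append_left _ _)) hp)
      · exact Or.inr (emb_trans (emb_of_sublist (List.sublist_append_right _ _)) hq)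
    · -- `vzw` with `a ≤ z` and `b ≤ z`: the part that contains `z` is above `va` or above `bw`
      refine mem_odot.2 fun t₁ t₂ ht => ?_
      have h : Emb (v ++ ([z] ++ w)) (t₁ ++ t₂) := ht ▸ emb_append hp (emb_append hm hq)
      obtain ⟨p, q, hpq, hp, hq⟩ := emb_append_right h
      rcases List.append_eq_append_iff.1 hpq with ⟨r, rfl, hr⟩ | ⟨r, _, rfl⟩
      · cases r with
        | nil =>
          right
          have hr : q = z :: w := by simpa using hr.symm
          subst hr
          exact emb_trans (.cons hbz (emb_refl w)) hq
        | cons z' r =>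
          left
          have hr : z = z' ∧ w = r ++ q := by simpa using hr
          obtain ⟨rfl, rfl⟩ := hr
          refine emb_trans (emb_append (emb_refl v) ?_) hp
          exact .cons haz .nil
      · right
        refine emb_trans ?_ hq
        exact emb_trans (.cons hbz (emb_refl w)) (emb_of_sublist (List.sublist_append_right _ _))

end Order
end SeqExt

open SeqExt

theorem Atom.nil_mem_den {X : Type u} (A : Atom (Set X)) : mk [] ∈ A.den := by
  cases A with
  | opt I => exact nil_mem_opt I
  | star D => exact nil_mem_star D

/-- Unless both atoms provide at most one letter, `A ⊆ B` implies that `A (B Q) ⊆ B Q`. -/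
theorem prod_subset_prod_of_subset {A B : Atom (Set X)} {P Q : Set (SeqExt X)}
    (hAB : A.den ⊆ B.den) (h : ¬ ∃ I J, A = Atom.opt I ∧ B = Atom.opt J) :
    SeqExt.prod A.den P ⊆ SeqExt.prod B.den Q ↔ P ⊆ SeqExt.prod B.den Q := by
  refine ⟨(subset_prod_left A.nil_mem_den).trans, fun hP => ?_⟩
  cases B with
  | star E =>
    refine (prod_mono hAB hP).trans ?_
    exact star_prod_star_prod_subset subset_rfl Q
  | opt J =>
    cases A with
    | opt I => exact (h ⟨I, J, rfl, rfl⟩).elim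
    | star D =>
      have hD : D = ∅ := star_subset_opt.1 hAB
      subst hD
      change SeqExt.prod (star ∅) P ⊆ _
      rwa [star_empty, eps_prod]

theorem Atom.prod_cons (A : Atom (Set X)) (P : List (Atom (Set X))) :
    Atom.prod (A :: P) = SeqExt.prod A.den (Atom.prod P) := rfl

theorem Atom.compl_prod {X : Type u} (P : List (Atom (Set X))) :
    (Atom.prod P)ᶜ = P.foldr (fun A U => odot A.denᶜ U) (eps X)ᶜ := by
  induction P with
  | nil => rfl
  | cons A P ih => rw [List.foldr_cons, ← ih, odot, compl_compl, compl_compl, Atom.prod_cons]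

section

variable {X : Type u} [Preorder X]

/-! ### Ideals and well-quasi-orders -/

/-- An ideal that is covered by finitely many lower sets is contained in one of them. -/
theorem isIdeal_subset_of_subset_iUnion {I : Set X} (hI : Order.IsIdeal I) {L : List (Set X)}
    (hL : ∀ J ∈ L, IsLowerSet J) (h : ∀ x ∈ I, ∃ J ∈ L, x ∈ J) : ∃ J ∈ L, I ⊆ J := by
  induction L with
  | nil =>
    obtain ⟨x, hx⟩ := hI.Nonempty
    obtain ⟨J, hJ, _⟩ := h x hx
    cases hJ
  | cons J L ih =>
    by_cases hJ : I ⊆ J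
    · exact ⟨J, List.mem_cons_self, hJ⟩
    obtain ⟨x, hx, hxJ⟩ := Set.not_subset.1 hJ
    obtain ⟨K, hK, hIK⟩ := ih (fun K hK => hL K (List.mem_cons_of_mem _ hK)) fun y hy => by
      obtain ⟨z, hz, hxz, hyz⟩ := hI.Directed x hx y hy
      obtain ⟨K, hK, hzK⟩ := h z hz
      rcases List.mem_cons.1 hK with rfl | hK'
      · exact (hxJ (hL K hK hxz hzK)).elim
      · exact ⟨K, hK', hL K hK hyz hzK⟩
    exact ⟨K, List.mem_cons_of_mem _ hK, hIK⟩

/-- In a strictly decreasing sequence of lower sets, elements that leave the sets one after another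
form a bad sequence. -/
theorem wellFoundedLT_lowerSet [WellQuasiOrderedLE X] : WellFoundedLT (LowerSet X) := by
  refine ⟨RelEmbedding.wellFounded_iff_isEmpty.2 ⟨fun f => ?_⟩⟩
  have hlt : ∀ i j, i < j → f j < f i := fun i j h => f.map_rel_iff.2 h
  have hx : ∀ i, ∃ x, x ∈ f i ∧ x ∉ f (i + 1) := fun i =>
    Set.exists_of_ssubset (LowerSet.coe_ssubset_coe.2 (hlt i (i + 1) (Nat.lt_succ_self i)))
  choose x hx hx' using hx
  obtain ⟨i, j, hij, h⟩ := wellQuasiOrdered_le x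
  refine hx' i ((f (i + 1)).lower h ?_)
  rcases (Nat.succ_le_of_lt hij).eq_or_lt with h' | h'
  · rw [Nat.succ_eq_add_one] at h'; rw [h']; exact hx j
  · exact (hlt _ _ h').le (hx j)

/-- A lower set of a well-quasi-order that is not directed is the union of two smaller lower sets:
the complements in it of `↑x` and of `↑y`, where `x` and `y` have no common upper bound. -/
theorem exists_ideal_decomposition [WellQuasiOrderedLE X] (S : LowerSet X) :
    ∃ L : List (Set X), (∀ I ∈ L, Order.IsIdeal I) ∧ (S : Set X) = {x | ∃ I ∈ L, x ∈ I} := by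
  have := wellFoundedLT_lowerSet (X := X)
  induction S using WellFoundedLT.induction with
  | ind S ih =>
    by_cases hne : (S : Set X).Nonempty
    swap
    · refine ⟨[], by simp, ?_⟩
      rw [Set.not_nonempty_iff_eq_empty.1 hne]
      simp
    by_cases hd : DirectedOn (· ≤ ·) (S : Set X)
    · exact ⟨[S], by simpa using ⟨S.lower, hne, hd⟩, by simp⟩
    simp only [DirectedOn] at hd
    push Not at hd
    obtain ⟨x, hx, y, hy, hxy⟩ := hd
    have key : ∀ z ∈ (S : Set X),
        ∃ T : LowerSet X, (T : Set X) = (S : Set X) ∩ (Set.Ici z)ᶜ ∧ T < S := by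
      intro z hz
      refine ⟨⟨S ∩ (Set.Ici z)ᶜ, S.lower.inter (isUpperSet_Ici z).compl⟩, rfl, ?_⟩
      refine lt_of_le_of_ne (fun w hw => hw.1) fun h => ?_
      have hz' := hz
      rw [← h] at hz'
      exact hz'.2 le_rfl
    obtain ⟨T, hT, hTS⟩ := key x hx
    obtain ⟨T', hT', hTS'⟩ := key y hy
    obtain ⟨L, hL, hLT⟩ := ih T hTS
    obtain ⟨L', hL', hLT'⟩ := ih T' hTS'
    refine ⟨L ++ L', fun I hI => (List.mem_append.1 hI).elim (hL I) (hL' I), ?_⟩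
    have hS : (S : Set X) = (T : Set X) ∪ T' := by
      rw [hT, hT']
      ext z
      constructor
      · intro hz
        by_cases hxz : x ≤ z
        · exact Or.inr ⟨hz, fun hyz => hxy z hz hxz hyz⟩
        · exact Or.inl ⟨hz, hxz⟩
      · rintro (h | h) <;> exact h.1
    rw [hS, hLT, hLT']
    ext z
    simp only [Set.mem_union, Set.mem_ofPred_eq, List.mem_append, or_and_right, exists_or]

/-- As long as a finite subset of `U` does not generate `U`, it can be enlarged, and then the
complement of the filter that it generates gets smaller; these complements are lower sets. -/
theorem exists_finite_basis [WellQuasiOrderedLE X] {U : Set X} (hU : IsUpperSet U) :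
    ∃ L : List X, U = {y | ∃ x ∈ L, x ≤ y} := by
  have := wellFoundedLT_lowerSet (X := X)
  suffices h : ∀ (T : LowerSet X) (L : List X), (∀ x ∈ L, x ∈ U) →
      (T : Set X) = {y | ∃ x ∈ L, x ≤ y}ᶜ → ∃ L : List X, U = {y | ∃ x ∈ L, x ≤ y} from
    h ⊤ [] (by simp) (by simp)
  intro T
  induction T using WellFoundedLT.induction with
  | ind T ih =>
    intro L hL hT
    by_cases h : U ⊆ {y | ∃ x ∈ L, x ≤ y}
    · exact ⟨L, h.antisymm fun y ⟨x, hx, hxy⟩ => hU hxy (hL x hx)⟩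
    obtain ⟨z, hz, hz'⟩ := Set.not_subset.1 h
    refine ih ⟨{y | ∃ x ∈ z :: L, x ≤ y}ᶜ, ?_⟩ ?_ (z :: L) (by simpa using ⟨hz, hL⟩) rfl
    · exact IsUpperSet.compl fun a b hab ⟨x, hx, hxa⟩ => ⟨x, hx, hxa.trans hab⟩
    · refine lt_of_le_of_ne (fun w hw => ?_) fun he => ?_
      · rw [hT]
        exact fun ⟨x, hx, hxw⟩ => hw ⟨x, List.mem_cons_of_mem _ hx, hxw⟩
      · have hzT : z ∈ (T : Set X) := by rw [hT]; exact hz'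
        rw [← he] at hzT
        exact hzT ⟨z, List.mem_cons_self, le_rfl⟩

/-! ### Atoms and their products -/

namespace SeqExt

theorem isIdeal_eps : Order.IsIdeal (eps X) :=
  ⟨isLowerSet_eps, ⟨mk [], rfl⟩, fun a ha b hb => ⟨mk [], rfl, by
    rw [show a = mk [] from ha], by rw [show b = mk [] from hb]⟩⟩

theorem isIdeal_prod {P Q : Set (SeqExt X)} (hP : Order.IsIdeal P) (hQ : Order.IsIdeal Q) :
    Order.IsIdeal (prod P Q) := by
  refine ⟨isLowerSet_prod hP.IsLowerSet hQ.IsLowerSet,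
    ⟨mk [], nil_mem_prod.2 ⟨nil_mem_of_ideal hP, nil_mem_of_ideal hQ⟩⟩, ?_⟩
  rintro _ ⟨u, v, hu, hv, rfl⟩ _ ⟨u', v', hu', hv', rfl⟩
  obtain ⟨u'', hu'', h1, h2⟩ := hP.Directed u hu u' hu'
  obtain ⟨v'', hv'', h3, h4⟩ := hQ.Directed v hv v' hv'
  exact ⟨_, append_mem_prod hu'' hv'', emb_append h1 h3, emb_append h2 h4⟩

theorem isIdeal_star {D : Set X} (hD : IsLowerSet D) : Order.IsIdeal (star D) := by
  refine ⟨isLowerSet_star hD, ⟨mk [], nil_mem_star D⟩, fun (a : List X) ha (b : List X) hb =>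
    ⟨mk (a ++ b), fun x hx => ?_, ?_, ?_⟩⟩
  · exact (List.mem_append.1 hx).elim (ha x) (hb x)
  · exact emb_of_sublist (List.sublist_append_left _ _)
  · exact emb_of_sublist (List.sublist_append_right _ _)

theorem isIdeal_opt {I : Set X} (hI : Order.IsIdeal I) : Order.IsIdeal (opt I) := by
  refine ⟨isLowerSet_opt hI.IsLowerSet, ⟨mk [], nil_mem_opt I⟩, ?_⟩
  rintro a (rfl | ⟨x, hx, rfl⟩) b hb
  · exact ⟨b, hb, .nil, le_rfl⟩
  · rcases hb with rfl | ⟨y, hy, rfl⟩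
    · exact ⟨mk [x], singleton_mem_opt.2 hx, le_rfl, .nil⟩
    · obtain ⟨z, hz, hxz, hyz⟩ := hI.Directed x hx y hy
      exact ⟨mk [z], singleton_mem_opt.2 hz, .cons hxz .nil, .cons hyz .nil⟩

end SeqExt

theorem Atom.Valid.isIdeal {A : Atom (Set X)} (hA : A.Valid) : Order.IsIdeal A.den := by
  cases A with
  | opt I => exact isIdeal_opt hA
  | star D => exact isIdeal_star hA

theorem Atom.isIdeal_prod {P : List (Atom (Set X))} (hP : ∀ A ∈ P, A.Valid) :
    Order.IsIdeal (Atom.prod P) := by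
  induction P with
  | nil => exact isIdeal_eps
  | cons A P ih =>
    exact SeqExt.isIdeal_prod (hP A List.mem_cons_self).isIdeal
      (ih fun B hB => hP B (List.mem_cons_of_mem _ hB))

/-! ### Inclusion of ideals -/

theorem atom_prod_subset_eps {A : Atom (Set X)} {P : Set (SeqExt X)} (hA : A.Valid)
    (hP : Order.IsIdeal P) :
    SeqExt.prod A.den P ⊆ eps X ↔ A.den = star ∅ ∧ P ⊆ eps X := by
  constructor
  · intro h
    rw [star_empty]
    refine ⟨?_, (subset_prod_left A.nil_mem_den).trans h⟩
    exact ((subset_prod_right (nil_mem_of_ideal hP)).trans h).antisymm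
      (eps_subset_of_ideal hA.isIdeal)
  · rintro ⟨h, h'⟩
    rwa [h, star_empty, eps_prod]

/-- If `A` is not contained in `B`, then every element `w` of `A P` can be extended to an element
`z p` of `A P` such that `z p ∈ B Q` forces `w ∈ Q`: either `z` is not a letter of `B`, or `w = p`
and `B` provides at most one letter. -/
theorem prod_subset_prod_of_not_subset {A B : Atom (Set X)} {P Q : Set (SeqExt X)}
    (hA : A.Valid) (hB : B.Valid) (hQ : IsLowerSet Q) (hAB : ¬ A.den ⊆ B.den) :
    SeqExt.prod A.den P ⊆ SeqExt.prod B.den Q ↔ SeqExt.prod A.den P ⊆ Q := by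
  refine ⟨fun h => ?_, fun h => h.trans (subset_prod_left B.nil_mem_den)⟩
  have hI : ∀ I S : Set X, Order.IsIdeal I → IsLowerSet S → ¬ I ⊆ S →
      ∀ w : List X, mk w ∈ SeqExt.prod (opt I) P →
        ∃ z p, z ∉ S ∧ mk (z :: p) ∈ SeqExt.prod (opt I) P ∧ Emb w (z :: p) := by
    rintro I S hI hS hIS t ⟨_, w, rfl | ⟨y, hy, rfl⟩, hw, rfl⟩
    · obtain ⟨x, hx, hxS⟩ := Set.not_subset.1 hIS
      exact ⟨x, t, hxS, cons_mem_opt_prod.2 (Or.inr ⟨hx, hw⟩), .cons_right (emb_refl t)⟩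
    · obtain ⟨x, hx, hxS⟩ := Set.not_subset.1 hIS
      obtain ⟨z, hz, hxz, hyz⟩ := hI.Directed x hx y hy
      exact ⟨z, w, fun h => hxS (hS hxz h), cons_mem_opt_prod.2 (Or.inr ⟨hz, hw⟩),
        .cons hyz (emb_refl w)⟩
  refine subset_mk fun w hw => ?_
  cases A with
  | opt I =>
    cases B with
    | opt J =>
      obtain ⟨z, p, hz, hp, hwp⟩ :=
        hI I J hA hB.IsLowerSet (fun h => hAB (opt_subset_opt.2 h)) w hw
      rcases cons_mem_opt_prod.1 (h hp) with h | h
      · exact hQ (le_def.2 hwp) h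
      · exact (hz h.1).elim
    | star E =>
      obtain ⟨z, p, hz, hp, hwp⟩ := hI I E hA hB (fun h => hAB (opt_subset_star_iff.2 h)) w hw
      rcases cons_mem_star_prod.1 (h hp) with h | h
      · exact hQ (le_def.2 hwp) h
      · exact (hz h.1).elim
  | star D =>
    cases B with
    | opt J =>
      obtain ⟨x, hx⟩ : D.Nonempty :=
        Set.nonempty_iff_ne_empty.2 fun h => hAB (star_subset_opt.2 h)
      rcases cons_mem_opt_prod.1 (h (cons_mem_star_prod.2 (Or.inr ⟨hx, hw⟩))) with h | h
      · exact mem_of_cons_mem hQ h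
      · exact h.2
    | star E =>
      obtain ⟨x, hx, hxE⟩ := Set.not_subset.1 fun h => hAB (star_subset_star.2 h)
      rcases cons_mem_star_prod.1 (h (cons_mem_star_prod.2 (Or.inr ⟨hx, hw⟩))) with h | h
      · exact mem_of_cons_mem hQ h
      · exact (hxE h.1).elim

theorem opt_prod_subset_opt_prod {I J : Set X} {P Q : Set (SeqExt X)} (hI : I.Nonempty)
    (hQ : IsLowerSet Q) (hIJ : I ⊆ J) :
    SeqExt.prod (opt I) P ⊆ SeqExt.prod (opt J) Q ↔ P ⊆ Q := by
  refine ⟨fun h => subset_mk fun w hw => ?_, prod_mono (opt_subset_opt.2 hIJ)⟩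
  obtain ⟨x, hx⟩ := hI
  rcases cons_mem_opt_prod.1 (h (cons_mem_opt_prod.2 (Or.inr ⟨hx, hw⟩))) with h | h
  · exact mem_of_cons_mem hQ h
  · exact h.2

/-- Every call of `sub` is followed by the removal of an atom, or by the end of the test. -/
theorem inclTest_count_le {δ : Type u} (e : δ) (sub : δ → δ → Bool) (P Q : List (Atom δ)) :
    (Atom.inclTest e sub P Q).2 ≤ P.length + Q.length := by
  induction P, Q using Atom.inclTest.induct e sub <;>
    (rw [Atom.inclTest]; grind)

theorem inclTest_iff {sub : Set X → Set X → Bool}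
    (hsub : ∀ D E : Set X, IsLowerSet D → IsLowerSet E → (sub D E = true ↔ D ⊆ E))
    (P Q : List (Atom (Set X))) (hP : ∀ A ∈ P, A.Valid) (hQ : ∀ B ∈ Q, B.Valid) :
    (Atom.inclTest ∅ sub P Q).1 = true ↔ Atom.prod P ⊆ Atom.prod Q := by
  have he : IsLowerSet (∅ : Set X) := isLowerSet_empty
  induction P, Q using Atom.inclTest.induct ∅ sub with
  | case1 Q =>
    rw [Atom.inclTest]
    exact iff_of_true rfl (eps_subset_of_ideal (Atom.isIdeal_prod hQ))
  | case2 I P =>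
    rw [List.forall_mem_cons] at hP
    rw [Atom.inclTest]
    refine iff_of_false (by simp) fun h => ?_
    have h' := ((atom_prod_subset_eps hP.1 (Atom.isIdeal_prod hP.2)).1 h).1
    obtain ⟨x, hx⟩ := hP.1.Nonempty
    exact (opt_subset_star_iff.1 (le_of_eq h') hx).elim
  | case3 D P h ih =>
    rw [List.forall_mem_cons] at hP
    rw [Atom.inclTest, if_pos h]
    refine (ih hP.2 hQ).trans
      (Iff.trans ?_ (atom_prod_subset_eps hP.1 (Atom.isIdeal_prod hP.2)).symm)
    rw [Set.subset_empty_iff.1 ((hsub D ∅ hP.1 he).1 h)]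
    exact (and_iff_right rfl).symm
  | case4 D P h =>
    rw [List.forall_mem_cons] at hP
    rw [Atom.inclTest, if_neg h, Atom.prod_cons]
    refine iff_of_false (by simp) fun h' => h ?_
    rw [hsub D ∅ hP.1 he]
    exact star_subset_star.1
      (le_of_eq ((atom_prod_subset_eps hP.1 (Atom.isIdeal_prod hP.2)).1 h').1)
  | case5 I P J Q h ih =>
    rw [List.forall_mem_cons] at hP hQ
    rw [Atom.inclTest, if_pos h]
    refine (ih hP.2 hQ.2).trans ?_
    exact (opt_prod_subset_opt_prod hP.1.Nonempty (Atom.isIdeal_prod hQ.2).IsLowerSet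
      ((hsub I J hP.1.IsLowerSet hQ.1.IsLowerSet).1 h)).symm
  | case6 I P J Q h ih =>
    rw [Atom.inclTest, if_neg h]
    refine (ih hP fun B hB => hQ B (List.mem_cons_of_mem _ hB)).trans ?_
    rw [List.forall_mem_cons] at hP hQ
    refine (prod_subset_prod_of_not_subset hP.1 hQ.1 (Atom.isIdeal_prod hQ.2).IsLowerSet
      fun hc => h ?_).symm
    exact (hsub I J hP.1.IsLowerSet hQ.1.IsLowerSet).2 (opt_subset_opt.1 hc)
  | case7 I P D Q h ih =>
    rw [Atom.inclTest, if_pos h]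
    refine (ih (fun B hB => hP B (List.mem_cons_of_mem _ hB)) hQ).trans ?_
    rw [List.forall_mem_cons] at hP hQ
    exact (prod_subset_prod_of_subset (A := .opt I) (B := .star D)
      (opt_subset_star_iff.2 ((hsub I D hP.1.IsLowerSet hQ.1).1 h)) (by simp)).symm
  | case8 I P D Q h ih =>
    rw [Atom.inclTest, if_neg h]
    refine (ih hP fun B hB => hQ B (List.mem_cons_of_mem _ hB)).trans ?_
    rw [List.forall_mem_cons] at hP hQ
    refine (prod_subset_prod_of_not_subset hP.1 hQ.1 (Atom.isIdeal_prod hQ.2).IsLowerSet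
      fun hc => h ?_).symm
    exact (hsub I D hP.1.IsLowerSet hQ.1).2 (opt_subset_star_iff.1 hc)
  | case9 D P E Q h ih =>
    rw [Atom.inclTest, if_pos h]
    refine (ih (fun B hB => hP B (List.mem_cons_of_mem _ hB)) hQ).trans ?_
    rw [List.forall_mem_cons] at hP hQ
    exact (prod_subset_prod_of_subset (A := .star D) (B := .star E)
      (star_subset_star.2 ((hsub D E hP.1 hQ.1).1 h)) (by simp)).symm
  | case10 D P E Q h ih =>
    rw [Atom.inclTest, if_neg h]
    refine (ih hP fun B hB => hQ B (List.mem_cons_of_mem _ hB)).trans ?_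
    rw [List.forall_mem_cons] at hP hQ
    refine (prod_subset_prod_of_not_subset hP.1 hQ.1 (Atom.isIdeal_prod hQ.2).IsLowerSet
      fun hc => h ?_).symm
    exact (hsub D E hP.1 hQ.1).2 (star_subset_star.1 hc)
  | case11 D P I Q h ih =>
    rw [Atom.inclTest, if_pos h]
    refine (ih (fun B hB => hP B (List.mem_cons_of_mem _ hB)) hQ).trans ?_
    rw [List.forall_mem_cons] at hP hQ
    exact (prod_subset_prod_of_subset (A := .star D) (B := .opt I)
      (star_subset_opt.2 (Set.subset_empty_iff.1 ((hsub D ∅ hP.1 he).1 h))) (by simp)).symm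
  | case12 D P I Q h ih =>
    rw [Atom.inclTest, if_neg h]
    refine (ih hP fun B hB => hQ B (List.mem_cons_of_mem _ hB)).trans ?_
    rw [List.forall_mem_cons] at hP hQ
    refine (prod_subset_prod_of_not_subset hP.1 hQ.1 (Atom.isIdeal_prod hQ.2).IsLowerSet
      fun hc => h ?_).symm
    exact (hsub D ∅ hP.1 he).2 (star_subset_opt.1 hc).le

/-! ### Ideals of sequences are products of atoms -/

/-- The finite unions of products of atoms. -/
def IsProds (S : Set (SeqExt X)) : Prop :=
  ∃ L : List (List (Atom (Set X))), (∀ P ∈ L, ∀ A ∈ P, A.Valid) ∧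
    S = {w | ∃ P ∈ L, w ∈ Atom.prod P}

theorem isProds_empty : IsProds (∅ : Set (SeqExt X)) := ⟨[], by simp, by simp⟩

theorem isProds_prod {P : List (Atom (Set X))} (hP : ∀ A ∈ P, A.Valid) :
    IsProds (Atom.prod P) := ⟨[P], by simpa using hP, by simp⟩

theorem IsProds.union {S T : Set (SeqExt X)} (hS : IsProds S) (hT : IsProds T) :
    IsProds (S ∪ T) := by
  obtain ⟨L, hL, rfl⟩ := hS
  obtain ⟨M, hM, rfl⟩ := hT
  refine ⟨L ++ M, fun P hP => (List.mem_append.1 hP).elim (hL P) (hM P), ?_⟩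
  ext w
  simp only [Set.mem_union, Set.mem_ofPred_eq, List.mem_append, or_and_right, exists_or]

theorem isProds_iUnion {ι : Type*} (l : List ι) (S : ι → Set (SeqExt X))
    (h : ∀ i ∈ l, IsProds (S i)) : IsProds {w | ∃ i ∈ l, w ∈ S i} := by
  induction l with
  | nil => simpa using isProds_empty
  | cons i l ih =>
    rw [List.forall_mem_cons] at h
    convert h.1.union (ih h.2) using 1
    ext w
    simp

theorem IsProds.atom_prod {A : Atom (Set X)} (hA : A.Valid) {S : Set (SeqExt X)}
    (hS : IsProds S) : IsProds (SeqExt.prod A.den S) := by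
  obtain ⟨L, hL, rfl⟩ := hS
  refine ⟨L.map (A :: ·), ?_, ?_⟩
  · simpa using fun P hP => ⟨hA, hL P hP⟩
  · refine ext_mk fun w => ?_
    constructor
    · rintro ⟨u, v, hu, ⟨P, hP, hv⟩, rfl⟩
      exact ⟨A :: P, List.mem_map_of_mem hP, u, v, hu, hv, rfl⟩
    · rintro ⟨P', hP', hw⟩
      obtain ⟨P, hP, rfl⟩ := List.mem_map.1 hP'
      obtain ⟨u, v, hu, hv, rfl⟩ := hw
      exact ⟨u, v, hu, ⟨P, hP, hv⟩, rfl⟩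

variable [WellQuasiOrderedLE X]

theorem IsProds.opt_prod {D : Set X} (hD : IsLowerSet D) {S : Set (SeqExt X)}
    (hS : IsProds S) : IsProds (SeqExt.prod (opt D) S) := by
  obtain ⟨L, hL, hDL⟩ := exists_ideal_decomposition ⟨D, hD⟩
  obtain rfl : D = {x | ∃ I ∈ L, x ∈ I} := hDL
  rw [opt_iUnion_prod L fun I => I]
  exact hS.union (isProds_iUnion L (fun I => SeqExt.prod (Atom.opt I).den S)
    fun I hI => hS.atom_prod (A := .opt I) (hL I hI))

theorem isProds_prod_inter_prod (P Q : List (Atom (Set X))) (hP : ∀ A ∈ P, A.Valid)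
    (hQ : ∀ B ∈ Q, B.Valid) : IsProds (Atom.prod P ∩ Atom.prod Q) := by
  induction P generalizing Q with
  | nil =>
    have : Atom.prod ([] : List (Atom (Set X))) ∩ Atom.prod Q = Atom.prod [] :=
      Set.inter_eq_left.2 (eps_subset_of_ideal (Atom.isIdeal_prod hQ))
    rw [this]
    exact isProds_prod (by simp)
  | cons A P ihP =>
    induction Q with
    | nil =>
      have : Atom.prod (A :: P) ∩ Atom.prod [] = Atom.prod [] :=
        Set.inter_eq_right.2 (eps_subset_of_ideal (Atom.isIdeal_prod hP))
      rw [this]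
      exact isProds_prod (by simp)
    | cons B Q ihQ =>
      have hP' := (List.forall_mem_cons.1 hP).2
      have hQ' := (List.forall_mem_cons.1 hQ).2
      have hA := (List.forall_mem_cons.1 hP).1
      have hB := (List.forall_mem_cons.1 hQ).1
      have h1 := ihQ hQ'
      have h2 := ihP (B :: Q) hP' hQ
      have h3 := ihP Q hP' hQ'
      rw [Atom.prod_cons] at h1 h2 ⊢
      rw [Atom.prod_cons]
      cases A with
      | star D =>
        cases B with
        | star E =>
          have h4 := star_prod_inter_star_prod D E (Atom.prod P) (Atom.prod Q)
          exact h4 ▸ (h1.union h2).atom_prod (A := .star (D ∩ E)) (IsLowerSet.inter hA hB)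
        | opt J =>
          have h4 := star_prod_inter_opt_prod D J (Atom.prod P) (Atom.prod Q)
          exact h4 ▸ h2.union (h1.opt_prod (IsLowerSet.inter hA hB.IsLowerSet))
      | opt I =>
        cases B with
        | star E =>
          have h4 := star_prod_inter_opt_prod E I (Atom.prod Q) (Atom.prod P)
          rw [Set.inter_comm (SeqExt.prod (star E) _) (SeqExt.prod (opt I) _),
            Set.inter_comm (Atom.prod Q), Set.inter_comm _ (Atom.prod P)] at h4
          exact h4 ▸ h1.union (h2.opt_prod (IsLowerSet.inter hB hA.IsLowerSet))
        | opt J =>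
          have h4 := opt_prod_inter_opt_prod I J (Atom.prod P) (Atom.prod Q)
          exact h4 ▸ (h1.union h2).union
            (h3.opt_prod (IsLowerSet.inter hA.IsLowerSet hB.IsLowerSet))

theorem IsProds.inter {S T : Set (SeqExt X)} (hS : IsProds S) (hT : IsProds T) :
    IsProds (S ∩ T) := by
  obtain ⟨L, hL, rfl⟩ := hS
  obtain ⟨M, hM, rfl⟩ := hT
  convert isProds_iUnion L (fun P => {w | ∃ Q ∈ M, w ∈ Atom.prod P ∩ Atom.prod Q})
    (fun P hP => isProds_iUnion M (fun Q => Atom.prod P ∩ Atom.prod Q)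
      fun Q hQ => isProds_prod_inter_prod P Q (hL P hP) (hM Q hQ)) using 1
  ext w
  constructor
  · rintro ⟨⟨P, hP, h⟩, Q, hQ, h'⟩
    exact ⟨P, hP, Q, hQ, h, h'⟩
  · rintro ⟨P, hP, Q, hQ, h, h'⟩
    exact ⟨⟨P, hP, h⟩, Q, hQ, h'⟩

theorem isProds_compl_fil (w : List X) : IsProds (fil w)ᶜ := by
  induction w with
  | nil =>
    rw [fil_nil, Set.compl_univ]
    exact isProds_empty
  | cons x v ih =>
    have hx : IsLowerSet (Set.Ici x)ᶜ := (isUpperSet_Ici x).compl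
    by_cases hv : v = []
    · subst hv
      rw [compl_fil_singleton]
      have h := isProds_prod (P := [Atom.star (Set.Ici x)ᶜ])
        (by rintro A (_ | ⟨_, ⟨⟩⟩); exact hx)
      rwa [Atom.prod_cons, show Atom.prod ([] : List (Atom (Set X))) = eps X from rfl,
        prod_eps] at h
    · rw [compl_fil_cons x hv]
      exact (ih.opt_prod isLowerSet_univ).atom_prod (A := .star _) hx

/-- Higman's lemma. -/
theorem wellQuasiOrderedLE_seqExt : WellQuasiOrderedLE (SeqExt X) := by
  refine ⟨fun f => ?_⟩
  have h : (Set.univ : Set X).PartiallyWellOrderedOn (· ≤ ·) :=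
    fun g => wellQuasiOrdered_le fun n => (g n : X)
  exact h.partiallyWellOrderedOn_sublistForall₂ (· ≤ ·) fun n => ⟨f n, fun x _ => trivial⟩

/-- A lower set is a finite intersection of complements of principal filters, and the finite unions
of products of atoms contain these and are closed under intersection. -/
theorem isProds_of_isLowerSet {S : Set (SeqExt X)} (hS : IsLowerSet S) : IsProds S := by
  have := wellQuasiOrderedLE_seqExt (X := X)
  obtain ⟨L, hL⟩ := exists_finite_basis hS.compl
  have huniv : IsProds (Set.univ : Set (SeqExt X)) := by
    convert isProds_prod (P := [Atom.star (Set.univ : Set X)])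
      (by rintro A (_ | ⟨_, ⟨⟩⟩); exact isLowerSet_univ)
    refine (Set.eq_univ_of_forall fun w => ?_).symm
    exact subset_prod_right (V := eps X) rfl fun x _ => trivial
  have key : ∀ L : List (SeqExt X), IsProds {y | ∃ x ∈ L, x ≤ y}ᶜ := by
    intro L
    induction L with
    | nil => simpa using huniv
    | cons w L ih =>
      convert (isProds_compl_fil w).inter ih using 1
      ext v
      simp [fil]
  rw [← compl_compl S, hL]
  exact key L

/-- An ideal that is a finite union of products is equal to one of them. -/
theorem isIdeal_iff_exists_prod {S : Set (SeqExt X)} :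
    Order.IsIdeal S ↔ ∃ P : List (Atom (Set X)), (∀ A ∈ P, A.Valid) ∧ S = Atom.prod P := by
  constructor
  · intro hS
    obtain ⟨L, hL, hSL⟩ := isProds_of_isLowerSet hS.IsLowerSet
    obtain ⟨_, hJ, hSJ⟩ := isIdeal_subset_of_subset_iUnion hS (L := L.map Atom.prod)
      (by simpa using fun P hP => (Atom.isIdeal_prod (hL P hP)).IsLowerSet)
      (fun x hx => by simpa [hSL] using hx)
    obtain ⟨P, hP, rfl⟩ := List.mem_map.1 hJ
    refine ⟨P, hL P hP, hSJ.antisymm fun w hw => ?_⟩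
    rw [hSL]
    exact ⟨P, hP, hw⟩
  · rintro ⟨P, hP, rfl⟩
    exact Atom.isIdeal_prod hP

end

/-! ### Computations with bounded resources -/

/-- The family `a`, where `a k` is the outcome of a computation with resource bound `k` (`none` if
the bound does not suffice), converges to a value that satisfies `Q`. All outcomes agree, so the
value can be found by an unbounded search for a sufficient bound. -/
def Computes {σ : Type*} (a : ℕ → Option σ) (Q : σ → Prop) : Prop :=
  ∃ x, Q x ∧ (∀ᶠ k in atTop, a k = some x) ∧ ∀ k y, a k = some y → y = x

namespace Computes

variable {α β σ τ : Type*}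

theorem pure {Q : σ → Prop} {x : σ} (h : Q x) : Computes (fun _ => some x) Q :=
  ⟨x, h, Eventually.of_forall fun _ => rfl, fun _ _ h => (Option.some.inj h).symm⟩

theorem mono {a : ℕ → Option σ} {Q R : σ → Prop} (h : Computes a Q) (hQ : ∀ x, Q x → R x) :
    Computes a R :=
  let ⟨x, hx, h'⟩ := h
  ⟨x, hQ x hx, h'⟩

theorem bind {a : ℕ → Option σ} {b : ℕ → σ → Option τ} {Q : σ → Prop} {R : τ → Prop}
    (ha : Computes a Q) (hb : ∀ x, Q x → Computes (fun k => b k x) R) :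
    Computes (fun k => (a k).bind (b k)) R := by
  obtain ⟨x, hx, h1, h2⟩ := ha
  obtain ⟨y, hy, h3, h4⟩ := hb x hx
  refine ⟨y, hy, ?_, fun k z hz => ?_⟩
  · filter_upwards [h1, h3] with k h1 h3
    rw [h1, Option.bind_some, h3]
  · obtain ⟨x', hx', hz⟩ := Option.bind_eq_some_iff.1 hz
    rw [h2 k x' hx'] at hz
    exact h4 k z hz

theorem map {a : ℕ → Option σ} {f : σ → τ} {Q : σ → Prop} {R : τ → Prop}
    (ha : Computes a Q) (hf : ∀ x, Q x → R (f x)) : Computes (fun k => (a k).map f) R := by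
  simp only [Option.map_eq_bind]
  exact ha.bind fun x hx => pure (hf x hx)

theorem mapM {f : ℕ → α → Option σ} {Q : α → σ → Prop} (l : List α)
    (h : ∀ i ∈ l, Computes (fun k => f k i) (Q i)) :
    Computes (fun k => l.mapM (f k)) (List.Forall₂ Q l) := by
  induction l with
  | nil => exact pure .nil
  | cons i l ih =>
    rw [List.forall_mem_cons] at h
    simp only [List.mapM_cons]
    exact h.1.bind fun x hx => (ih h.2).bind fun y hy => pure (.cons hx hy)

end Computes

theorem computes_evaln {c : Code} {n : ℕ} {Q : ℕ → Prop} (h : ∃ y ∈ c.eval n, Q y) :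
    Computes (fun k => Code.evaln k c n) Q := by
  obtain ⟨y, hy, hQ⟩ := h
  obtain ⟨k₀, hk₀⟩ := Code.evaln_complete.1 hy
  refine ⟨y, hQ, eventually_atTop.2 ⟨k₀, fun k hk => Code.evaln_mono hk hk₀⟩, fun k z hz => ?_⟩
  exact Part.mem_unique (Code.evaln_sound hz) hy

/-- Simultaneous recursion on two lists: unless one of them is empty, the value for `a :: P` and
`b :: Q` is computed from those for `(a :: P, Q)`, `(P, b :: Q)` and `(P, Q)`, in this order. -/
def listRec₂ {α β σ : Type*} (base : List α → List β → σ) (step : α → β → σ → σ → σ → Option σ) :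
    List α → List β → Option σ
  | [], Q => some (base [] Q)
  | a :: P, [] => some (base (a :: P) [])
  | a :: P, b :: Q =>
    (listRec₂ base step (a :: P) Q).bind fun r₁ => (listRec₂ base step P (b :: Q)).bind fun r₂ =>
      (listRec₂ base step P Q).bind fun r₃ => step a b r₁ r₂ r₃
termination_by P Q => P.length + Q.length

theorem Computes.listRec₂ {α β σ : Type*} {base : List α → List β → σ}
    {step : ℕ → α → β → σ → σ → σ → Option σ} {R : List α → List β → σ → Prop}
    {p : α → Prop} {q : β → Prop}
    (hnil : ∀ Q, (∀ b ∈ Q, q b) → R [] Q (base [] Q))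
    (hnil' : ∀ P, (∀ a ∈ P, p a) → R P [] (base P []))
    (hstep : ∀ a P b Q r₁ r₂ r₃, (∀ a' ∈ a :: P, p a') → (∀ b' ∈ b :: Q, q b') →
      R (a :: P) Q r₁ → R P (b :: Q) r₂ → R P Q r₃ →
      Computes (fun k => step k a b r₁ r₂ r₃) (R (a :: P) (b :: Q)))
    (P : List α) (Q : List β) (hP : ∀ a ∈ P, p a) (hQ : ∀ b ∈ Q, q b) :
    Computes (fun k => IdealEff.listRec₂ base (step k) P Q) (R P Q) := by
  induction P generalizing Q with
  | nil => simp only [IdealEff.listRec₂]; exact Computes.pure (hnil Q hQ)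
  | cons a P ihP =>
    induction Q with
    | nil => simp only [IdealEff.listRec₂]; exact Computes.pure (hnil' (a :: P) hP)
    | cons b Q ihQ =>
      simp only [IdealEff.listRec₂]
      have hP' := (List.forall_mem_cons.1 hP).2
      have hQ' := (List.forall_mem_cons.1 hQ).2
      exact (ihQ hQ').bind fun r₁ h₁ => (ihP (b :: Q) hP' hQ).bind fun r₂ h₂ =>
        (ihP Q hP' hQ').bind fun r₃ h₃ => hstep a P b Q r₁ r₂ r₃ hP hQ h₁ h₂ h₃

/-! ### Primitive recursiveness of list operations -/

section Primrec

variable {γ α β σ : Type*} [Primcodable γ] [Primcodable α] [Primcodable β] [Primcodable σ]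

theorem primrec_list_mapM {f : γ → List α} {g : γ → α → Option β} (hf : Primrec f)
    (hg : Primrec₂ g) : Primrec fun c => (f c).mapM (g c) := by
  have h : ∀ (k : α → Option β) (l : List α), l.mapM k =
      l.foldr (fun a s => (k a).bind fun b => s.bind fun t => some (b :: t)) (some []) := by
    intro k l
    induction l with
    | nil => rfl
    | cons a l ih => rw [List.mapM_cons, ih]; rfl
  simp only [h]
  refine Primrec.list_foldr (h := fun c (p : α × Option (List β)) =>
    (g c p.1).bind fun b => p.2.bind fun t => some (b :: t)) hf (Primrec.const _) ?_
  refine Primrec.option_bind (hg.comp Primrec.fst (Primrec.fst.comp Primrec.snd)) ?_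
  refine Primrec.option_bind (Primrec.snd.comp (Primrec.snd.comp Primrec.fst)) ?_
  exact Primrec.option_some.comp
    (Primrec.list_cons.comp (Primrec.snd.comp Primrec.fst) Primrec.snd)

/-- The arguments of the recursive calls of `listRec₂`. -/
def listRec₂Calls (b : List α × List β) : List (List α × List β) :=
  ((b.1.head?.bind fun _ => b.2.head?.map fun _ =>
    [(b.1, b.2.tail), (b.1.tail, b.2), (b.1.tail, b.2.tail)]) :
      Option (List (List α × List β))).getD []

/-- The value of `listRec₂`, from those of its recursive calls. -/
def listRec₂Step (base : List α → List β → σ) (step : α → β → σ → σ → σ → Option σ)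
    (b : List α × List β) (l : List (Option σ)) : Option σ :=
  ((b.1.head?.bind fun a => b.2.head?.map fun a' =>
    ((l[0]?.bind id).bind fun r₁ => (l[1]?.bind id).bind fun r₂ =>
      (l[2]?.bind id).bind fun r₃ => step a a' r₁ r₂ r₃)) :
        Option (Option σ)).getD (some (base b.1 b.2))

theorem primrec_listRec₂Calls : Primrec (listRec₂Calls (α := α) (β := β)) := by
  have h1 : Primrec fun b : ((List α × List β) × α) × β => b.1.1.1 :=
    Primrec.fst.comp (Primrec.fst.comp Primrec.fst)
  have h2 : Primrec fun b : ((List α × List β) × α) × β => b.1.1.2 :=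
    Primrec.snd.comp (Primrec.fst.comp Primrec.fst)
  have h3 := Primrec.list_tail.comp h1
  have h4 := Primrec.list_tail.comp h2
  refine Primrec.option_getD.comp (Primrec.option_bind (Primrec.list_head?.comp Primrec.fst)
    (Primrec.option_map (Primrec.list_head?.comp (Primrec.snd.comp Primrec.fst)) ?_))
    (Primrec.const [])
  exact Primrec.list_cons.comp (h1.pair h4) (Primrec.list_cons.comp (h3.pair h2)
    (Primrec.list_cons.comp (h3.pair h4) (Primrec.const [])))

theorem primrec_listRec₂Step {base : γ → List α → List β → σ}
    {step : γ → α → β → σ → σ → σ → Option σ}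
    (hbase : Primrec fun x : γ × List α × List β => base x.1 x.2.1 x.2.2)
    (hstep : Primrec fun x : γ × α × β × σ × σ × σ =>
      step x.1 x.2.1 x.2.2.1 x.2.2.2.1 x.2.2.2.2.1 x.2.2.2.2.2) :
    Primrec fun x : γ × (List α × List β) × List (Option σ) =>
      listRec₂Step (base x.1) (step x.1) x.2.1 x.2.2 := by
  have hget : ∀ i : ℕ, Primrec fun l : List (Option σ) => l[i]?.bind id := fun i =>
    Primrec.option_bind (Primrec.list_getElem?.comp Primrec.id (Primrec.const i)) Primrec.snd
  have h₃ : Primrec fun y : (((γ × α × β) × List (Option σ)) × σ) × σ =>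
      (y.1.1.2[2]?.bind id).bind fun r₃ => step y.1.1.1.1 y.1.1.1.2.1 y.1.1.1.2.2 y.1.2 y.2 r₃ := by
    refine Primrec.option_bind
      ((hget 2).comp (Primrec.snd.comp (Primrec.fst.comp Primrec.fst))) ?_
    have h : Primrec fun z : ((((γ × α × β) × List (Option σ)) × σ) × σ) × σ => z.1.1.1.1 :=
      Primrec.fst.comp (Primrec.fst.comp (Primrec.fst.comp Primrec.fst))
    have h' := hstep.comp ((Primrec.fst.comp h).pair ((Primrec.fst.comp (Primrec.snd.comp h)).pair
      ((Primrec.snd.comp (Primrec.snd.comp h)).pair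
        ((Primrec.snd.comp (Primrec.fst.comp Primrec.fst)).pair
          ((Primrec.snd.comp Primrec.fst).pair Primrec.snd)))))
    exact h'
  have h₁ : Primrec fun y : (γ × α × β) × List (Option σ) =>
      (y.2[0]?.bind id).bind fun r₁ => (y.2[1]?.bind id).bind fun r₂ =>
        (y.2[2]?.bind id).bind fun r₃ => step y.1.1 y.1.2.1 y.1.2.2 r₁ r₂ r₃ := by
    refine Primrec.option_bind ((hget 0).comp Primrec.snd) ?_
    exact Primrec.option_bind ((hget 1).comp (Primrec.snd.comp Primrec.fst)) h₃
  have hx : Primrec fun z : ((γ × (List α × List β) × List (Option σ)) × α) × β => z.1.1 :=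
    Primrec.fst.comp Primrec.fst
  have h₀ : Primrec fun z : ((γ × (List α × List β) × List (Option σ)) × α) × β =>
      (((z.1.1.1, z.1.2, z.2), z.1.1.2.2) : (γ × α × β) × List (Option σ)) :=
    ((Primrec.fst.comp hx).pair ((Primrec.snd.comp Primrec.fst).pair Primrec.snd)).pair
      (Primrec.snd.comp (Primrec.snd.comp hx))
  have h₂ := h₁.comp h₀
  refine Primrec.option_getD.comp (Primrec.option_bind
    (Primrec.list_head?.comp (Primrec.fst.comp (Primrec.fst.comp Primrec.snd)))
    (Primrec.option_map (Primrec.list_head?.comp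
      (Primrec.snd.comp (Primrec.fst.comp (Primrec.snd.comp Primrec.fst)))) h₂))
    (Primrec.option_some.comp (hbase.comp (Primrec.fst.pair (Primrec.fst.comp Primrec.snd))))

theorem primrec_listRec₂ {base : γ → List α → List β → σ}
    {step : γ → α → β → σ → σ → σ → Option σ}
    (hbase : Primrec fun x : γ × List α × List β => base x.1 x.2.1 x.2.2)
    (hstep : Primrec fun x : γ × α × β × σ × σ × σ =>
      step x.1 x.2.1 x.2.2.1 x.2.2.2.1 x.2.2.2.2.1 x.2.2.2.2.2)
    {c : γ → List α} {d : γ → List β} (hc : Primrec c) (hd : Primrec d) :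
    Primrec fun x => listRec₂ (base x) (step x) (c x) (d x) := by
  have key := Primrec.nat_omega_rec (fun x (b : List α × List β) =>
      listRec₂ (base x) (step x) b.1 b.2) (m := fun _ b => b.1.length + b.2.length)
    (l := fun _ b => listRec₂Calls b)
    (g := fun x b => some (listRec₂Step (base x) (step x) b.1 b.2))
    (Primrec.nat_add.comp (Primrec.list_length.comp (Primrec.fst.comp Primrec.snd))
      (Primrec.list_length.comp (Primrec.snd.comp Primrec.snd)))
    (primrec_listRec₂Calls.comp Primrec.snd)
    (Primrec.option_some.comp (primrec_listRec₂Step hbase hstep)) ?_ ?_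
  · exact key.comp Primrec.id (hc.pair hd)
  · rintro x ⟨_ | ⟨a, P⟩, _ | ⟨b, Q⟩⟩ b' hb' <;> simp [listRec₂Calls] at hb'
    rcases hb' with rfl | rfl | rfl <;> (simp only [List.length_cons]; omega)
  · rintro x ⟨_ | ⟨a, P⟩, _ | ⟨b, Q⟩⟩ <;> simp [listRec₂Calls, listRec₂Step, listRec₂]

end Primrec

/-! ### Programs that use a presentation -/

section Programs

variable {γ : Type*} [Primcodable γ]

/-- A presentation and a resource bound for calls of its programs. -/
abbrev Ctx : Type := Presentation × ℕ

/-- The answer of the program `f p` of the presentation `p` on input `n`, within the bound. -/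
def call (f : Presentation → Code) (c : Ctx) (n : ℕ) : Option ℕ := Code.evaln c.2 (f c.1) n

/-- A call of a program that returns (the code of) a list. -/
def callList (f : Presentation → Code) (c : Ctx) (n : ℕ) : Option (List ℕ) :=
  (call f c n).bind fun m => decode m

theorem computes_call {f : Presentation → Code} {p : Presentation} {n : ℕ} {Q : ℕ → Prop}
    (h : ∃ y ∈ (f p).eval n, Q y) : Computes (fun k => call f (p, k) n) Q :=
  computes_evaln h

theorem computes_callList {f : Presentation → Code} {p : Presentation} {n : ℕ}
    {Q : List ℕ → Prop} (h : ∃ l : List ℕ, encode l ∈ (f p).eval n ∧ Q l) :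
    Computes (fun k => callList f (p, k) n) Q := by
  obtain ⟨l, hl, hQ⟩ := h
  refine (computes_call (Q := fun m => m = encode l) ⟨_, hl, rfl⟩).bind fun m hm => ?_
  subst hm
  simp only [encodek]
  exact Computes.pure hQ

theorem primrec_call {f : Presentation → Code} (hf : Primrec f) {c : γ → Ctx} {n : γ → ℕ}
    (hc : Primrec c) (hn : Primrec n) : Primrec fun x => call f (c x) (n x) :=
  Code.primrec_evaln.comp
    (((Primrec.snd.comp hc).pair (hf.comp (Primrec.fst.comp hc))).pair hn)

theorem primrec_callList {f : Presentation → Code} (hf : Primrec f) {c : γ → Ctx} {n : γ → ℕ}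
    (hc : Primrec c) (hn : Primrec n) : Primrec fun x => callList f (c x) (n x) :=
  Primrec.option_bind (primrec_call hf hc hn) (Primrec.decode.comp Primrec.snd)

/-- One algorithm turns a presentation `p` into a program that computes what `g` computes from `p`
with sufficiently large bounds. -/
theorem exists_uniform_code {g : Ctx → ℕ → Option ℕ} (hg : Primrec₂ g) :
    ∃ F : Presentation → Code, Computable F ∧ ∀ p n Q,
      Computes (fun k => g (p, k) n) Q → ∃ y ∈ (F p).eval n, Q y := by
  have h : Partrec fun x : Presentation × ℕ => Nat.rfindOpt fun k => g (x.1, k) x.2 := by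
    refine Partrec.rfindOpt (Primrec.to_comp ?_)
    exact hg.comp ((Primrec.fst.comp Primrec.fst).pair Primrec.snd)
      (Primrec.snd.comp Primrec.fst)
  obtain ⟨c, hc⟩ := Code.exists_code.1 h
  refine ⟨fun p => c.curry (encode p), ?_, fun p n Q hQ => ?_⟩
  · exact (Code.primrec₂_curry.comp (Primrec.const c) Primrec.encode).to_comp
  · obtain ⟨x, hx, h1, h2⟩ := hQ
    refine ⟨x, ?_, hx⟩
    have hmem : x ∈ Nat.rfindOpt fun k => g (p, k) n := by
      obtain ⟨k, hk⟩ := h1.exists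
      have hdom : (Nat.rfindOpt fun k => g (p, k) n).Dom := Nat.rfindOpt_dom.2 ⟨k, x, hk⟩
      obtain ⟨k', hk'⟩ := Nat.rfindOpt_spec (Part.get_mem hdom)
      rw [← h2 k' _ hk']
      exact Part.get_mem hdom
    rw [Code.eval_curry, hc]
    have hd : (decode (Nat.pair (encode p) n) : Option (Presentation × ℕ)) = some (p, n) := by
      simp
    simp only [hd, Part.coe_some, Part.bind_some]
    exact Part.mem_map _ hmem

end Programs

namespace Presentation

theorem primrec_equivProd : Primrec equivProd := Primrec.of_equiv

theorem primrec_decElt : Primrec decElt :=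
  (Primrec.fst.comp primrec_equivProd :)

theorem primrec_decIdl : Primrec decIdl :=
  (Primrec.fst.comp (Primrec.snd.comp primrec_equivProd) :)

theorem primrec_tail : Primrec fun p : Presentation => (equivProd p).2.2.2 :=
  (Primrec.snd.comp (Primrec.snd.comp (Primrec.snd.comp primrec_equivProd)) :)

theorem primrec_id : Primrec Presentation.id :=
  (Primrec.fst.comp primrec_tail :)

theorem primrec_pi : Primrec pi :=
  (Primrec.fst.comp (Primrec.snd.comp primrec_tail) :)

theorem primrec_cf : Primrec cf :=
  (Primrec.fst.comp (Primrec.snd.comp (Primrec.snd.comp primrec_tail)) :)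

theorem primrec_tail' : Primrec fun p : Presentation => (equivProd p).2.2.2.2.2.2 :=
  (Primrec.snd.comp (Primrec.snd.comp (Primrec.snd.comp primrec_tail)) :)

theorem primrec_if' : Primrec if' :=
  (Primrec.fst.comp primrec_tail' :)

theorem primrec_ci : Primrec ci :=
  (Primrec.fst.comp (Primrec.snd.comp primrec_tail') :)

theorem primrec_ii : Primrec ii :=
  (Primrec.fst.comp (Primrec.snd.comp (Primrec.snd.comp primrec_tail')) :)

theorem primrec_xi : Primrec xi :=
  (Primrec.fst.comp (Primrec.snd.comp (Primrec.snd.comp (Primrec.snd.comp primrec_tail'))) :)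

theorem primrec_xf : Primrec xf :=
  (Primrec.snd.comp (Primrec.snd.comp (Primrec.snd.comp (Primrec.snd.comp primrec_tail'))) :)

end Presentation

open Presentation

/-! ### Programs for sequences -/

section Programs

variable {γ : Type*} [Primcodable γ]

/-- A name of an atom: a name of an ideal `I` for `I + ε`, a list of names for `D*`. -/
abbrev AtomName : Type := ℕ ⊕ List ℕ

/-- Names of ideals whose union is the set of letters of an atom. -/
def letters (A : AtomName) : List ℕ := Sum.casesOn A (fun i => [i]) fun l => l

theorem primrec_letters : Primrec letters :=
  Primrec.sumCasesOn Primrec.id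
    (Primrec.list_cons.comp Primrec.snd (Primrec.const [])) Primrec.snd

/-- The conjunction of a list of answers. -/
def allAnswers (l : List ℕ) : ℕ := if ∃ b ∈ l, b = 0 then 0 else 1

/-- The disjunction of a list of answers. -/
def anyAnswer (l : List ℕ) : ℕ := if ∃ b ∈ l, b = 1 then 1 else 0

theorem primrec_allAnswers : Primrec allAnswers :=
  Primrec.ite (PrimrecPred.exists_mem_list (Primrec.eq.comp Primrec.id (Primrec.const 0)))
    (Primrec.const 0) (Primrec.const 1)

theorem primrec_anyAnswer : Primrec anyAnswer :=
  Primrec.ite (PrimrecPred.exists_mem_list (Primrec.eq.comp Primrec.id (Primrec.const 1)))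
    (Primrec.const 1) (Primrec.const 0)

/-- Whether a sequence of numbers consists of names of elements. -/
def seqDecElt (c : Ctx) (w : List ℕ) : Option ℕ :=
  (w.mapM (call Presentation.decElt c)).map allAnswers

/-- Whether names of atoms are valid. -/
def seqDecIdl (c : Ctx) (P : List AtomName) : Option ℕ :=
  ((P.flatMap letters).mapM (call Presentation.decIdl c)).map allAnswers

theorem primrec_seqDecElt : Primrec₂ seqDecElt :=
  Primrec.option_map (primrec_list_mapM Primrec.snd
    (primrec_call primrec_decElt (Primrec.fst.comp Primrec.fst) Primrec.snd))
    (primrec_allAnswers.comp Primrec.snd)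

theorem primrec_seqDecIdl : Primrec₂ seqDecIdl :=
  Primrec.option_map (primrec_list_mapM (Primrec.list_flatMap Primrec.snd
      (primrec_letters.comp Primrec.snd))
    (primrec_call primrec_decIdl (Primrec.fst.comp Primrec.fst) Primrec.snd))
    (primrec_allAnswers.comp Primrec.snd)

/-- Whether a union of ideals is contained in another one. -/
def lowerSubset (c : Ctx) (L M : List ℕ) : Option ℕ :=
  (L.mapM fun i => (M.mapM fun j => call Presentation.id c (Nat.pair i j)).map anyAnswer).map
    allAnswers

theorem primrec_lowerSubset {c : γ → Ctx} {L M : γ → List ℕ} (hc : Primrec c) (hL : Primrec L)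
    (hM : Primrec M) : Primrec fun x => lowerSubset (c x) (L x) (M x) := by
  refine Primrec.option_map (primrec_list_mapM hL ?_) (primrec_allAnswers.comp Primrec.snd)
  refine Primrec.option_map (primrec_list_mapM (hM.comp Primrec.fst) ?_)
    (primrec_anyAnswer.comp Primrec.snd)
  exact primrec_call primrec_id (hc.comp (Primrec.fst.comp Primrec.fst))
    (Primrec₂.natPair.comp (Primrec.snd.comp Primrec.fst) Primrec.snd)

/-- The atom `A` is contained in the atom `B` if and only if the letters of `A` are contained in
the union of these ideals. -/
def target (A B : AtomName) : List ℕ :=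
  Sum.casesOn A (fun _ => letters B) fun _ => Sum.casesOn B (fun _ => []) fun l => l

theorem primrec_target : Primrec₂ target := by
  refine Primrec.sumCasesOn Primrec.fst
    (primrec_letters.comp (Primrec.snd.comp Primrec.fst)) ?_
  exact Primrec.sumCasesOn (Primrec.snd.comp Primrec.fst) (Primrec.const []).to₂ Primrec.snd.to₂

/-- Of two values, the one that matters if `A` is contained in `B`: the second one if both atoms
provide at most one letter, and the first one otherwise. -/
def ifSubset (A B : AtomName) (r₂ r₃ : ℕ) : ℕ :=
  Sum.casesOn A (fun _ => Sum.casesOn B (fun _ => r₃) fun _ => r₂) fun _ => r₂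

theorem primrec_ifSubset {A B : γ → AtomName} {r₂ r₃ : γ → ℕ} (hA : Primrec A) (hB : Primrec B)
    (h₂ : Primrec r₂) (h₃ : Primrec r₃) :
    Primrec fun x => ifSubset (A x) (B x) (r₂ x) (r₃ x) := by
  refine Primrec.sumCasesOn hA ?_ (h₂.comp Primrec.fst).to₂
  exact Primrec.sumCasesOn (hB.comp Primrec.fst) (h₃.comp (Primrec.fst.comp Primrec.fst)).to₂
    (h₂.comp (Primrec.fst.comp Primrec.fst)).to₂

/-- Whether a product of atoms, one of which is empty, is contained in another one. -/
def inclBase (P _Q : List AtomName) : ℕ := if ∀ A ∈ P, A = Sum.inr [] then 1 else 0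

/-- The recursive step of the inclusion test. -/
def inclStep (c : Ctx) (A B : AtomName) (r₁ r₂ r₃ : ℕ) : Option ℕ :=
  (lowerSubset c (letters A) (target A B)).map fun b =>
    if b = 1 then ifSubset A B r₂ r₃ else r₁

/-- Whether a product of atoms is contained in another one. -/
def seqIncl (c : Ctx) (P Q : List AtomName) : Option ℕ := listRec₂ inclBase (inclStep c) P Q

theorem primrec_seqIncl {c : γ → Ctx} {P Q : γ → List AtomName} (hc : Primrec c)
    (hP : Primrec P) (hQ : Primrec Q) : Primrec fun x => seqIncl (c x) (P x) (Q x) := by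
  have hbase : Primrec fun x : γ × List AtomName × List AtomName => inclBase x.2.1 x.2.2 := by
    have h : PrimrecPred fun P : List AtomName => ∀ A ∈ P, A = Sum.inr [] :=
      PrimrecPred.forall_mem_list (Primrec.eq.comp Primrec.id (Primrec.const _))
    exact Primrec.ite (h.comp (Primrec.fst.comp Primrec.snd)) (Primrec.const 1) (Primrec.const 0)
  have hstep : Primrec fun x : γ × AtomName × AtomName × ℕ × ℕ × ℕ =>
      inclStep (c x.1) x.2.1 x.2.2.1 x.2.2.2.1 x.2.2.2.2.1 x.2.2.2.2.2 := by
    have hA : Primrec fun x : γ × AtomName × AtomName × ℕ × ℕ × ℕ => x.2.1 :=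
      Primrec.fst.comp Primrec.snd
    have h2 : Primrec fun x : γ × AtomName × AtomName × ℕ × ℕ × ℕ => x.2.2 :=
      Primrec.snd.comp Primrec.snd
    have hB := Primrec.fst.comp h2
    have hr := Primrec.snd.comp h2
    refine Primrec.option_map (primrec_lowerSubset (hc.comp Primrec.fst)
      (primrec_letters.comp hA) (primrec_target.comp hA hB)) ?_
    refine Primrec.ite (Primrec.eq.comp Primrec.snd (Primrec.const 1)) ?_
      ((Primrec.fst.comp hr).comp Primrec.fst)
    exact primrec_ifSubset (hA.comp Primrec.fst) (hB.comp Primrec.fst)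
      ((Primrec.fst.comp (Primrec.snd.comp hr)).comp Primrec.fst)
      ((Primrec.snd.comp (Primrec.snd.comp hr)).comp Primrec.fst)
  exact primrec_listRec₂ (base := fun _ => inclBase) (step := fun x => inclStep (c x))
    hbase hstep hP hQ

/-- The principal ideal generated by a sequence, as a product of atoms. -/
def seqPI (c : Ctx) (w : List ℕ) : Option (List AtomName) :=
  (w.mapM (call Presentation.pi c)).map fun l => l.map Sum.inl

theorem primrec_seqPI {c : γ → Ctx} {w : γ → List ℕ} (hc : Primrec c) (hw : Primrec w) :
    Primrec fun x => seqPI (c x) (w x) :=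
  Primrec.option_map (primrec_list_mapM hw
      (primrec_call primrec_pi (hc.comp Primrec.fst) Primrec.snd))
    (Primrec.list_map Primrec.snd (Primrec.sumInl.comp Primrec.snd))

/-- Whether a sequence embeds in another one, tested by means of the ideals they generate. -/
def seqOD (c : Ctx) (v w : List ℕ) : Option ℕ :=
  (seqPI c v).bind fun P => (seqPI c w).bind fun Q => seqIncl c P Q

theorem primrec_seqOD {c : γ → Ctx} {v w : γ → List ℕ} (hc : Primrec c) (hv : Primrec v)
    (hw : Primrec w) : Primrec fun x => seqOD (c x) (v x) (w x) := by
  refine Primrec.option_bind (primrec_seqPI hc hv) ?_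
  refine Primrec.option_bind (primrec_seqPI (hc.comp Primrec.fst) (hw.comp Primrec.fst)) ?_
  exact primrec_seqIncl (hc.comp (Primrec.fst.comp Primrec.fst))
    (Primrec.snd.comp Primrec.fst) Primrec.snd

/-- The complement of the filter generated by a sequence, from the complements of the filters
generated by its letters and a decomposition of `X` into ideals. -/
def complFil (xi : List ℕ) (l : List (List ℕ)) : List (List AtomName) :=
  l.foldr (fun D S => [Sum.inr D] ::
    xi.flatMap fun i => S.map fun P => Sum.inr D :: Sum.inl i :: P) []

/-- The complement of the filter generated by a sequence. -/
def seqCF (c : Ctx) (w : List ℕ) : Option (List (List AtomName)) :=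
  (w.mapM (callList Presentation.cf c)).map (complFil c.1.xi)

theorem primrec_seqCF {c : γ → Ctx} {w : γ → List ℕ} (hc : Primrec c) (hw : Primrec w) :
    Primrec fun x => seqCF (c x) (w x) := by
  refine Primrec.option_map (primrec_list_mapM hw
    (primrec_callList primrec_cf (hc.comp Primrec.fst) Primrec.snd)) ?_
  refine Primrec.list_foldr (h := fun (y : γ × List (List ℕ))
    (z : List ℕ × List (List AtomName)) => [Sum.inr z.1] ::
      (c y.1).1.xi.flatMap fun i => z.2.map fun P => Sum.inr z.1 :: Sum.inl i :: P)
    Primrec.snd (Primrec.const []) ?_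
  have hD : Primrec fun x : (γ × List (List ℕ)) × List ℕ × List (List AtomName) =>
      (Sum.inr x.2.1 : AtomName) := Primrec.sumInr.comp (Primrec.fst.comp Primrec.snd)
  refine Primrec.list_cons.comp (Primrec.list_cons.comp hD (Primrec.const [])) ?_
  refine Primrec.list_flatMap (primrec_xi.comp (Primrec.fst.comp
    (hc.comp (Primrec.fst.comp Primrec.fst)))) ?_
  refine Primrec.list_map (Primrec.snd.comp (Primrec.snd.comp Primrec.fst)) ?_
  exact Primrec.list_cons.comp (hD.comp (Primrec.fst.comp Primrec.fst))
    (Primrec.list_cons.comp (Primrec.sumInl.comp (Primrec.snd.comp Primrec.fst)) Primrec.snd)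

/-- The union of the results of a binary operation for all pairs of elements of two lists. -/
def onPairs {α β σ : Type*} (f : α → β → Option (List σ)) (L : List α) (M : List β) :
    Option (List σ) :=
  (L.mapM fun i => M.mapM fun j => f i j).map fun l => l.flatten.flatten

theorem primrec_onPairs {α β σ : Type*} [Primcodable α] [Primcodable β] [Primcodable σ]
    {f : γ → α → β → Option (List σ)} {L : γ → List α} {M : γ → List β}
    (hf : Primrec fun x : (γ × α) × β => f x.1.1 x.1.2 x.2) (hL : Primrec L) (hM : Primrec M) :
    Primrec fun x => onPairs (f x) (L x) (M x) := by
  refine Primrec.option_map (primrec_list_mapM hL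
    (primrec_list_mapM (hM.comp Primrec.fst) hf)) ?_
  exact Primrec.list_flatten.comp (Primrec.list_flatten.comp Primrec.snd)

theorem primrec_onPairs_callList {f : Presentation → Code} (hf : Primrec f) {c : γ → Ctx}
    {L M : γ → List ℕ} (hc : Primrec c) (hL : Primrec L) (hM : Primrec M) :
    Primrec fun x => onPairs (fun i j => callList f (c x) (Nat.pair i j)) (L x) (M x) :=
  primrec_onPairs (f := fun x i j => callList f (c x) (Nat.pair i j))
    (primrec_callList hf (hc.comp (Primrec.fst.comp Primrec.fst))
      (Primrec₂.natPair.comp (Primrec.snd.comp Primrec.fst) Primrec.snd)) hL hM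

/-- The recursive step for the intersection of filters. -/
def filInterStep (c : Ctx) (x y : ℕ) (r₁ r₂ r₃ : List (List ℕ)) : Option (List (List ℕ)) :=
  (callList Presentation.if' c (Nat.pair x y)).map fun zs =>
    r₁.map (y :: ·) ++ (r₂.map (x :: ·) ++ zs.flatMap fun z => r₃.map (z :: ·))

/-- The intersection of the filters generated by two sequences. -/
def seqIF (c : Ctx) (v w : List ℕ) : Option (List (List ℕ)) :=
  listRec₂ (fun v w => [v ++ w]) (filInterStep c) v w

theorem primrec_map_cons {α : Type*} [Primcodable α] {a : γ → α} {l : γ → List (List α)}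
    (ha : Primrec a) (hl : Primrec l) : Primrec fun x => (l x).map (a x :: ·) :=
  Primrec.list_map hl (Primrec.list_cons.comp (ha.comp Primrec.fst) Primrec.snd)

theorem primrec_seqIF {c : γ → Ctx} {v w : γ → List ℕ} (hc : Primrec c) (hv : Primrec v)
    (hw : Primrec w) : Primrec fun x => seqIF (c x) (v x) (w x) := by
  have hstep : Primrec fun x : γ × ℕ × ℕ × List (List ℕ) × List (List ℕ) × List (List ℕ) =>
      filInterStep (c x.1) x.2.1 x.2.2.1 x.2.2.2.1 x.2.2.2.2.1 x.2.2.2.2.2 := by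
    have hx : Primrec fun x : γ × ℕ × ℕ × List (List ℕ) × List (List ℕ) × List (List ℕ) =>
      x.2.1 := Primrec.fst.comp Primrec.snd
    have h2 : Primrec fun x : γ × ℕ × ℕ × List (List ℕ) × List (List ℕ) × List (List ℕ) =>
      x.2.2 := Primrec.snd.comp Primrec.snd
    have hy := Primrec.fst.comp h2
    have hr := Primrec.snd.comp h2
    refine Primrec.option_map (primrec_callList primrec_if' (hc.comp Primrec.fst)
      (Primrec₂.natPair.comp hx hy)) ?_
    refine Primrec.list_append.comp (primrec_map_cons (hy.comp Primrec.fst)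
      ((Primrec.fst.comp hr).comp Primrec.fst)) (Primrec.list_append.comp
        (primrec_map_cons (hx.comp Primrec.fst)
          ((Primrec.fst.comp (Primrec.snd.comp hr)).comp Primrec.fst)) ?_)
    refine Primrec.list_flatMap Primrec.snd ?_
    exact primrec_map_cons Primrec.snd ((Primrec.snd.comp (Primrec.snd.comp hr)).comp
      (Primrec.fst.comp Primrec.fst))
  have hbase : Primrec fun x : γ × List ℕ × List ℕ => [x.2.1 ++ x.2.2] :=
    Primrec.list_cons.comp (Primrec.list_append.comp (Primrec.fst.comp Primrec.snd)
      (Primrec.snd.comp Primrec.snd)) (Primrec.const [])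
  exact primrec_listRec₂ (base := fun _ v w => [v ++ w]) (step := fun x => filInterStep (c x))
    hbase hstep hv hw

/-- The union for `k` in `L` of the products of `k + ε` with the elements of `r`. -/
def optProds (L : List ℕ) (r : List (List AtomName)) : List (List AtomName) :=
  L.flatMap fun k => r.map (Sum.inl k :: ·)

theorem primrec_optProds {L : γ → List ℕ} {r : γ → List (List AtomName)} (hL : Primrec L)
    (hr : Primrec r) : Primrec fun x => optProds (L x) (r x) :=
  Primrec.list_flatMap hL (primrec_map_cons (Primrec.sumInl.comp Primrec.snd)
    (hr.comp Primrec.fst))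

/-- The intersection of two nonempty products of atoms, from the intersection `L` of the sets of
letters of their first atoms and the intersections of shorter products. -/
def idlInterCases (A B : AtomName) (L : List ℕ) (r₁ r₂ r₃ : List (List AtomName)) :
    List (List AtomName) :=
  Sum.casesOn A
    (fun _ => Sum.casesOn B (fun _ => (r₁ ++ r₂) ++ optProds L r₃)
      fun _ => (r₁ ++ r₂) ++ optProds L r₂)
    fun _ => Sum.casesOn B (fun _ => (r₁ ++ r₂) ++ optProds L r₁)
      fun _ => (r₁ ++ r₂).map (Sum.inr L :: ·)

/-- The recursive step for the intersection of products of atoms. -/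
def idlInterStep (c : Ctx) (A B : AtomName) (r₁ r₂ r₃ : List (List AtomName)) :
    Option (List (List AtomName)) :=
  (onPairs (fun i j => callList Presentation.ii c (Nat.pair i j)) (letters A) (letters B)).map
    fun L => idlInterCases A B L r₁ r₂ r₃

/-- The intersection of two products of atoms. -/
def seqII (c : Ctx) (P Q : List AtomName) : Option (List (List AtomName)) :=
  listRec₂ (fun _ _ => [[]]) (idlInterStep c) P Q

theorem primrec_idlInterCases {A B : γ → AtomName} {L : γ → List ℕ}
    {r₁ r₂ r₃ : γ → List (List AtomName)} (hA : Primrec A) (hB : Primrec B) (hL : Primrec L)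
    (h₁ : Primrec r₁) (h₂ : Primrec r₂) (h₃ : Primrec r₃) :
    Primrec fun x => idlInterCases (A x) (B x) (L x) (r₁ x) (r₂ x) (r₃ x) := by
  have h := Primrec.list_append.comp h₁ h₂
  refine Primrec.sumCasesOn (σ := List (List AtomName)) hA
    (g := fun x _ => Sum.casesOn (B x) (fun _ => (r₁ x ++ r₂ x) ++ optProds (L x) (r₃ x))
      fun _ => (r₁ x ++ r₂ x) ++ optProds (L x) (r₂ x))
    (h := fun x _ => Sum.casesOn (B x) (fun _ => (r₁ x ++ r₂ x) ++ optProds (L x) (r₁ x))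
      fun _ => (r₁ x ++ r₂ x).map (Sum.inr (L x) :: ·)) ?_ ?_
  · have h' : Primrec fun x : γ => (Sum.casesOn (B x)
        (fun _ => (r₁ x ++ r₂ x) ++ optProds (L x) (r₃ x))
        fun _ => (r₁ x ++ r₂ x) ++ optProds (L x) (r₂ x) : List (List AtomName)) :=
      Primrec.sumCasesOn hB
        ((Primrec.list_append.comp h (primrec_optProds hL h₃)).comp Primrec.fst).to₂
        ((Primrec.list_append.comp h (primrec_optProds hL h₂)).comp Primrec.fst).to₂
    exact (h'.comp Primrec.fst).to₂
  · have h' : Primrec fun x : γ => (Sum.casesOn (B x)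
        (fun _ => (r₁ x ++ r₂ x) ++ optProds (L x) (r₁ x))
        fun _ => (r₁ x ++ r₂ x).map (Sum.inr (L x) :: ·) : List (List AtomName)) :=
      Primrec.sumCasesOn hB
        ((Primrec.list_append.comp h (primrec_optProds hL h₁)).comp Primrec.fst).to₂
        ((primrec_map_cons (Primrec.sumInr.comp hL) h).comp Primrec.fst).to₂
    exact (h'.comp Primrec.fst).to₂

theorem primrec_seqII {c : γ → Ctx} {P Q : γ → List AtomName} (hc : Primrec c)
    (hP : Primrec P) (hQ : Primrec Q) : Primrec fun x => seqII (c x) (P x) (Q x) := by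
  have hstep : Primrec fun x : γ × AtomName × AtomName × List (List AtomName) ×
      List (List AtomName) × List (List AtomName) =>
      idlInterStep (c x.1) x.2.1 x.2.2.1 x.2.2.2.1 x.2.2.2.2.1 x.2.2.2.2.2 := by
    have hA : Primrec fun x : γ × AtomName × AtomName × List (List AtomName) ×
      List (List AtomName) × List (List AtomName) => x.2.1 := Primrec.fst.comp Primrec.snd
    have h2 : Primrec fun x : γ × AtomName × AtomName × List (List AtomName) ×
      List (List AtomName) × List (List AtomName) => x.2.2 := Primrec.snd.comp Primrec.snd
    have hB := Primrec.fst.comp h2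
    have hr := Primrec.snd.comp h2
    refine Primrec.option_map (primrec_onPairs_callList primrec_ii (hc.comp Primrec.fst)
      (primrec_letters.comp hA) (primrec_letters.comp hB)) ?_
    exact primrec_idlInterCases (hA.comp Primrec.fst) (hB.comp Primrec.fst) Primrec.snd
      ((Primrec.fst.comp hr).comp Primrec.fst)
      ((Primrec.fst.comp (Primrec.snd.comp hr)).comp Primrec.fst)
      ((Primrec.snd.comp (Primrec.snd.comp hr)).comp Primrec.fst)
  exact primrec_listRec₂ (base := fun _ _ _ => [[]]) (step := fun x => idlInterStep (c x))
    (Primrec.const _) hstep hP hQ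

/-- The complement of a union of ideals. -/
def complLower (c : Ctx) (D : List ℕ) : Option (List ℕ) :=
  D.foldr (fun i s => s.bind fun U => (callList Presentation.ci c i).bind fun V =>
    onPairs (fun a b => callList Presentation.if' c (Nat.pair a b)) V U) (some c.1.xf)

theorem primrec_complLower {c : γ → Ctx} {D : γ → List ℕ} (hc : Primrec c) (hD : Primrec D) :
    Primrec fun x => complLower (c x) (D x) := by
  refine Primrec.list_foldr (h := fun x (y : ℕ × Option (List ℕ)) => y.2.bind fun U =>
    (callList Presentation.ci (c x) y.1).bind fun V =>
      onPairs (fun a b => callList Presentation.if' (c x) (Nat.pair a b)) V U)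
    hD (Primrec.option_some.comp (primrec_xf.comp (Primrec.fst.comp hc))) ?_
  refine Primrec.option_bind (Primrec.snd.comp Primrec.snd) ?_
  refine Primrec.option_bind (primrec_callList primrec_ci
    (hc.comp (Primrec.fst.comp Primrec.fst))
    (Primrec.fst.comp (Primrec.snd.comp Primrec.fst))) ?_
  exact primrec_onPairs_callList primrec_if'
    (hc.comp (Primrec.fst.comp (Primrec.fst.comp Primrec.fst))) Primrec.snd
    (Primrec.snd.comp Primrec.fst)

/-- Sequences of length two that generate the set of all sequences of length at least two, if the
atom contains no sequence of length two; otherwise, nothing. -/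
def longWords (xf : List ℕ) (A : AtomName) : List (List ℕ) :=
  Sum.casesOn A (fun _ => xf.flatMap fun a => xf.map fun b => [a, b]) fun _ => []

/-- The complement of an atom. -/
def complAtom (c : Ctx) (A : AtomName) : Option (List (List ℕ)) :=
  (complLower c (letters A)).map fun U => U.map (fun a => [a]) ++ longWords c.1.xf A

theorem primrec_complAtom {c : γ → Ctx} {A : γ → AtomName} (hc : Primrec c) (hA : Primrec A) :
    Primrec fun x => complAtom (c x) (A x) := by
  refine Primrec.option_map (primrec_complLower hc (primrec_letters.comp hA)) ?_
  refine Primrec.list_append.comp (Primrec.list_map Primrec.snd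
    (Primrec.list_cons.comp Primrec.snd (Primrec.const []))) ?_
  have hxf : Primrec fun x => (c x).1.xf := primrec_xf.comp (Primrec.fst.comp hc)
  have h : Primrec fun x => longWords (c x).1.xf (A x) := by
    refine Primrec.sumCasesOn hA ?_ (Primrec.const []).to₂
    refine Primrec.list_flatMap (hxf.comp Primrec.fst) ?_
    refine Primrec.list_map (hxf.comp (Primrec.fst.comp Primrec.fst)) ?_
    exact Primrec.list_cons.comp (Primrec.snd.comp Primrec.fst)
      (Primrec.list_cons.comp Primrec.snd (Primrec.const []))
  exact h.comp Primrec.fst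

/-- The operation `⊙` for the filters generated by two sequences. -/
def odotFil (c : Ctx) (u v : List ℕ) : Option (List (List ℕ)) :=
  List.casesOn u.reverse (some [[]]) fun a s => List.casesOn v (some [[]]) fun b t =>
    (callList Presentation.if' c (Nat.pair a b)).map fun zs =>
      (u ++ v) :: zs.map fun z => s.reverse ++ z :: t

theorem primrec_odotFil {c : γ → Ctx} {u v : γ → List ℕ} (hc : Primrec c) (hu : Primrec u)
    (hv : Primrec v) : Primrec fun x => odotFil (c x) (u x) (v x) := by
  refine Primrec.list_casesOn (σ := Option (List (List ℕ)))
    (h := fun x (y : ℕ × List ℕ) => List.casesOn (v x) (some [[]])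
    fun b t => (callList Presentation.if' (c x) (Nat.pair y.1 b)).map fun zs =>
      (u x ++ v x) :: zs.map fun z => y.2.reverse ++ z :: t)
    (Primrec.list_reverse.comp hu) (Primrec.const _) ?_
  refine Primrec.list_casesOn (f := fun x : γ × ℕ × List ℕ => v x.1)
    (h := fun x (y : ℕ × List ℕ) =>
      (callList Presentation.if' (c x.1) (Nat.pair x.2.1 y.1)).map fun zs =>
        (u x.1 ++ v x.1) :: zs.map fun z => x.2.2.reverse ++ z :: y.2)
    (hv.comp Primrec.fst) (Primrec.const _) ?_
  have h1 : Primrec fun x : (γ × ℕ × List ℕ) × ℕ × List ℕ => x.1.1 :=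
    Primrec.fst.comp Primrec.fst
  have h2 : Primrec fun x : (γ × ℕ × List ℕ) × ℕ × List ℕ => x.1.2 :=
    Primrec.snd.comp Primrec.fst
  refine Primrec.option_map (primrec_callList primrec_if' (hc.comp h1) (Primrec₂.natPair.comp
    (Primrec.fst.comp h2) (Primrec.fst.comp Primrec.snd))) ?_
  refine Primrec.list_cons.comp (Primrec.list_append.comp (hu.comp (h1.comp Primrec.fst))
    (hv.comp (h1.comp Primrec.fst))) (Primrec.list_map Primrec.snd ?_)
  have h3 : Primrec fun x : (((γ × ℕ × List ℕ) × ℕ × List ℕ) × List ℕ) × ℕ => x.1.1.1.2 :=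
    h2.comp (Primrec.fst.comp Primrec.fst)
  exact Primrec.list_append.comp (Primrec.list_reverse.comp (Primrec.snd.comp h3))
    (Primrec.list_cons.comp Primrec.snd
      (Primrec.snd.comp (Primrec.snd.comp (Primrec.fst.comp Primrec.fst))))

/-- The complement of a product of atoms. -/
def seqCI (c : Ctx) (P : List AtomName) : Option (List (List ℕ)) :=
  P.foldr (fun A s => s.bind fun V => (complAtom c A).bind fun U => onPairs (odotFil c) U V)
    (some (c.1.xf.map fun a => [a]))

theorem primrec_seqCI {c : γ → Ctx} {P : γ → List AtomName} (hc : Primrec c) (hP : Primrec P) :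
    Primrec fun x => seqCI (c x) (P x) := by
  refine Primrec.list_foldr (h := fun x (y : AtomName × Option (List (List ℕ))) =>
    y.2.bind fun V => (complAtom (c x) y.1).bind fun U => onPairs (odotFil (c x)) U V) hP ?_ ?_
  · exact Primrec.option_some.comp (Primrec.list_map (primrec_xf.comp (Primrec.fst.comp hc))
      (Primrec.list_cons.comp Primrec.snd (Primrec.const [])))
  · refine Primrec.option_bind (Primrec.snd.comp Primrec.snd) ?_
    refine Primrec.option_bind (primrec_complAtom (hc.comp (Primrec.fst.comp Primrec.fst))
      (Primrec.fst.comp (Primrec.snd.comp Primrec.fst))) ?_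
    refine primrec_onPairs (f := fun (x : ((γ × AtomName × Option (List (List ℕ))) ×
      List (List ℕ)) × List (List ℕ)) => odotFil (c x.1.1.1)) ?_ Primrec.snd
      (Primrec.snd.comp Primrec.fst)
    refine primrec_odotFil ?_ (Primrec.snd.comp Primrec.fst) Primrec.snd
    exact hc.comp (Primrec.fst.comp (Primrec.fst.comp (Primrec.fst.comp
      (Primrec.fst.comp Primrec.fst))))

end Programs

/-! ### Finite unions -/

section Means

variable {σ W : Type*}

/-- The elements of the list `l` are valid names, and the union of the sets that they denote
is `S`. -/
def Means (ok : σ → Prop) (den : σ → Set W) (l : List σ) (S : Set W) : Prop :=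
  (∀ a ∈ l, ok a) ∧ S = {w | ∃ a ∈ l, w ∈ den a}

variable {ok : σ → Prop} {den : σ → Set W}

theorem Means.nil : Means ok den [] ∅ := ⟨by simp, by simp⟩

theorem Means.singleton {a : σ} (h : ok a) : Means ok den [a] (den a) :=
  ⟨by simpa using h, by simp⟩

theorem Means.append {l m : List σ} {S T : Set W} (hl : Means ok den l S)
    (hm : Means ok den m T) : Means ok den (l ++ m) (S ∪ T) := by
  obtain ⟨h, rfl⟩ := hl
  obtain ⟨h', rfl⟩ := hm
  refine ⟨fun a ha => (List.mem_append.1 ha).elim (h a) (h' a), ?_⟩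
  ext w
  simp only [Set.mem_union, Set.mem_ofPred_eq, List.mem_append, or_and_right, exists_or]

theorem Means.flatten {ι : Type*} {l : List ι} {ls : List (List σ)} {S : ι → Set W}
    (h : List.Forall₂ (fun i m => Means ok den m (S i)) l ls) :
    Means ok den ls.flatten {w | ∃ i ∈ l, w ∈ S i} := by
  induction h with
  | nil => simpa using Means.nil
  | cons h _ ih =>
    rw [List.flatten_cons]
    convert h.append ih using 1
    ext w
    simp

theorem Means.flatMap {ι : Type*} {l : List ι} {f : ι → List σ} {S : ι → Set W}
    (h : ∀ i ∈ l, Means ok den (f i) (S i)) :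
    Means ok den (l.flatMap f) {w | ∃ i ∈ l, w ∈ S i} := by
  rw [List.flatMap_def]
  refine Means.flatten (List.forall₂_map_right_iff.2 ?_)
  exact List.forall₂_same.2 h

theorem Means.map {τ V : Type*} {ok' : τ → Prop} {den' : τ → Set V} {l : List σ} {S : Set W}
    {f : σ → τ} {F : Set W → Set V} (h : Means ok den l S) (hok : ∀ a, ok a → ok' (f a))
    (hden : ∀ a, ok a → den' (f a) = F (den a))
    (hF : ∀ w, w ∈ F S ↔ ∃ a ∈ l, w ∈ F (den a)) : Means ok' den' (l.map f) (F S) := by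
  obtain ⟨h, rfl⟩ := h
  refine ⟨fun b hb => ?_, ?_⟩
  · obtain ⟨a, ha, rfl⟩ := List.mem_map.1 hb
    exact hok a (h a ha)
  · ext w
    rw [hF]
    constructor
    · rintro ⟨a, ha, hw⟩
      exact ⟨f a, List.mem_map_of_mem ha, (hden a (h a ha)).symm ▸ hw⟩
    · rintro ⟨b, hb, hw⟩
      obtain ⟨a, ha, rfl⟩ := List.mem_map.1 hb
      exact ⟨a, ha, hden a (h a ha) ▸ hw⟩

theorem Computes.onPairs {α β : Type*} {f : ℕ → α → β → Option (List σ)} {L : List α}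
    {M : List β} {S : α → β → Set W}
    (h : ∀ i ∈ L, ∀ j ∈ M, Computes (fun k => f k i j) fun l => Means ok den l (S i j)) :
    Computes (fun k => IdealEff.onPairs (f k) L M) fun l =>
      Means ok den l {w | ∃ i ∈ L, ∃ j ∈ M, w ∈ S i j} := by
  refine (Computes.mapM L fun i hi => Computes.mapM M fun j hj => h i hi j hj).map
    fun lll hlll => ?_
  have h' : List.Forall₂ (fun i m => Means ok den m {w | ∃ j ∈ M, w ∈ S i j}) L
      (lll.map List.flatten) :=
    List.forall₂_map_right_iff.2 (hlll.imp fun i ll hll => Means.flatten hll)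
  have := Means.flatten h'
  rwa [List.flatten_flatten]

end Means

/-! ### Answers -/

/-- `b` is `1` if `P` holds and `0` otherwise. -/
def IsAnswer (P : Prop) (b : ℕ) : Prop := (P → b = 1) ∧ (¬ P → b = 0)

theorem IsAnswer.congr {P Q : Prop} {b : ℕ} (h : IsAnswer P b) (hPQ : P ↔ Q) : IsAnswer Q b :=
  ⟨fun hQ => h.1 (hPQ.2 hQ), fun hQ => h.2 fun hP => hQ (hPQ.1 hP)⟩

theorem IsAnswer.eq_one_iff {P : Prop} {b : ℕ} (h : IsAnswer P b) : b = 1 ↔ P := by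
  refine ⟨fun hb => ?_, h.1⟩
  by_contra hP
  rw [h.2 hP] at hb
  cases hb

theorem IsAnswer.eq_zero_iff {P : Prop} {b : ℕ} (h : IsAnswer P b) : b = 0 ↔ ¬ P := by
  refine ⟨fun hb hP => ?_, h.2⟩
  rw [h.1 hP] at hb
  cases hb

theorem answers_iff {f : ℕ →. ℕ} {n : ℕ} {P : Prop} :
    DataStructures.Answers f n P ↔ ∃ b ∈ f n, IsAnswer P b := by
  constructor
  · intro h
    by_cases hP : P
    · exact ⟨1, h.1 hP, fun _ => rfl, fun h => (h hP).elim⟩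
    · exact ⟨0, h.2 hP, fun h => (hP h).elim, fun _ => rfl⟩
  · rintro ⟨b, hb, h⟩
    exact ⟨fun hP => h.1 hP ▸ hb, fun hP => h.2 hP ▸ hb⟩

theorem isAnswer_allAnswers {α : Type*} {l : List α} {bs : List ℕ} {P : α → Prop}
    (h : List.Forall₂ (fun a b => IsAnswer (P a) b) l bs) :
    IsAnswer (∀ a ∈ l, P a) (allAnswers bs) := by
  have key : (∃ b ∈ bs, b = 0) ↔ ¬ ∀ a ∈ l, P a := by
    induction h with
    | nil => simp
    | cons h _ ih =>
      simp only [List.mem_cons, exists_eq_or_imp, forall_eq_or_imp, not_and_or, h.eq_zero_iff]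
      exact or_congr_right ih
  unfold allAnswers
  exact ⟨fun hP => if_neg fun h => key.1 h hP, fun hP => if_pos (key.2 hP)⟩

theorem isAnswer_anyAnswer {α : Type*} {l : List α} {bs : List ℕ} {P : α → Prop}
    (h : List.Forall₂ (fun a b => IsAnswer (P a) b) l bs) :
    IsAnswer (∃ a ∈ l, P a) (anyAnswer bs) := by
  have key : (∃ b ∈ bs, b = 1) ↔ ∃ a ∈ l, P a := by
    induction h with
    | nil => simp
    | cons h _ ih =>
      simp only [List.mem_cons, exists_eq_or_imp, h.eq_one_iff]
      exact or_congr_right ih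
  unfold anyAnswer
  exact ⟨fun hP => if_pos (key.2 hP), fun hP => if_neg fun h => hP (key.1 h)⟩

/-! ### Denotations of names -/

theorem mapM_eq_some {α β : Type*} {f : α → Option β} {l : List α} {L : List β} :
    l.mapM f = some L ↔ List.Forall₂ (fun a b => f a = some b) l L := by
  induction l generalizing L with
  | nil => simp [eq_comm]
  | cons a l ih =>
    rw [List.mapM_cons, List.forall₂_cons_left_iff]
    simp only [Option.bind_eq_bind, Option.bind_eq_some_iff, ih, Option.pure_def,
      Option.some.injEq]
    constructor
    · rintro ⟨b, hb, L', hL', rfl⟩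
      exact ⟨b, L', hb, hL', rfl⟩
    · rintro ⟨b, L', hb, hL', rfl⟩
      exact ⟨b, hb, L', hL', rfl⟩

theorem exists_forall₂_iff {α β : Type*} {f : α → Option β} {l : List α} :
    (∃ L, List.Forall₂ (fun a b => f a = some b) l L) ↔ ∀ a ∈ l, (f a).isSome := by
  induction l with
  | nil => simp
  | cons a l ih =>
    rw [List.forall_mem_cons, ← ih]
    constructor
    · rintro ⟨_, h | ⟨h, h'⟩⟩
      exact ⟨by rw [h]; rfl, _, h'⟩
    · rintro ⟨h, L, hL⟩
      obtain ⟨b, hb⟩ := Option.isSome_iff_exists.1 h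
      exact ⟨b :: L, .cons hb hL⟩

/-- A list of names denotes the set `S`, in the sense of `DataStructures.down` and
`DataStructures.up`, if and only if it means `S`. -/
theorem mapM_map_eq_some {σ τ W : Type*} {f : σ → Option τ} {d : τ → Set W} {den : σ → Set W}
    (hden : ∀ a b, f a = some b → den a = d b) {l : List σ} {S : Set W} :
    (l.mapM f).map (fun L => {w | ∃ b ∈ L, w ∈ d b}) = some S ↔
      Means (fun a => (f a).isSome = true) den l S := by
  have key : ∀ L, List.Forall₂ (fun a b => f a = some b) l L →
      {w | ∃ b ∈ L, w ∈ d b} = {w | ∃ a ∈ l, w ∈ den a} := by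
    intro L hL
    induction hL with
    | nil => simp
    | cons h _ ih =>
      ext w
      have := Set.ext_iff.1 ih w
      simp only [Set.mem_ofPred_eq, List.mem_cons, exists_eq_or_imp] at this ⊢
      rw [this, hden _ _ h]
  simp only [Option.map_eq_some_iff, mapM_eq_some]
  unfold Means
  rw [← exists_forall₂_iff]
  constructor
  · rintro ⟨L, hL, rfl⟩
    exact ⟨⟨L, hL⟩, key L hL⟩
  · rintro ⟨⟨L, hL⟩, rfl⟩
    exact ⟨L, hL, key L hL⟩

namespace DataStructures

variable {X : Type u} (D : DataStructures X)

/-- The ideal with a given name (empty if the name is not valid). -/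
def idlSet (i : ℕ) : Set X := (D.idl i).getD ∅

/-- The union of the ideals with given names. -/
def lowSet (l : List ℕ) : Set X := {x | ∃ i ∈ l, x ∈ D.idlSet i}

/-- A valid name of an ideal. -/
abbrev OkIdl (i : ℕ) : Prop := (D.idl i).isSome = true

/-- A valid name of an element. -/
abbrev OkElt (n : ℕ) : Prop := (D.elt n).isSome = true

/-- The atom with a given name. -/
def atomSet (A : AtomName) : Atom (Set X) :=
  Sum.casesOn A (fun i => Atom.opt (D.idlSet i)) fun l => Atom.star (D.lowSet l)

/-- A valid name of an atom. -/
def OkAtom (A : AtomName) : Prop := ∀ i ∈ letters A, D.OkIdl i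

/-- A valid name of a product of atoms. -/
def OkProd (P : List AtomName) : Prop := ∀ A ∈ P, D.OkAtom A

/-- The product of atoms with given names. -/
def prodSet (P : List AtomName) : Set (SeqExt X) := Atom.prod (P.map D.atomSet)

/-- A valid name of a sequence. -/
def OkWord (w : List ℕ) : Prop := ∀ n ∈ w, D.OkElt n

/-- `w` is a name of the sequence `v`. -/
def Names (w : List ℕ) (v : List X) : Prop := List.Forall₂ (fun n x => D.elt n = some x) w v

theorem idl_eq_some {i : ℕ} {I : Set X} : D.idl i = some I ↔ D.OkIdl i ∧ I = D.idlSet i := by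
  unfold OkIdl idlSet
  cases D.idl i <;> simp [eq_comm]

theorem down_eq_some {l : List ℕ} {S : Set X} :
    D.down l = some S ↔ Means D.OkIdl D.idlSet l S :=
  mapM_map_eq_some (d := id) fun _ _ h => ((D.idl_eq_some).1 h).2.symm

theorem down_eq_some' {l : List ℕ} {S : Set X} :
    D.down l = some S ↔ (∀ i ∈ l, D.OkIdl i) ∧ S = D.lowSet l := D.down_eq_some

theorem atom_eq_some {A : AtomName} {B : Atom (Set X)} :
    D.atom A = some B ↔ D.OkAtom A ∧ B = D.atomSet A := by
  cases A with
  | inl i =>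
    simp only [atom, Option.map_eq_some_iff, idl_eq_some]
    constructor
    · rintro ⟨I, ⟨h, rfl⟩, rfl⟩
      exact ⟨by simpa [OkAtom, letters] using h, rfl⟩
    · rintro ⟨h, rfl⟩
      exact ⟨_, ⟨by simpa [OkAtom, letters] using h, rfl⟩, rfl⟩
  | inr l =>
    simp only [atom, Option.map_eq_some_iff, down_eq_some']
    constructor
    · rintro ⟨I, ⟨h, rfl⟩, rfl⟩
      exact ⟨h, rfl⟩
    · rintro ⟨h, rfl⟩
      exact ⟨_, ⟨h, rfl⟩, rfl⟩

theorem forall₂_atom {P : List AtomName} {L : List (Atom (Set X))} :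
    List.Forall₂ (fun A B => D.atom A = some B) P L ↔ D.OkProd P ∧ L = P.map D.atomSet := by
  induction P generalizing L with
  | nil => simp [OkProd]
  | cons A P ih =>
    rw [List.forall₂_cons_left_iff]
    constructor
    · rintro ⟨B, L', h, h', rfl⟩
      obtain ⟨h₁, rfl⟩ := D.atom_eq_some.1 h
      obtain ⟨h₂, rfl⟩ := ih.1 h'
      exact ⟨List.forall_mem_cons.2 ⟨h₁, h₂⟩, rfl⟩
    · rintro ⟨h, rfl⟩
      have h := List.forall_mem_cons.1 h
      exact ⟨_, _, D.atom_eq_some.2 ⟨h.1, rfl⟩, ih.2 ⟨h.2, rfl⟩, rfl⟩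

theorem seq_idl_encode {P : List AtomName} {S : Set (SeqExt X)} :
    D.seq.idl (encode P) = some S ↔ D.OkProd P ∧ S = D.prodSet P := by
  simp only [seq, encodek, Option.bind_some, Option.map_eq_some_iff, mapM_eq_some, forall₂_atom]
  constructor
  · rintro ⟨L, ⟨h, rfl⟩, rfl⟩
    exact ⟨h, rfl⟩
  · rintro ⟨h, rfl⟩
    exact ⟨_, ⟨h, rfl⟩, rfl⟩

theorem seq_elt_encode {w : List ℕ} {v : List X} :
    D.seq.elt (encode w) = some (SeqExt.mk v) ↔ D.Names w v := by
  simp only [seq, encodek]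
  exact mapM_eq_some

theorem okWord_iff {w : List ℕ} : D.OkWord w ↔ ∃ v, D.Names w v := exists_forall₂_iff.symm

theorem Names.unique {D : DataStructures X} {w : List ℕ} {v v' : List X} (h : D.Names w v)
    (h' : D.Names w v') : v = v' := by
  have := mapM_eq_some.2 h
  rw [mapM_eq_some.2 h'] at this
  exact (Option.some.inj this).symm

theorem seq_down_map_encode {L : List (List AtomName)} {S : Set (SeqExt X)}
    (h : Means D.OkProd D.prodSet L S) : D.seq.down (L.map encode) = some S := by
  rw [down_eq_some]
  have key : ∀ P, D.OkProd P → D.seq.OkIdl (encode P) ∧ D.seq.idlSet (encode P) = D.prodSet P := by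
    intro P hP
    have h := (D.seq.idl_eq_some).1 (D.seq_idl_encode.2 ⟨hP, rfl⟩)
    exact ⟨h.1, h.2.symm⟩
  refine h.map (F := _root_.id) (fun P hP => (key P hP).1) (fun P hP => (key P hP).2) fun w => ?_
  rw [h.2]
  rfl

section Order

variable [Preorder X]

/-- The filter generated by the element with a given name. -/
def eltSet (n : ℕ) : Set X := {y | ∃ x, D.elt n = some x ∧ x ≤ y}

/-- The filter generated by the sequence with a given name. -/
def filSet (w : List ℕ) : Set (SeqExt X) := {t | ∃ v, D.Names w v ∧ t ∈ fil v}

theorem eltSet_eq {n : ℕ} {x : X} (h : D.elt n = some x) : D.eltSet n = Set.Ici x := by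
  ext y
  simp [eltSet, h]

theorem filSet_eq {w : List ℕ} {v : List X} (h : D.Names w v) : D.filSet w = fil v := by
  ext t
  constructor
  · rintro ⟨v', hv', ht⟩
    rwa [h.unique hv']
  · exact fun ht => ⟨v, h, ht⟩

theorem isUpperSet_filSet (w : List ℕ) : IsUpperSet (D.filSet w) :=
  fun _ _ h ⟨v, hv, ht⟩ => ⟨v, hv, isUpperSet_fil v h ht⟩

theorem up_eq_some {l : List ℕ} {S : Set X} :
    D.up l = some S ↔ Means D.OkElt D.eltSet l S :=
  mapM_map_eq_some (d := Set.Ici) fun _ _ h => D.eltSet_eq h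

theorem seq_up_map_encode {U : List (List ℕ)} {S : Set (SeqExt X)}
    (h : Means D.OkWord D.filSet U S) : D.seq.up (U.map encode) = some S := by
  rw [up_eq_some]
  have key : ∀ w, D.OkWord w → D.seq.OkElt (encode w) ∧ D.seq.eltSet (encode w) = D.filSet w := by
    intro w hw
    obtain ⟨v, hv⟩ := D.okWord_iff.1 hw
    have h := D.seq_elt_encode.2 hv
    refine ⟨Option.isSome_iff_exists.2 ⟨_, h⟩, ?_⟩
    rw [D.seq.eltSet_eq h, D.filSet_eq hv]
    rfl
  refine h.map (F := _root_.id) (fun P hP => (key P hP).1) (fun P hP => (key P hP).2) fun w => ?_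
  rw [h.2]
  rfl

theorem Exact.isIdeal_idlSet {D : DataStructures X} (h : D.Exact) {i : ℕ} (hi : D.OkIdl i) :
    Order.IsIdeal (D.idlSet i) :=
  (h.idl _).1 ⟨i, D.idl_eq_some.2 ⟨hi, rfl⟩⟩

theorem Exact.isLowerSet_lowSet {D : DataStructures X} (h : D.Exact) {l : List ℕ}
    (hl : ∀ i ∈ l, D.OkIdl i) : IsLowerSet (D.lowSet l) :=
  fun _ _ hab ⟨i, hi, ha⟩ => ⟨i, hi, (h.isIdeal_idlSet (hl i hi)).IsLowerSet hab ha⟩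

theorem Exact.valid_atomSet {D : DataStructures X} (h : D.Exact) {A : AtomName}
    (hA : D.OkAtom A) : (D.atomSet A).Valid := by
  cases A with
  | inl i => exact h.isIdeal_idlSet (hA i (by simp [letters]))
  | inr l => exact h.isLowerSet_lowSet hA

theorem Exact.valid_of_mem {D : DataStructures X} (h : D.Exact) {P : List AtomName}
    (hP : D.OkProd P) : ∀ A ∈ P.map D.atomSet, A.Valid := by
  intro B hB
  obtain ⟨A, hA, rfl⟩ := List.mem_map.1 hB
  exact h.valid_atomSet (hP A hA)

theorem Exact.isIdeal_prodSet {D : DataStructures X} (h : D.Exact) {P : List AtomName}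
    (hP : D.OkProd P) : Order.IsIdeal (D.prodSet P) :=
  Atom.isIdeal_prod (h.valid_of_mem hP)

end Order

end DataStructures

open DataStructures

/-! ### Correctness of the programs for sequences -/

section Denotations

variable {X : Type u} {D : DataStructures X}

theorem okProd_iff {P : List AtomName} : D.OkProd P ↔ ∀ i ∈ P.flatMap letters, D.OkIdl i := by
  simp only [OkProd, OkAtom, List.mem_flatMap, forall_exists_index, and_imp]
  exact ⟨fun h i A hA hi => h A hA i hi, fun h A hA i hi => h i A hA hi⟩

theorem lowSet_nil : D.lowSet [] = ∅ := by simp [lowSet]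

theorem lowSet_singleton (i : ℕ) : D.lowSet [i] = D.idlSet i := by simp [lowSet]

theorem prodSet_cons (A : AtomName) (P : List AtomName) :
    D.prodSet (A :: P) = SeqExt.prod (D.atomSet A).den (D.prodSet P) := rfl

theorem prodSet_nil : D.prodSet [] = eps X := rfl

theorem den_inl (i : ℕ) : (D.atomSet (Sum.inl i)).den = opt (D.idlSet i) := rfl

theorem den_inr (l : List ℕ) : (D.atomSet (Sum.inr l)).den = star (D.lowSet l) := rfl

theorem okIdl_target {A B : AtomName} (hB : D.OkAtom B) : ∀ i ∈ target A B, D.OkIdl i := by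
  rcases A with i | l <;> rcases B with j | m
  · exact hB
  · exact hB
  · simp [target]
  · exact hB

theorem okAtom_inl {i : ℕ} (h : D.OkIdl i) : D.OkAtom (Sum.inl i) := by
  simpa [OkAtom, letters] using h

theorem lowSet_target (A B : AtomName) :
    D.lowSet (letters A) ⊆ D.lowSet (target A B) ↔ (D.atomSet A).den ⊆ (D.atomSet B).den := by
  rcases A with i | l <;> rcases B with j | m
  · rw [den_inl, den_inl, opt_subset_opt, ← lowSet_singleton, ← lowSet_singleton]; rfl
  · rw [den_inl, den_inr, opt_subset_star_iff, ← lowSet_singleton]; rfl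
  · rw [den_inl, den_inr, star_subset_opt, ← Set.subset_empty_iff, ← lowSet_nil (D := D)]; rfl
  · rw [den_inr, den_inr, star_subset_star]; rfl

theorem Means.cons_prod {L : List (List AtomName)} {S : Set (SeqExt X)} {A : AtomName}
    (hA : D.OkAtom A) (h : Means D.OkProd D.prodSet L S) :
    Means D.OkProd D.prodSet (L.map (A :: ·)) (SeqExt.prod (D.atomSet A).den S) := by
  refine h.map (F := SeqExt.prod (D.atomSet A).den)
    (fun P hP => List.forall_mem_cons.2 ⟨hA, hP⟩) (fun P _ => prodSet_cons A P) fun w => ?_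
  rw [h.2]
  constructor
  · rintro ⟨u, v, hu, ⟨P, hP, hv⟩, rfl⟩
    exact ⟨P, hP, u, v, hu, hv, rfl⟩
  · rintro ⟨P, hP, u, v, hu, hv, rfl⟩
    exact ⟨u, v, hu, ⟨P, hP, hv⟩, rfl⟩

theorem Means.star_atom {L : List ℕ} (hL : ∀ i ∈ L, D.OkIdl i) :
    Means D.OkProd D.prodSet [[Sum.inr L]] (star (D.lowSet L)) := by
  have h := Means.cons_prod (A := Sum.inr L) (D := D) hL
    (Means.singleton (ok := D.OkProd) (den := D.prodSet) (a := []) (by simp [OkProd]))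
  rwa [prodSet_nil, den_inr, prod_eps] at h

/-- The summand `S` of the product is missing in `optProds`, but it is contained in `T`. -/
theorem Means.append_optProds {K : List ℕ} (hK : ∀ i ∈ K, D.OkIdl i)
    {l r : List (List AtomName)} {S T : Set (SeqExt X)} (hl : Means D.OkProd D.prodSet l T)
    (hr : Means D.OkProd D.prodSet r S) (hST : S ⊆ T) :
    Means D.OkProd D.prodSet (l ++ optProds K r) (T ∪ SeqExt.prod (opt (D.lowSet K)) S) := by
  have h : Means D.OkProd D.prodSet (optProds K r)
      {w | ∃ i ∈ K, w ∈ SeqExt.prod (opt (D.idlSet i)) S} :=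
    Means.flatMap fun i hi => hr.cons_prod (okAtom_inl (hK i hi))
  rw [lowSet, opt_iUnion_prod, ← Set.union_assoc, Set.union_eq_left.2 hST]
  exact hl.append h

end Denotations

section Correctness

variable {X : Type u} [Preorder X] {D : DataStructures X} {p : Presentation}

theorem computes_seqDecElt (hp : IsPresentation D p) (w : List ℕ) :
    Computes (fun k => seqDecElt (p, k) w) (IsAnswer (D.OkWord w)) :=
  (Computes.mapM w fun n _ => computes_call (answers_iff.1 (hp.decElt n))).map
    fun _ h => isAnswer_allAnswers h

theorem computes_seqDecIdl (hp : IsPresentation D p) (P : List AtomName) :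
    Computes (fun k => seqDecIdl (p, k) P) (IsAnswer (D.OkProd P)) :=
  (Computes.mapM _ fun n _ => computes_call (answers_iff.1 (hp.decIdl n))).map
    fun _ h => (isAnswer_allAnswers h).congr okProd_iff.symm

/-- An ideal is contained in a union of ideals if and only if it is contained in one of them. -/
theorem lowSet_subset_lowSet (hD : D.Exact) {L M : List ℕ} (hL : ∀ i ∈ L, D.OkIdl i)
    (hM : ∀ i ∈ M, D.OkIdl i) :
    (∀ i ∈ L, ∃ j ∈ M, D.idlSet i ⊆ D.idlSet j) ↔ D.lowSet L ⊆ D.lowSet M := by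
  constructor
  · rintro h x ⟨i, hi, hx⟩
    obtain ⟨j, hj, hij⟩ := h i hi
    exact ⟨j, hj, hij hx⟩
  · intro h i hi
    obtain ⟨_, hJ, hiJ⟩ := isIdeal_subset_of_subset_iUnion (hD.isIdeal_idlSet (hL i hi))
      (L := M.map D.idlSet) (by simpa using fun j hj => (hD.isIdeal_idlSet (hM j hj)).IsLowerSet)
      (fun x hx =>
        let ⟨_, hj, hx'⟩ := h ⟨i, hi, hx⟩
        ⟨_, List.mem_map_of_mem hj, hx'⟩)
    obtain ⟨j, hj, rfl⟩ := List.mem_map.1 hJ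
    exact ⟨j, hj, hiJ⟩

theorem computes_lowerSubset (hp : IsPresentation D p) {L M : List ℕ}
    (hL : ∀ i ∈ L, D.OkIdl i) (hM : ∀ i ∈ M, D.OkIdl i) :
    Computes (fun k => lowerSubset (p, k) L M) (IsAnswer (D.lowSet L ⊆ D.lowSet M)) := by
  refine (Computes.mapM L (Q := fun i => IsAnswer (∃ j ∈ M, D.idlSet i ⊆ D.idlSet j))
    fun i hi => ?_).map fun _ h =>
      (isAnswer_allAnswers h).congr (lowSet_subset_lowSet hp.exact hL hM)
  refine (Computes.mapM M (Q := fun j => IsAnswer (D.idlSet i ⊆ D.idlSet j))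
    fun j hj => ?_).map fun _ h => isAnswer_anyAnswer h
  exact computes_call (answers_iff.1 (hp.id i j _ _ (D.idl_eq_some.2 ⟨hL i hi, rfl⟩)
    (D.idl_eq_some.2 ⟨hM j hj, rfl⟩)))

/-- Since ideals are nonempty, a product of atoms is contained in `{ε}` only if all atoms are `D*`,
with `D` given by the empty list. -/
theorem isAnswer_inclBase_nil (hD : D.Exact) {P : List AtomName} (hP : D.OkProd P) :
    IsAnswer (D.prodSet P ⊆ D.prodSet []) (inclBase P []) := by
  have key : (∀ A ∈ P, A = Sum.inr []) ↔ D.prodSet P ⊆ D.prodSet [] := by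
    induction P with
    | nil => simp
    | cons A P ih =>
      have hP' := List.forall_mem_cons.1 hP
      rw [List.forall_mem_cons, ih hP'.2, prodSet_cons, prodSet_nil,
        atom_prod_subset_eps (hD.valid_atomSet hP'.1) (hD.isIdeal_prodSet hP'.2)]
      refine and_congr_left fun _ => ?_
      rcases A with i | l
      · refine iff_of_false (by simp) fun h => ?_
        obtain ⟨x, hx⟩ := (hD.isIdeal_idlSet (hP'.1 i (by simp [letters]))).Nonempty
        exact opt_subset_star_iff.1 (le_of_eq h) hx
      · rw [den_inr, Sum.inr.injEq]
        constructor
        · rintro rfl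
          rw [lowSet_nil]
        · intro h
          have h' := star_subset_star.1 (le_of_eq h)
          rcases l with _ | ⟨i, l⟩
          · rfl
          · obtain ⟨x, hx⟩ := (hD.isIdeal_idlSet (hP'.1 i (by simp [letters]))).Nonempty
            exact (h' ⟨i, List.mem_cons_self, hx⟩).elim
  unfold inclBase
  exact ⟨fun h => if_pos (key.2 h), fun h => if_neg fun h' => h (key.1 h')⟩

theorem computes_seqIncl (hp : IsPresentation D p) {P Q : List AtomName} (hP : D.OkProd P)
    (hQ : D.OkProd Q) :
    Computes (fun k => seqIncl (p, k) P Q) (IsAnswer (D.prodSet P ⊆ D.prodSet Q)) := by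
  have hD := hp.exact
  refine Computes.listRec₂ (R := fun P Q => IsAnswer (D.prodSet P ⊆ D.prodSet Q)) (p := D.OkAtom)
    (q := D.OkAtom) (fun Q hQ => ?_) (fun P hP => isAnswer_inclBase_nil hD hP) ?_ P Q hP hQ
  · have h : inclBase [] Q = 1 := if_pos (by simp)
    exact ⟨fun _ => h, fun h => (h (eps_subset_of_ideal (hD.isIdeal_prodSet hQ))).elim⟩
  · intro A P B Q r₁ r₂ r₃ hP hQ h₁ h₂ h₃
    have hP' := List.forall_mem_cons.1 hP
    have hQ' := List.forall_mem_cons.1 hQ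
    refine (computes_lowerSubset hp hP'.1 (okIdl_target (A := A) hQ'.1)).map fun b hb => ?_
    have hA := hD.valid_atomSet hP'.1
    have hB := hD.valid_atomSet hQ'.1
    have hPi := hD.isIdeal_prodSet hP'.2
    have hQi := hD.isIdeal_prodSet hQ'.2
    by_cases hAB : (D.atomSet A).den ⊆ (D.atomSet B).den
    · rw [if_pos (hb.1 ((lowSet_target A B).2 hAB))]
      by_cases h : ∃ i j, A = Sum.inl i ∧ B = Sum.inl j
      · obtain ⟨i, j, rfl, rfl⟩ := h
        refine h₃.congr ?_
        exact (opt_prod_subset_opt_prod hA.Nonempty hQi.IsLowerSet (opt_subset_opt.1 hAB)).symm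
      · have h' : ifSubset A B r₂ r₃ = r₂ := by
          rcases A with i | l
          · rcases B with j | m
            · exact (h ⟨i, j, rfl, rfl⟩).elim
            · rfl
          · rfl
        rw [h']
        refine h₂.congr (prod_subset_prod_of_subset hAB ?_).symm
        rintro ⟨I, J, hI, hJ⟩
        refine h ?_
        rcases A with i | l
        · rcases B with j | m
          · exact ⟨i, j, rfl, rfl⟩
          · cases hJ
        · cases hI
    · have hb' : b ≠ 1 := fun h => hAB ((lowSet_target A B).1 (hb.eq_one_iff.1 h))
      rw [if_neg hb']
      exact h₁.congr (prod_subset_prod_of_not_subset hA hB hQi.IsLowerSet hAB).symm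

theorem iic_seq_cons (x : X) (v : List X) :
    Set.Iic (SeqExt.mk (x :: v)) = SeqExt.prod (opt (Set.Iic x)) (Set.Iic (SeqExt.mk v)) := by
  refine ext_mk fun w => ⟨fun h => ?_, ?_⟩
  · obtain ⟨a, b, rfl, ha, hb⟩ := emb_append_right (v := [x]) (w := v) (le_def.1 h)
    refine ⟨a, b, ?_, hb, rfl⟩
    rcases a with _ | ⟨y, a⟩
    · exact nil_mem_opt _
    · rcases cons_emb_cons.1 (show Emb (y :: a) [x] from ha) with ⟨h1, h2⟩ | h
      · obtain rfl := emb_nil.1 h2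
        exact singleton_mem_opt.2 h1
      · cases emb_nil.1 h
  · rintro ⟨a, b, rfl | ⟨y, hy, rfl⟩, hb, rfl⟩
    · exact .cons_right hb
    · exact .cons hy hb

theorem iic_seq_nil : Set.Iic (SeqExt.mk ([] : List X)) = eps X :=
  ext_mk fun _ => emb_nil

theorem computes_seqPI (hp : IsPresentation D p) {w : List ℕ} {v : List X} (hw : D.Names w v) :
    Computes (fun k => seqPI (p, k) w) fun P =>
      D.OkProd P ∧ D.prodSet P = Set.Iic (SeqExt.mk v) := by
  refine (Computes.mapM w (Q := fun n i => ∀ x, D.elt n = some x → D.idl i = some (Set.Iic x))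
    fun n hn => computes_call ?_).map fun l hl => ?_
  · obtain ⟨x, hx⟩ := Option.isSome_iff_exists.1 (D.okWord_iff.2 ⟨v, hw⟩ n hn)
    obtain ⟨i, hi, h⟩ := hp.pi n x hx
    refine ⟨i, hi, fun y hy => ?_⟩
    rw [hx] at hy
    cases hy
    exact h
  · induction hw generalizing l with
    | nil =>
      cases hl
      exact ⟨by simp [OkProd], iic_seq_nil.symm⟩
    | cons hx _ ih =>
      obtain ⟨i, l', hi, hl', rfl⟩ := List.forall₂_cons_left_iff.1 hl
      obtain ⟨h1, h2⟩ := ih l' hl'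
      obtain ⟨h3, h4⟩ := D.idl_eq_some.1 (hi _ hx)
      refine ⟨List.forall_mem_cons.2 ⟨by simpa [OkAtom, letters] using h3, h1⟩, ?_⟩
      rw [iic_seq_cons, List.map_cons, prodSet_cons, h2, den_inl, h4]

theorem computes_seqOD (hp : IsPresentation D p) {w w' : List ℕ} {v v' : List X}
    (hw : D.Names w v) (hw' : D.Names w' v') :
    Computes (fun k => seqOD (p, k) w w') (IsAnswer (SeqExt.mk v ≤ SeqExt.mk v')) :=
  (computes_seqPI hp hw).bind fun _ hP => (computes_seqPI hp hw').bind fun _ hQ =>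
    (computes_seqIncl hp hP.1 hQ.1).mono fun _ h => h.congr (by
      rw [hP.2, hQ.2, Set.Iic_subset_Iic])

/-! #### Complements of filters -/

theorem means_complFil {xi : List ℕ} (hxi : D.down xi = some Set.univ)
    {v : List X} {l : List (List ℕ)}
    (h : List.Forall₂ (fun x m => D.down m = some (Set.Ici x)ᶜ) v l) :
    Means D.OkProd D.prodSet (complFil xi l) (fil v)ᶜ := by
  induction h with
  | nil =>
    rw [fil_nil, Set.compl_univ]
    exact Means.nil
  | @cons x m v l h _ ih =>
    obtain ⟨hm, hm'⟩ := D.down_eq_some'.1 h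
    obtain ⟨hx, hx'⟩ := D.down_eq_some'.1 hxi
    have hinr : D.OkAtom (Sum.inr m) := hm
    have h1 : Means D.OkProd D.prodSet
        (xi.flatMap fun i => (complFil xi l).map fun P => Sum.inr m :: Sum.inl i :: P)
        {w | ∃ i ∈ xi, w ∈ SeqExt.prod (star (Set.Ici x)ᶜ)
          (SeqExt.prod (opt (D.idlSet i)) (fil v)ᶜ)} := by
      refine Means.flatMap fun i hi => ?_
      have := (ih.cons_prod (okAtom_inl (hx i hi))).cons_prod hinr
      rw [List.map_map, den_inr, ← hm'] at this
      exact this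
    have h2 := (Means.star_atom (D := D) hm).append h1
    rw [← hm'] at h2
    have h3 : SeqExt.prod (star (Set.Ici x)ᶜ) (SeqExt.prod (opt Set.univ) (fil v)ᶜ) =
        {w | ∃ i ∈ xi, w ∈ SeqExt.prod (star (Set.Ici x)ᶜ)
          (SeqExt.prod (opt (D.idlSet i)) (fil v)ᶜ)} := by
      -- the decomposition of `X` is not empty, because `X` has an element
      obtain ⟨j, hj, -⟩ : x ∈ D.lowSet xi := hx' ▸ Set.mem_univ x
      rw [hx', lowSet, opt_iUnion_prod]
      refine ext_mk fun w => ⟨?_, ?_⟩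
      · rintro ⟨a, b, ha, hb | ⟨i, hi, hb⟩, rfl⟩
        · exact ⟨j, hj, a, b, ha, subset_prod_left (nil_mem_opt _) hb, rfl⟩
        · exact ⟨i, hi, a, b, ha, hb, rfl⟩
      · rintro ⟨i, hi, a, b, ha, hb, rfl⟩
        exact ⟨a, b, ha, Or.inr ⟨i, hi, hb⟩, rfl⟩
    rw [compl_fil_cons_eq_union, h3]
    exact h2

theorem computes_seqCF (hp : IsPresentation D p) {w : List ℕ} {v : List X} (hw : D.Names w v) :
    Computes (fun k => seqCF (p, k) w) fun L => Means D.OkProd D.prodSet L (fil v)ᶜ := by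
  refine Computes.map (f := complFil p.xi) (Computes.mapM w
    (Q := fun n l => ∀ x, D.elt n = some x → D.down l = some (Set.Ici x)ᶜ)
    fun n hn => computes_callList (f := Presentation.cf) (p := p) ?_)
    fun l hl => means_complFil hp.xi ?_
  · obtain ⟨x, hx⟩ := Option.isSome_iff_exists.1 (D.okWord_iff.2 ⟨v, hw⟩ n hn)
    obtain ⟨l, hl, h⟩ := hp.cf n x hx
    refine ⟨l, hl, fun y hy => ?_⟩
    rw [hx] at hy
    cases hy
    exact h
  · induction hw generalizing l with
    | nil => cases hl; exact .nil
    | cons hx _ ih =>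
      obtain ⟨i, l', hi, hl', rfl⟩ := List.forall₂_cons_left_iff.1 hl
      exact .cons (hi _ hx) (ih l' hl')

/-! #### Intersections of filters -/

theorem computes_if' (hp : IsPresentation D p) {a b : ℕ} (ha : D.OkElt a) (hb : D.OkElt b) :
    Computes (fun k => callList Presentation.if' (p, k) (Nat.pair a b)) fun l =>
      Means D.OkElt D.eltSet l (D.eltSet a ∩ D.eltSet b) := by
  obtain ⟨x, hx⟩ := Option.isSome_iff_exists.1 ha
  obtain ⟨y, hy⟩ := Option.isSome_iff_exists.1 hb
  obtain ⟨l, hl, h⟩ := hp.if' a b x y hx hy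
  refine computes_callList ⟨l, hl, ?_⟩
  rw [D.eltSet_eq hx, D.eltSet_eq hy]
  exact D.up_eq_some.1 h

theorem filSet_cons {n : ℕ} (w : List ℕ) :
    D.filSet (n :: w) = SeqExt.prod (upLetters (D.eltSet n)) (D.filSet w) := by
  refine ext_mk fun t => ⟨?_, ?_⟩
  · rintro ⟨v, hv, ht⟩
    obtain ⟨x, v', hx, hv', rfl⟩ := List.forall₂_cons_left_iff.1 hv
    have ht : SeqExt.mk t ∈ fil ([x] ++ v') := ht
    rw [← fil_prod_fil] at ht
    obtain ⟨a, b, ha, hb, rfl⟩ := ht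
    exact ⟨a, b, ⟨x, ⟨x, hx, le_rfl⟩, ha⟩, ⟨v', hv', hb⟩, rfl⟩
  · rintro ⟨a, b, ⟨y, ⟨x, hx, hxy⟩, ha⟩, ⟨v, hv, hb⟩, rfl⟩
    refine ⟨x :: v, .cons hx hv, ?_⟩
    exact emb_append (u := [x]) (emb_trans (.cons hxy .nil) ha) hb

theorem Means.cons_word {U : List (List ℕ)} {S : Set (SeqExt X)} {n : ℕ} (hn : D.OkElt n)
    (h : Means D.OkWord D.filSet U S) :
    Means D.OkWord D.filSet (U.map (n :: ·)) (SeqExt.prod (upLetters (D.eltSet n)) S) := by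
  refine h.map (F := SeqExt.prod (upLetters (D.eltSet n)))
    (fun w hw => List.forall_mem_cons.2 ⟨hn, hw⟩) (fun w _ => filSet_cons w) fun t => ?_
  rw [h.2]
  constructor
  · rintro ⟨u, v, hu, ⟨P, hP, hv⟩, rfl⟩
    exact ⟨P, hP, u, v, hu, hv, rfl⟩
  · rintro ⟨P, hP, u, v, hu, hv, rfl⟩
    exact ⟨u, v, hu, ⟨P, hP, hv⟩, rfl⟩

theorem upLetters_ici (x : X) : upLetters (Set.Ici x) = fil [x] :=
  ext_mk fun _ => ⟨fun ⟨_, hy, h⟩ => emb_trans (.cons hy .nil) h, fun h => ⟨x, le_rfl, h⟩⟩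

theorem computes_seqIF (hp : IsPresentation D p) {w w' : List ℕ} (hw : D.OkWord w)
    (hw' : D.OkWord w') :
    Computes (fun k => seqIF (p, k) w w') fun U =>
      Means D.OkWord D.filSet U (D.filSet w ∩ D.filSet w') := by
  have hnil : D.filSet [] = Set.univ := by
    rw [D.filSet_eq (v := []) .nil, fil_nil]
  refine Computes.listRec₂ (R := fun w w' U => Means D.OkWord D.filSet U
    (D.filSet w ∩ D.filSet w')) (p := D.OkElt) (q := D.OkElt) (fun w hw => ?_) (fun w hw => ?_)
    ?_ w w' hw hw'
  · rw [hnil, Set.univ_inter]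
    exact Means.singleton hw
  · rw [hnil, Set.inter_univ, List.append_nil]
    exact Means.singleton hw
  · intro a w b w' r₁ r₂ r₃ hw hw' h₁ h₂ h₃
    have ha := List.forall_mem_cons.1 hw
    have hb := List.forall_mem_cons.1 hw'
    refine (computes_if' hp ha.1 hb.1).map fun zs hzs => ?_
    obtain ⟨x, hx⟩ := Option.isSome_iff_exists.1 ha.1
    obtain ⟨y, hy⟩ := Option.isSome_iff_exists.1 hb.1
    obtain ⟨v, hv⟩ := D.okWord_iff.1 ha.2
    obtain ⟨v', hv'⟩ := D.okWord_iff.1 hb.2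
    have h4 : Means D.OkWord D.filSet (zs.flatMap fun z => r₃.map (z :: ·))
        {t | ∃ z ∈ zs, t ∈ SeqExt.prod (upLetters (D.eltSet z)) (D.filSet w ∩ D.filSet w')} :=
      Means.flatMap fun z hz => h₃.cons_word (hzs.1 z hz)
    have h5 := (h₁.cons_word hb.1).append ((h₂.cons_word ha.1).append h4)
    have h6 : {t | ∃ z ∈ zs, t ∈ SeqExt.prod (upLetters (D.eltSet z))
        (D.filSet w ∩ D.filSet w')} =
        SeqExt.prod (upLetters (Set.Ici x ∩ Set.Ici y)) (D.filSet w ∩ D.filSet w') := by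
      have hzs' := hzs.2
      rw [D.eltSet_eq hx, D.eltSet_eq hy] at hzs'
      rw [hzs']
      refine ext_mk fun t => ⟨?_, ?_⟩
      · rintro ⟨z, hz, c, d, ⟨y, hy, hc⟩, hd, rfl⟩
        exact ⟨c, d, ⟨y, ⟨z, hz, hy⟩, hc⟩, hd, rfl⟩
      · rintro ⟨c, d, ⟨y, ⟨z, hz, hy⟩, hc⟩, hd, rfl⟩
        exact ⟨z, hz, c, d, ⟨y, hy, hc⟩, hd, rfl⟩
    have hav : D.filSet (a :: w) = fil (x :: v) := D.filSet_eq (.cons hx hv)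
    have hbv : D.filSet (b :: w') = fil (y :: v') := D.filSet_eq (.cons hy hv')
    rw [h6, hav, hbv, D.filSet_eq hv, D.filSet_eq hv', D.eltSet_eq hx, D.eltSet_eq hy,
      upLetters_ici, upLetters_ici] at h5
    rw [hav, hbv, fil_cons_inter_fil_cons, Set.union_assoc, Set.union_left_comm]
    exact h5

/-! #### Intersections of ideals -/

theorem computes_lowerInter (hp : IsPresentation D p) {L M : List ℕ}
    (hL : ∀ i ∈ L, D.OkIdl i) (hM : ∀ i ∈ M, D.OkIdl i) :
    Computes (fun k => onPairs (fun i j => callList Presentation.ii (p, k) (Nat.pair i j)) L M)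
      fun K => (∀ i ∈ K, D.OkIdl i) ∧ D.lowSet K = D.lowSet L ∩ D.lowSet M := by
  refine (Computes.onPairs (ok := D.OkIdl) (den := D.idlSet)
    (S := fun i j => D.idlSet i ∩ D.idlSet j) fun i hi j hj => ?_).mono fun K hK => ⟨hK.1, ?_⟩
  · obtain ⟨l, hl, h⟩ := hp.ii i j _ _ (D.idl_eq_some.2 ⟨hL i hi, rfl⟩)
      (D.idl_eq_some.2 ⟨hM j hj, rfl⟩)
    exact computes_callList ⟨l, hl, D.down_eq_some.1 h⟩
  · refine hK.2.symm.trans (Set.ext fun x => ⟨?_, ?_⟩)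
    · rintro ⟨i, hi, j, hj, h, h'⟩
      exact ⟨⟨i, hi, h⟩, j, hj, h'⟩
    · rintro ⟨⟨i, hi, h⟩, j, hj, h'⟩
      exact ⟨i, hi, j, hj, h, h'⟩

theorem computes_seqII (hp : IsPresentation D p) {P Q : List AtomName} (hP : D.OkProd P)
    (hQ : D.OkProd Q) :
    Computes (fun k => seqII (p, k) P Q) fun L =>
      Means D.OkProd D.prodSet L (D.prodSet P ∩ D.prodSet Q) := by
  have hD := hp.exact
  have hnil : Means D.OkProd D.prodSet [[]] (eps X) := Means.singleton (by simp [OkProd])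
  refine Computes.listRec₂ (R := fun P Q L => Means D.OkProd D.prodSet L
    (D.prodSet P ∩ D.prodSet Q)) (p := D.OkAtom) (q := D.OkAtom) (fun Q hQ => ?_)
    (fun P hP => ?_) ?_ P Q hP hQ
  · rw [prodSet_nil, Set.inter_eq_left.2 (eps_subset_of_ideal (hD.isIdeal_prodSet hQ))]
    exact hnil
  · rw [prodSet_nil, Set.inter_eq_right.2 (eps_subset_of_ideal (hD.isIdeal_prodSet hP))]
    exact hnil
  · intro A P B Q r₁ r₂ r₃ hP hQ h₁ h₂ h₃
    have hP' := List.forall_mem_cons.1 hP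
    have hQ' := List.forall_mem_cons.1 hQ
    refine (computes_lowerInter hp hP'.1 hQ'.1).map fun K hK => ?_
    rw [prodSet_cons] at h₁ h₂ ⊢
    rw [prodSet_cons]
    have h₁₂ := h₁.append h₂
    rcases A with i | l <;> rcases B with j | m
    · have h := h₁₂.append_optProds hK.1 h₃ fun w hw =>
        Or.inl ⟨subset_prod_left (nil_mem_opt _) hw.1, hw.2⟩
      have hK' : D.lowSet K = D.idlSet i ∩ D.idlSet j := by
        rw [hK.2]; exact congrArg₂ _ (lowSet_singleton i) (lowSet_singleton j)
      rw [hK'] at h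
      rw [den_inl, den_inl, opt_prod_inter_opt_prod]
      exact h
    · have h := h₁₂.append_optProds hK.1 h₂ fun w hw => Or.inr hw
      have hK' : D.lowSet K = D.idlSet i ∩ D.lowSet m := by
        rw [hK.2]; exact congrArg (· ∩ _) (lowSet_singleton i)
      rw [hK'] at h
      have h4 := star_prod_inter_opt_prod (D.lowSet m) (D.idlSet i) (D.prodSet Q) (D.prodSet P)
      rw [Set.inter_comm (SeqExt.prod (star _) _) (SeqExt.prod (opt _) _),
        Set.inter_comm (D.prodSet Q), Set.inter_comm _ (D.prodSet P),
        Set.inter_comm (D.lowSet m)] at h4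
      rw [den_inl, den_inr, h4]
      rw [den_inl, den_inr, Set.union_assoc, Set.union_eq_right.2
        (subset_prod_left (nil_mem_opt _))] at h
      exact h
    · have h := h₁₂.append_optProds hK.1 h₁ fun w hw => Or.inl hw
      have hK' : D.lowSet K = D.lowSet l ∩ D.idlSet j := by
        rw [hK.2]; exact congrArg (_ ∩ ·) (lowSet_singleton j)
      rw [hK'] at h
      rw [den_inl, den_inr, star_prod_inter_opt_prod]
      rw [den_inl, den_inr, Set.union_comm (SeqExt.prod _ _ ∩ _), Set.union_assoc,
        Set.union_eq_right.2 (subset_prod_left (nil_mem_opt _))] at h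
      exact h
    · have hK' : D.lowSet K = D.lowSet l ∩ D.lowSet m := hK.2
      have h := h₁₂.cons_prod (A := Sum.inr K) hK.1
      rw [den_inr, hK'] at h
      rw [den_inr, den_inr, star_prod_inter_star_prod]
      exact h

/-! #### Complements of ideals -/

theorem computes_complLower (hp : IsPresentation D p) {L : List ℕ} (hL : ∀ i ∈ L, D.OkIdl i) :
    Computes (fun k => complLower (p, k) L) fun U => Means D.OkElt D.eltSet U (D.lowSet L)ᶜ := by
  induction L with
  | nil =>
    rw [lowSet_nil, Set.compl_empty]
    exact Computes.pure (x := p.xf) (Q := fun U => Means D.OkElt D.eltSet U _)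
      (D.up_eq_some.1 hp.xf)
  | cons i L ih =>
    rw [List.forall_mem_cons] at hL
    refine (ih hL.2).bind fun U hU => ?_
    obtain ⟨V, hV, h⟩ := hp.ci i _ (D.idl_eq_some.2 ⟨hL.1, rfl⟩)
    refine (computes_callList (Q := fun V => Means D.OkElt D.eltSet V (D.idlSet i)ᶜ)
      ⟨V, hV, D.up_eq_some.1 h⟩).bind fun V hV => ?_
    refine (Computes.onPairs fun a ha b hb =>
      computes_if' hp (hV.1 a ha) (hU.1 b hb)).mono fun l hl => ?_
    convert hl using 1
    have h1 := fun x => Set.ext_iff.1 hU.2 x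
    have h2 := fun x => Set.ext_iff.1 hV.2 x
    have h3 : (D.lowSet (i :: L))ᶜ = (D.idlSet i)ᶜ ∩ (D.lowSet L)ᶜ := by
      ext x
      simp [lowSet]
    rw [h3]
    ext x
    constructor
    · rintro ⟨hx, hx'⟩
      obtain ⟨a, ha, hxa⟩ := (h2 x).1 hx
      obtain ⟨b, hb, hxb⟩ := (h1 x).1 hx'
      exact ⟨a, ha, b, hb, hxa, hxb⟩
    · rintro ⟨a, ha, b, hb, hxa, hxb⟩
      exact ⟨(h2 x).2 ⟨a, ha, hxa⟩, (h1 x).2 ⟨b, hb, hxb⟩⟩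

theorem Means.eq_setOf_exists_le {U : List ℕ} {S : Set X} (h : Means D.OkElt D.eltSet U S) :
    S = {y | ∃ x ∈ {x | ∃ n ∈ U, D.elt n = some x}, x ≤ y} := by
  rw [h.2]
  ext y
  constructor
  · rintro ⟨n, hn, x, hx, hxy⟩
    exact ⟨x, ⟨n, hn, hx⟩, hxy⟩
  · rintro ⟨x, ⟨n, hn, hx⟩, hxy⟩
    exact ⟨n, hn, x, hx, hxy⟩

theorem means_singletons {U : List ℕ} (hU : ∀ n ∈ U, D.OkElt n) :
    Means D.OkWord D.filSet (U.map fun a => [a])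
      {w | ∃ x ∈ {x | ∃ n ∈ U, D.elt n = some x}, w ∈ fil [x]} := by
  refine ⟨fun w hw => ?_, Set.ext fun w => ⟨?_, ?_⟩⟩
  · obtain ⟨a, ha, rfl⟩ := List.mem_map.1 hw
    simpa [OkWord] using hU a ha
  · rintro ⟨x, ⟨n, hn, hx⟩, hw⟩
    exact ⟨[n], List.mem_map_of_mem hn, [x], .cons hx .nil, hw⟩
  · rintro ⟨_, ha, v, hv, hw⟩
    obtain ⟨n, hn, rfl⟩ := List.mem_map.1 ha
    obtain ⟨x, v₁, hx, hv₁, rfl⟩ := List.forall₂_cons_left_iff.1 hv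
    cases hv₁
    exact ⟨x, ⟨n, hn, hx⟩, hw⟩

theorem means_pairs {U : List ℕ} (hU : ∀ n ∈ U, D.OkElt n) :
    Means D.OkWord D.filSet (U.flatMap fun a => U.map fun b => [a, b])
      {w | ∃ c ∈ {x | ∃ n ∈ U, D.elt n = some x}, ∃ d ∈ {x | ∃ n ∈ U, D.elt n = some x},
        w ∈ fil [c, d]} := by
  refine ⟨fun w hw => ?_, Set.ext fun w => ⟨?_, ?_⟩⟩
  · obtain ⟨a, ha, hw⟩ := List.mem_flatMap.1 hw
    obtain ⟨b, hb, rfl⟩ := List.mem_map.1 hw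
    simpa [OkWord] using ⟨hU a ha, hU b hb⟩
  · rintro ⟨x, ⟨n, hn, hx⟩, y, ⟨m, hm, hy⟩, hw⟩
    exact ⟨[n, m], List.mem_flatMap.2 ⟨n, hn, List.mem_map_of_mem hm⟩, [x, y],
      .cons hx (.cons hy .nil), hw⟩
  · rintro ⟨_, ha, v, hv, hw⟩
    obtain ⟨n, hn, hb⟩ := List.mem_flatMap.1 ha
    obtain ⟨m, hm, rfl⟩ := List.mem_map.1 hb
    obtain ⟨x, v₁, hx, hv₁, rfl⟩ := List.forall₂_cons_left_iff.1 hv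
    obtain ⟨y, v₂, hy, hv₂, rfl⟩ := List.forall₂_cons_left_iff.1 hv₁
    cases hv₂
    exact ⟨x, ⟨n, hn, hx⟩, y, ⟨m, hm, hy⟩, hw⟩

theorem computes_complAtom (hp : IsPresentation D p) {A : AtomName} (hA : D.OkAtom A) :
    Computes (fun k => complAtom (p, k) A) fun U =>
      Means D.OkWord D.filSet U (D.atomSet A).denᶜ := by
  refine Computes.map (f := fun U => U.map (fun a => [a]) ++ longWords p.xf A)
    (computes_complLower hp hA) fun U hU => ?_
  have hxf := D.up_eq_some.1 hp.xf
  rcases A with i | l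
  · rw [den_inl]
    have h : Means D.OkElt D.eltSet U (D.idlSet i)ᶜ := lowSet_singleton (D := D) i ▸ hU
    rw [compl_opt (Means.eq_setOf_exists_le h) (Means.eq_setOf_exists_le hxf)]
    exact (means_singletons hU.1).append (means_pairs hxf.1)
  · rw [den_inr, compl_star (Means.eq_setOf_exists_le (S := (D.lowSet l)ᶜ) hU)]
    have h := (means_singletons hU.1).append (Means.nil (ok := D.OkWord) (den := D.filSet))
    rwa [Set.union_empty] at h

theorem computes_odotFil (hp : IsPresentation D p) {w w' : List ℕ} (hw : D.OkWord w)
    (hw' : D.OkWord w') :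
    Computes (fun k => odotFil (p, k) w w') fun U =>
      Means D.OkWord D.filSet U (odot (D.filSet w) (D.filSet w')) := by
  have hnil : D.filSet [] = Set.univ := by
    rw [D.filSet_eq (v := []) .nil, fil_nil]
  have huniv : Means D.OkWord D.filSet [[]] Set.univ := by
    rw [← hnil]
    exact Means.singleton (by simp [OkWord])
  rcases List.eq_nil_or_concat' w with rfl | ⟨s, a, rfl⟩
  · rw [hnil, univ_odot]
    exact Computes.pure huniv
  rcases w' with _ | ⟨b, t⟩
  · rw [hnil, odot_univ]
    simp only [odotFil, List.reverse_append, List.reverse_singleton, List.singleton_append]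
    exact Computes.pure huniv
  have hs : D.OkWord s := fun n hn => hw n (List.mem_append_left _ hn)
  have ha : D.OkElt a := hw a (by simp)
  have hb := List.forall_mem_cons.1 hw'
  simp only [odotFil, List.reverse_append, List.reverse_singleton, List.singleton_append,
    List.reverse_reverse]
  refine (computes_if' hp ha hb.1).map fun zs hzs => ?_
  obtain ⟨x, hx⟩ := Option.isSome_iff_exists.1 ha
  obtain ⟨y, hy⟩ := Option.isSome_iff_exists.1 hb.1
  obtain ⟨v, hv⟩ := D.okWord_iff.1 hs
  obtain ⟨v', hv'⟩ := D.okWord_iff.1 hb.2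
  have h1 : D.Names (s ++ [a]) (v ++ [x]) := List.rel_append hv (.cons hx .nil)
  have h2 : D.Names (b :: t) (y :: v') := .cons hy hv'
  have h3 : D.Names (s ++ [a] ++ b :: t) (v ++ [x] ++ y :: v') := List.rel_append h1 h2
  rw [D.filSet_eq h1, D.filSet_eq h2, fil_odot_fil]
  have h4 : Means D.OkWord D.filSet [s ++ [a] ++ b :: t] (fil (v ++ [x, y] ++ v')) := by
    rw [show v ++ [x, y] ++ v' = v ++ [x] ++ y :: v' by simp, ← D.filSet_eq h3]
    exact Means.singleton (D.okWord_iff.2 ⟨_, h3⟩)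
  have h5 : Means D.OkWord D.filSet (zs.map fun z => s ++ z :: t)
      (SeqExt.prod (fil v) (SeqExt.prod (upLetters (Set.Ici x ∩ Set.Ici y)) (fil v'))) := by
    rw [D.eltSet_eq hx, D.eltSet_eq hy] at hzs
    have hfil : ∀ z, D.OkElt z → D.filSet (s ++ z :: t) =
        SeqExt.prod (fil v) (SeqExt.prod (upLetters (D.eltSet z)) (fil v')) := by
      intro z hz
      obtain ⟨c, hc⟩ := Option.isSome_iff_exists.1 hz
      have h : D.Names (s ++ z :: t) (v ++ ([c] ++ v')) := List.rel_append hv (.cons hc hv')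
      rw [D.filSet_eq h, D.eltSet_eq hc, upLetters_ici, fil_prod_fil, fil_prod_fil]
    refine hzs.map
      (F := fun T => SeqExt.prod (fil v) (SeqExt.prod (upLetters T) (fil v')))
      (fun z hz => ?_) hfil fun w => ?_
    · intro n hn
      rcases List.mem_append.1 hn with hn | hn
      · exact hs n hn
      · exact List.forall_mem_cons.2 ⟨hz, hb.2⟩ n hn
    · rw [hzs.2]
      constructor
      · rintro ⟨c, _, hc, ⟨d, e, ⟨q, ⟨z, hz, hq⟩, hd⟩, he, rfl⟩, rfl⟩
        exact ⟨z, hz, c, _, hc, ⟨d, e, ⟨q, hq, hd⟩, he, rfl⟩, rfl⟩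
      · rintro ⟨z, hz, c, _, hc, ⟨d, e, ⟨q, hq, hd⟩, he, rfl⟩, rfl⟩
        exact ⟨c, _, hc, ⟨d, e, ⟨q, ⟨z, hz, hq⟩, hd⟩, he, rfl⟩, rfl⟩
  exact h4.append h5

theorem computes_seqCI (hp : IsPresentation D p) {P : List AtomName} (hP : D.OkProd P) :
    Computes (fun k => seqCI (p, k) P) fun U =>
      Means D.OkWord D.filSet U (D.prodSet P)ᶜ := by
  have hD := hp.exact
  induction P with
  | nil =>
    have hxf := D.up_eq_some.1 hp.xf
    refine Computes.pure (x := p.xf.map fun a => [a])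
      (Q := fun U => Means D.OkWord D.filSet U (D.prodSet [])ᶜ) ?_
    have h : (D.prodSet [])ᶜ = {w | ∃ x ∈ {x | ∃ n ∈ p.xf, D.elt n = some x}, w ∈ fil [x]} := by
      rw [prodSet_nil, ← star_empty]
      exact compl_star (by rw [Set.compl_empty]; exact Means.eq_setOf_exists_le hxf)
    rw [h]
    exact means_singletons hxf.1
  | cons A P ih =>
    have hP' := List.forall_mem_cons.1 hP
    refine (ih hP'.2).bind fun V hV => (computes_complAtom hp hP'.1).bind fun U hU => ?_
    refine (Computes.onPairs fun u hu v hv =>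
      computes_odotFil hp (hU.1 u hu) (hV.1 v hv)).mono fun l hl => ?_
    have h : (D.prodSet (A :: P))ᶜ = odot (D.atomSet A).denᶜ (D.prodSet P)ᶜ := by
      rw [odot, compl_compl, compl_compl, prodSet_cons]
    -- `⊙` distributes over empty unions because neither complement contains the empty sequence
    have hU0 : SeqExt.mk [] ∉ (D.atomSet A).denᶜ := fun h => h (Atom.nil_mem_den _)
    have hV0 : SeqExt.mk [] ∉ (D.prodSet P)ᶜ :=
      fun h => h (nil_mem_of_ideal (hD.isIdeal_prodSet hP'.2))
    rw [h]
    convert hl using 1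
    rw [hV.2] at hV0
    rw [hU.2] at hU0
    rw [hU.2, hV.2, iUnion_odot U (fun u _ => D.isUpperSet_filSet u) hV0]
    ext w
    refine exists_congr fun u => and_congr_right fun hu => ?_
    rw [odot_iUnion V (fun v _ => D.isUpperSet_filSet v) fun h => hU0 ⟨u, hu, h⟩]
    rfl

end Correctness

/-! ### Presentations of the sequence extension -/

section Uniform

variable {α β σ : Type*} [Primcodable α] [Primcodable β] [Primcodable σ]

theorem exists_uniform_code₁ {f : Ctx → α → Option σ} (hf : Primrec₂ f) :
    ∃ F : Presentation → Code, Computable F ∧ ∀ p a Q, Computes (fun k => f (p, k) a) Q →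
      ∃ y, encode y ∈ (F p).eval (encode a) ∧ Q y := by
  have hg : Primrec₂ fun (c : Ctx) (n : ℕ) =>
      (decode n : Option α).bind fun a => (f c a).map (encode : σ → ℕ) := by
    refine Primrec.option_bind (Primrec.decode.comp Primrec.snd) ?_
    exact Primrec.option_map (hf.comp (Primrec.fst.comp Primrec.fst) Primrec.snd)
      (Primrec.encode.comp Primrec.snd)
  obtain ⟨F, hF, h⟩ := exists_uniform_code hg
  refine ⟨F, hF, fun p a Q hQ => ?_⟩
  obtain ⟨_, hy, y, rfl, hyQ⟩ := h p (encode a) (fun n => ∃ y : σ, n = encode y ∧ Q y) (by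
    simp only [encodek, Option.bind_some]
    exact hQ.map fun y hy => ⟨y, rfl, hy⟩)
  exact ⟨y, hy, hyQ⟩

theorem exists_uniform_code₂ {f : Ctx → α → β → Option σ}
    (hf : Primrec fun x : Ctx × α × β => f x.1 x.2.1 x.2.2) :
    ∃ F : Presentation → Code, Computable F ∧ ∀ p a b Q, Computes (fun k => f (p, k) a b) Q →
      ∃ y, encode y ∈ (F p).eval (Nat.pair (encode a) (encode b)) ∧ Q y := by
  obtain ⟨F, hF, h⟩ := exists_uniform_code₁ (f := fun c (x : α × β) => f c x.1 x.2) hf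
  exact ⟨F, hF, fun p a b Q hQ => h p (a, b) Q hQ⟩

/-- The code of a list is built from the codes of its entries, so that a list of names and the list
of the objects that they encode have the same code. -/
theorem encode_map_encode {α : Type*} [Encodable α] (l : List α) :
    encode (l.map encode) = encode l := by
  induction l with
  | nil => rfl
  | cons a l ih => rw [List.map_cons, encode_list_cons, encode_list_cons, ih]; rfl

end Uniform

section Names

variable {X : Type u} {D : DataStructures X}

theorem exists_encode_word (n : ℕ) : ∃ w : List ℕ, n = encode w :=
  ⟨Denumerable.ofNat (List ℕ) n, (Denumerable.encode_ofNat n).symm⟩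

theorem exists_encode_prod (n : ℕ) : ∃ P : List AtomName, n = encode P :=
  ⟨Denumerable.ofNat (List AtomName) n, (Denumerable.encode_ofNat n).symm⟩

theorem isSome_seq_elt_encode {w : List ℕ} : (D.seq.elt (encode w)).isSome ↔ D.OkWord w := by
  rw [okWord_iff, Option.isSome_iff_exists]
  exact exists_congr fun v => D.seq_elt_encode

theorem isSome_seq_idl_encode {P : List AtomName} :
    (D.seq.idl (encode P)).isSome ↔ D.OkProd P := by
  rw [Option.isSome_iff_exists]
  exact ⟨fun ⟨_, h⟩ => (D.seq_idl_encode.1 h).1, fun h => ⟨_, D.seq_idl_encode.2 ⟨h, rfl⟩⟩⟩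

theorem exists_names_of_seq_elt {n : ℕ} {v : SeqExt X} (h : D.seq.elt n = some v) :
    ∃ w : List ℕ, n = encode w ∧ D.Names w v := by
  obtain ⟨w, rfl⟩ := exists_encode_word n
  exact ⟨w, rfl, D.seq_elt_encode.1 h⟩

theorem exists_names_of_seq_idl {n : ℕ} {S : Set (SeqExt X)} (h : D.seq.idl n = some S) :
    ∃ P : List AtomName, n = encode P ∧ D.OkProd P ∧ S = D.prodSet P := by
  obtain ⟨P, rfl⟩ := exists_encode_prod n
  exact ⟨P, rfl, D.seq_idl_encode.1 h⟩

theorem exists_list_of_forall {σ τ : Type*} {r : σ → τ → Prop} {L : List τ}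
    (h : ∀ b ∈ L, ∃ a, r a b) : ∃ l, List.Forall₂ r l L := by
  induction L with
  | nil => exact ⟨[], .nil⟩
  | cons b L ih =>
    rw [List.forall_mem_cons] at h
    obtain ⟨a, ha⟩ := h.1
    obtain ⟨l, hl⟩ := ih h.2
    exact ⟨a :: l, .cons ha hl⟩

variable [Preorder X]

theorem DataStructures.Exact.exists_down (h : D.Exact) [WellQuasiOrderedLE X] {S : Set X}
    (hS : IsLowerSet S) : ∃ l, D.down l = some S := by
  obtain ⟨L, hL, hSL⟩ := exists_ideal_decomposition ⟨S, hS⟩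
  obtain ⟨l, hl⟩ := exists_list_of_forall fun I hI => (h.idl I).2 (hL I hI)
  refine ⟨l, Option.map_eq_some_iff.2 ⟨L, mapM_eq_some.2 hl, hSL.symm⟩⟩

theorem DataStructures.Exact.exists_up (h : D.Exact) [WellQuasiOrderedLE X] {U : Set X}
    (hU : IsUpperSet U) : ∃ l, D.up l = some U := by
  obtain ⟨L, hUL⟩ := exists_finite_basis hU
  obtain ⟨l, hl⟩ := exists_list_of_forall (L := L) fun x _ => h.elt x
  exact ⟨l, Option.map_eq_some_iff.2 ⟨L, mapM_eq_some.2 hl, hUL.symm⟩⟩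

theorem DataStructures.Exact.exists_atom (h : D.Exact) [WellQuasiOrderedLE X]
    {A : Atom (Set X)} (hA : A.Valid) : ∃ a, D.atom a = some A := by
  cases A with
  | opt I =>
    obtain ⟨i, hi⟩ := (h.idl I).2 hA
    exact ⟨Sum.inl i, Option.map_eq_some_iff.2 ⟨I, hi, rfl⟩⟩
  | star S =>
    obtain ⟨l, hl⟩ := h.exists_down hA
    exact ⟨Sum.inr l, Option.map_eq_some_iff.2 ⟨S, hl, rfl⟩⟩

theorem DataStructures.Exact.seq (h : D.Exact) [WellQuasiOrderedLE X] : D.seq.Exact where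
  elt v := by
    obtain ⟨w, hw⟩ := exists_list_of_forall (L := (v : List X)) fun x _ => h.elt x
    exact ⟨encode w, D.seq_elt_encode.2 hw⟩
  idl S := by
    constructor
    · rintro ⟨n, hn⟩
      obtain ⟨P, -, hP, rfl⟩ := exists_names_of_seq_idl hn
      exact h.isIdeal_prodSet hP
    · intro hS
      obtain ⟨L, hL, rfl⟩ := isIdeal_iff_exists_prod.1 hS
      obtain ⟨P, hP⟩ := exists_list_of_forall fun A hA => h.exists_atom (hL A hA)
      obtain ⟨hP', rfl⟩ := D.forall₂_atom.1 hP
      exact ⟨encode P, D.seq_idl_encode.2 ⟨hP', rfl⟩⟩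

end Names

/-- The function that turns presentations of `X` into presentations of the sequence extension. The
decomposition (XI) of the latter consists of the single ideal `X*`, and (XF) of the filter generated
by the empty sequence. -/
theorem exists_computable_isPresentation_seq : ∃ F : Presentation → Presentation, Computable F ∧
    ∀ (X : Type u) [Preorder X] (D : DataStructures X) (p : Presentation),
      IsPresentation D p → IsPresentation D.seq (F p) := by
  obtain ⟨f₁, c₁, h₁⟩ := exists_uniform_code₁ primrec_seqDecElt
  obtain ⟨f₂, c₂, h₂⟩ := exists_uniform_code₁ primrec_seqDecIdl
  obtain ⟨f₃, c₃, h₃⟩ := exists_uniform_code₂ (f := seqOD) (primrec_seqOD Primrec.fst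
    (Primrec.fst.comp Primrec.snd) (Primrec.snd.comp Primrec.snd))
  obtain ⟨f₄, c₄, h₄⟩ := exists_uniform_code₂ (f := seqIncl) (primrec_seqIncl Primrec.fst
    (Primrec.fst.comp Primrec.snd) (Primrec.snd.comp Primrec.snd))
  obtain ⟨f₅, c₅, h₅⟩ := exists_uniform_code₁ (f := seqPI) (primrec_seqPI Primrec.fst Primrec.snd)
  obtain ⟨f₆, c₆, h₆⟩ := exists_uniform_code₁ (f := seqCF) (primrec_seqCF Primrec.fst Primrec.snd)
  obtain ⟨f₇, c₇, h₇⟩ := exists_uniform_code₂ (f := seqIF) (primrec_seqIF Primrec.fst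
    (Primrec.fst.comp Primrec.snd) (Primrec.snd.comp Primrec.snd))
  obtain ⟨f₈, c₈, h₈⟩ := exists_uniform_code₁ (f := seqCI) (primrec_seqCI Primrec.fst Primrec.snd)
  obtain ⟨f₉, c₉, h₉⟩ := exists_uniform_code₂ (f := seqII) (primrec_seqII Primrec.fst
    (Primrec.fst.comp Primrec.snd) (Primrec.snd.comp Primrec.snd))
  have hxi : Computable fun p : Presentation => [encode [(Sum.inr p.xi : AtomName)]] :=
    (Primrec.list_cons.comp (Primrec.encode.comp (Primrec.list_cons.comp
      (Primrec.sumInr.comp Presentation.primrec_xi) (Primrec.const []))) (Primrec.const [])).to_comp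
  refine ⟨fun p => ⟨f₁ p, f₂ p, f₃ p, f₄ p, f₅ p, f₆ p, f₇ p, f₈ p, f₉ p,
    [encode [(Sum.inr p.xi : AtomName)]], [encode ([] : List ℕ)]⟩, ?_, ?_⟩
  · have hsymm : Computable Presentation.equivProd.symm := Primrec.of_equiv_symm.to_comp
    have h := hsymm.comp (c₁.pair (c₂.pair (c₃.pair (c₄.pair (c₅.pair (c₆.pair (c₇.pair (c₈.pair
      (c₉.pair (hxi.pair (Computable.const [encode ([] : List ℕ)])))))))))))
    exact h
  intro X _ D p hp
  have := hp.wqo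
  constructor
  case wqo => exact wellQuasiOrderedLE_seqExt
  case exact => exact hp.exact.seq
  case decElt =>
    intro n
    obtain ⟨w, rfl⟩ := exists_encode_word n
    exact answers_iff.2 (h₁ p w _ ((computes_seqDecElt hp w).mono
      fun _ h => h.congr isSome_seq_elt_encode.symm))
  case decIdl =>
    intro n
    obtain ⟨P, rfl⟩ := exists_encode_prod n
    exact answers_iff.2 (h₂ p P _ ((computes_seqDecIdl hp P).mono
      fun _ h => h.congr isSome_seq_idl_encode.symm))
  case od =>
    intro m n v v' hv hv'
    obtain ⟨w, rfl, hw⟩ := exists_names_of_seq_elt hv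
    obtain ⟨w', rfl, hw'⟩ := exists_names_of_seq_elt hv'
    exact answers_iff.2 (h₃ p w w' _ (computes_seqOD hp hw hw'))
  case id =>
    intro m n I J hI hJ
    obtain ⟨P, rfl, hP, rfl⟩ := exists_names_of_seq_idl hI
    obtain ⟨Q, rfl, hQ, rfl⟩ := exists_names_of_seq_idl hJ
    exact answers_iff.2 (h₄ p P Q _ (computes_seqIncl hp hP hQ))
  case pi =>
    intro n v hv
    obtain ⟨w, rfl, hw⟩ := exists_names_of_seq_elt hv
    obtain ⟨P, hP, hP', h⟩ := h₅ p w _ (computes_seqPI hp hw)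
    exact ⟨encode P, hP, D.seq_idl_encode.2 ⟨hP', h.symm⟩⟩
  case cf =>
    intro n v hv
    obtain ⟨w, rfl, hw⟩ := exists_names_of_seq_elt hv
    obtain ⟨L, hL, h⟩ := h₆ p w _ (computes_seqCF hp hw)
    exact ⟨L.map encode, by rwa [encode_map_encode], D.seq_down_map_encode h⟩
  case if' =>
    intro m n v v' hv hv'
    obtain ⟨w, rfl, hw⟩ := exists_names_of_seq_elt hv
    obtain ⟨w', rfl, hw'⟩ := exists_names_of_seq_elt hv'
    obtain ⟨U, hU, h⟩ := h₇ p w w' _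
      (computes_seqIF hp (D.okWord_iff.2 ⟨v, hw⟩) (D.okWord_iff.2 ⟨v', hw'⟩))
    rw [D.filSet_eq hw, D.filSet_eq hw'] at h
    exact ⟨U.map encode, by rwa [encode_map_encode], D.seq_up_map_encode h⟩
  case ci =>
    intro n I hI
    obtain ⟨P, rfl, hP, rfl⟩ := exists_names_of_seq_idl hI
    obtain ⟨U, hU, h⟩ := h₈ p P _ (computes_seqCI hp hP)
    exact ⟨U.map encode, by rwa [encode_map_encode], D.seq_up_map_encode h⟩
  case ii =>
    intro m n I J hI hJ
    obtain ⟨P, rfl, hP, rfl⟩ := exists_names_of_seq_idl hI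
    obtain ⟨Q, rfl, hQ, rfl⟩ := exists_names_of_seq_idl hJ
    obtain ⟨L, hL, h⟩ := h₉ p P Q _ (computes_seqII hp hP hQ)
    exact ⟨L.map encode, by rwa [encode_map_encode], D.seq_down_map_encode h⟩
  case xi =>
    obtain ⟨hx, hx'⟩ := D.down_eq_some'.1 hp.xi
    have h := Means.star_atom (D := D) hx
    rw [← hx', show star (Set.univ : Set X) = Set.univ from
      ext_mk fun w => iff_of_true (fun _ _ => trivial) trivial] at h
    exact D.seq_down_map_encode h
  case xf =>
    have h : Means D.OkWord D.filSet [[]] (D.filSet []) :=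
      Means.singleton fun n hn => (List.not_mem_nil hn).elim
    rw [D.filSet_eq (v := []) .nil, fil_nil] at h
    exact D.seq_up_map_encode h

/-- The finite decompositions (XI) and (XF), which are not part of ideal effectiveness, exist
because `X` is a well-quasi-order. -/
theorem exists_isPresentation {X : Type u} [Preorder X] {D : DataStructures X}
    (h : D.IdeallyEffective) : ∃ p, IsPresentation D p := by
  have := h.wqo
  have key : ∀ {P : (ℕ →. ℕ) → Prop}, (∃ f, Nat.Partrec f ∧ P f) → ∃ c : Code, P c.eval := by
    rintro P ⟨f, hf, hP⟩
    obtain ⟨c, rfl⟩ := Code.exists_code.1 hf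
    exact ⟨c, hP⟩
  obtain ⟨c₁, h₁⟩ := key h.decElt
  obtain ⟨c₂, h₂⟩ := key h.decIdl
  obtain ⟨c₃, h₃⟩ := key h.od
  obtain ⟨c₄, h₄⟩ := key h.id
  obtain ⟨c₅, h₅⟩ := key h.pi
  obtain ⟨c₆, h₆⟩ := key h.cf
  obtain ⟨c₇, h₇⟩ := key h.if'
  obtain ⟨c₈, h₈⟩ := key h.ci
  obtain ⟨c₉, h₉⟩ := key h.ii
  obtain ⟨xi, hxi⟩ := h.exact.exists_down isLowerSet_univ
  obtain ⟨xf, hxf⟩ := h.exact.exists_up isUpperSet_univ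
  exact ⟨⟨c₁, c₂, c₃, c₄, c₅, c₆, c₇, c₈, c₉, xi, xf⟩, h.wqo, h.exact, h₁, h₂, h₃, h₄, h₅, h₆,
    h₇, h₈, h₉, hxi, hxf⟩

theorem IsPresentation.ideallyEffective {X : Type u} [Preorder X] {D : DataStructures X}
    {p : Presentation} (hp : IsPresentation D p) : D.IdeallyEffective := by
  have key : ∀ c : Code, Nat.Partrec c.eval := fun c => Code.exists_code.2 ⟨c, rfl⟩
  exact ⟨hp.wqo, hp.exact, ⟨_, key _, hp.decElt⟩, ⟨_, key _, hp.decIdl⟩, ⟨_, key _, hp.od⟩,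
    ⟨_, key _, hp.id⟩, ⟨_, key _, hp.pi⟩, ⟨_, key _, hp.cf⟩, ⟨_, key _, hp.if'⟩,
    ⟨_, key _, hp.ci⟩, ⟨_, key _, hp.ii⟩⟩

theorem ideallyEffective_sequenceExtension :
    Constructor.IdeallyEffective.{u} sequenceExtension := by
  obtain ⟨F, hF, h⟩ := exists_computable_isPresentation_seq.{u}
  refine ⟨fun X _ hX => wellQuasiOrderedLE_seqExt (X := X), fun X _ D hD => ?_, F, hF, h⟩
  obtain ⟨p, hp⟩ := exists_isPresentation hD
  exact (h X D p hp).ideallyEffective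

end IdealEff

theorem mainTheorem3 :
    -- the sequence extension is an ideally effective constructor
    Constructor.IdeallyEffective.{u} sequenceExtension ∧
    ∀ (X : Type u) [Preorder X] [WellQuasiOrderedLE X],
      -- inclusion of ideals: atoms
      ((∀ I J : Set X, Order.IsIdeal I → Order.IsIdeal J →
          (SeqExt.opt I ⊆ SeqExt.opt J ↔ I ⊆ J)) ∧
        (∀ I D : Set X, Order.IsIdeal I → IsLowerSet D →
          (SeqExt.opt I ⊆ SeqExt.star D ↔ I ⊆ D)) ∧
        (∀ D E : Set X, IsLowerSet D → IsLowerSet E →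
          (SeqExt.star D ⊆ SeqExt.star E ↔ D ⊆ E)) ∧
        (∀ D I : Set X, IsLowerSet D → Order.IsIdeal I →
          (SeqExt.star D ⊆ SeqExt.opt I ↔ D = ∅))) ∧
      -- inclusion of ideals: products
      ((∀ P : Set (SeqExt X), Order.IsIdeal P → SeqExt.eps X ⊆ P) ∧
        (∀ (A : Atom (Set X)) (P : Set (SeqExt X)), A.Valid → Order.IsIdeal P →
          (SeqExt.prod A.den P ⊆ SeqExt.eps X ↔ A.den = SeqExt.star ∅ ∧ P ⊆ SeqExt.eps X)) ∧
        (∀ (A B : Atom (Set X)) (P Q : Set (SeqExt X)), A.Valid → B.Valid →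
          Order.IsIdeal P → Order.IsIdeal Q → ¬ A.den ⊆ B.den →
          (SeqExt.prod A.den P ⊆ SeqExt.prod B.den Q ↔ SeqExt.prod A.den P ⊆ Q)) ∧
        (∀ (I J : Set X) (P Q : Set (SeqExt X)), Order.IsIdeal I → Order.IsIdeal J →
          Order.IsIdeal P → Order.IsIdeal Q → I ⊆ J →
          (SeqExt.prod (SeqExt.opt I) P ⊆ SeqExt.prod (SeqExt.opt J) Q ↔ P ⊆ Q)) ∧
        (∀ (A B : Atom (Set X)) (P Q : Set (SeqExt X)), A.Valid → B.Valid →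
          Order.IsIdeal P → Order.IsIdeal Q → A.den ⊆ B.den →
          (¬ ∃ I J, A = Atom.opt I ∧ B = Atom.opt J) →
          (SeqExt.prod A.den P ⊆ SeqExt.prod B.den Q ↔ P ⊆ SeqExt.prod B.den Q))) ∧
      -- inclusion of ideals: the resulting test is correct and makes linearly many calls
      (∀ sub : Set X → Set X → Bool,
        (∀ D E : Set X, IsLowerSet D → IsLowerSet E → (sub D E = true ↔ D ⊆ E)) →
        ∀ P Q : List (Atom (Set X)), (∀ A ∈ P, A.Valid) → (∀ B ∈ Q, B.Valid) →
          ((Atom.inclTest ∅ sub P Q).1 = true ↔ Atom.prod P ⊆ Atom.prod Q) ∧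
          (Atom.inclTest ∅ sub P Q).2 ≤ P.length + Q.length) ∧
      -- complement of a filter
      ((SeqExt.fil ([] : List X))ᶜ = ∅ ∧
        (∀ x : X, (SeqExt.fil [x])ᶜ = SeqExt.star (Set.Ici x)ᶜ) ∧
        (∀ (x : X) (v : List X), v ≠ [] →
          (SeqExt.fil (x :: v))ᶜ =
            SeqExt.prod (SeqExt.star (Set.Ici x)ᶜ)
              (SeqExt.prod (SeqExt.opt Set.univ) (SeqExt.fil v)ᶜ))) ∧
      -- intersection of ideals
      (∀ P Q : Set (SeqExt X), Order.IsIdeal P → Order.IsIdeal Q →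
        SeqExt.eps X ∩ Q = SeqExt.eps X ∧
        P ∩ SeqExt.eps X = SeqExt.eps X ∧
        (∀ D E : Set X, IsLowerSet D → IsLowerSet E →
          SeqExt.prod (SeqExt.star D) P ∩ SeqExt.prod (SeqExt.star E) Q =
            SeqExt.prod (SeqExt.star (D ∩ E))
              ((SeqExt.prod (SeqExt.star D) P ∩ Q) ∪ (P ∩ SeqExt.prod (SeqExt.star E) Q))) ∧
        (∀ I J : Set X, Order.IsIdeal I → Order.IsIdeal J →
          SeqExt.prod (SeqExt.opt I) P ∩ SeqExt.prod (SeqExt.opt J) Q =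
            (SeqExt.prod (SeqExt.opt I) P ∩ Q) ∪ (P ∩ SeqExt.prod (SeqExt.opt J) Q) ∪
              SeqExt.prod (SeqExt.opt (I ∩ J)) (P ∩ Q)) ∧
        (∀ D I : Set X, IsLowerSet D → Order.IsIdeal I →
          SeqExt.prod (SeqExt.star D) P ∩ SeqExt.prod (SeqExt.opt I) Q =
            (P ∩ SeqExt.prod (SeqExt.opt I) Q) ∪
              SeqExt.prod (SeqExt.opt (D ∩ I)) (SeqExt.prod (SeqExt.star D) P ∩ Q))) ∧
      -- intersection of filters
      ((∀ v : List X, SeqExt.fil v ∩ SeqExt.fil [] = SeqExt.fil v ∧ SeqExt.fil [] ∩ SeqExt.fil v = SeqExt.fil v) ∧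
        (∀ (x y : X) (v w : List X),
          SeqExt.fil (x :: v) ∩ SeqExt.fil (y :: w) =
            SeqExt.prod (SeqExt.fil [x]) (SeqExt.fil v ∩ SeqExt.fil (y :: w)) ∪
              SeqExt.prod (SeqExt.fil [y]) (SeqExt.fil (x :: v) ∩ SeqExt.fil w) ∪
              SeqExt.prod (SeqExt.upLetters (Set.Ici x ∩ Set.Ici y)) (SeqExt.fil v ∩ SeqExt.fil w)) ∧
        (∀ u v : List X, SeqExt.prod (SeqExt.fil u) (SeqExt.fil v) = SeqExt.fil (u ++ v))) ∧
      -- complement of an ideal: atoms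
      ((∀ (D : Set X) (S : List X), IsLowerSet D → Dᶜ = {y | ∃ a ∈ S, a ≤ y} →
          (SeqExt.star D)ᶜ = {w | ∃ a ∈ S, w ∈ SeqExt.fil [a]}) ∧
        (∀ (I : Set X) (S T : List X), Order.IsIdeal I → Iᶜ = {y | ∃ b ∈ S, b ≤ y} →
          Set.univ = {y | ∃ c ∈ T, c ≤ y} →
          (SeqExt.opt I)ᶜ = {w | ∃ b ∈ S, w ∈ SeqExt.fil [b]} ∪
            {w | ∃ c ∈ T, ∃ d ∈ T, w ∈ SeqExt.fil [c, d]})) ∧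
      -- complement of an ideal: products
      ((∀ U V : Set (SeqExt X), IsUpperSet U → IsUpperSet V → IsUpperSet (SeqExt.odot U V)) ∧
        (∀ U V W : Set (SeqExt X), IsUpperSet U → IsUpperSet V → IsUpperSet W →
          SeqExt.odot (SeqExt.odot U V) W = SeqExt.odot U (SeqExt.odot V W) ∧
          SeqExt.odot (U ∪ V) W = SeqExt.odot U W ∪ SeqExt.odot V W ∧
          SeqExt.odot W (U ∪ V) = SeqExt.odot W U ∪ SeqExt.odot W V) ∧
        (∀ v : List X, SeqExt.odot (SeqExt.fil v) (SeqExt.fil []) = Set.univ ∧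
          SeqExt.odot (SeqExt.fil []) (SeqExt.fil v) = Set.univ) ∧
        (∀ (a b : X) (v w : List X),
          SeqExt.odot (SeqExt.fil (v ++ [a])) (SeqExt.fil (b :: w)) =
            SeqExt.fil (v ++ [a, b] ++ w) ∪
              SeqExt.prod (SeqExt.fil v)
                (SeqExt.prod (SeqExt.upLetters (Set.Ici a ∩ Set.Ici b)) (SeqExt.fil w))) ∧
        (∀ P : List (Atom (Set X)), (∀ A ∈ P, A.Valid) →
          (Atom.prod P)ᶜ = P.foldr (fun A U => SeqExt.odot A.denᶜ U) (SeqExt.eps X)ᶜ)) := by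
  open SeqExt in
  refine ⟨ideallyEffective_sequenceExtension, fun X _ _ => ⟨?_, ?_, ?_, ?_, ?_, ?_, ?_, ?_⟩⟩
  · exact ⟨fun _ _ _ _ => opt_subset_opt, fun _ _ _ _ => opt_subset_star_iff,
      fun _ _ _ _ => star_subset_star, fun _ _ _ _ => star_subset_opt⟩
  · exact ⟨fun _ => eps_subset_of_ideal, fun _ _ => atom_prod_subset_eps,
      fun _ _ _ _ hA hB _ hQ => prod_subset_prod_of_not_subset hA hB hQ.IsLowerSet,
      fun _ _ _ _ hI _ _ hQ => opt_prod_subset_opt_prod hI.Nonempty hQ.IsLowerSet,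
      fun _ _ _ _ _ _ _ _ => prod_subset_prod_of_subset⟩
  · exact fun sub hsub P Q hP hQ => ⟨inclTest_iff hsub P Q hP hQ, inclTest_count_le ∅ sub P Q⟩
  · exact ⟨by rw [fil_nil, Set.compl_univ], compl_fil_singleton, fun x _ => compl_fil_cons x⟩
  · exact fun P Q hP hQ => ⟨Set.inter_eq_left.2 (eps_subset_of_ideal hQ),
      Set.inter_eq_right.2 (eps_subset_of_ideal hP),
      fun D E _ _ => star_prod_inter_star_prod D E P Q,
      fun I J _ _ => opt_prod_inter_opt_prod I J P Q,
      fun D I _ _ => star_prod_inter_opt_prod D I P Q⟩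
  · exact ⟨fun v => by rw [fil_nil, Set.inter_univ, Set.univ_inter]; exact ⟨rfl, rfl⟩,
      fil_cons_inter_fil_cons, fil_prod_fil⟩
  · exact ⟨fun D S _ h => compl_star (S := {a | a ∈ S}) h,
      fun I S T _ h hT => compl_opt (S := {b | b ∈ S}) (T := {c | c ∈ T}) h hT⟩
  · exact ⟨fun _ _ => isUpperSet_odot, fun U V W hU hV _ =>
      ⟨odot_assoc U V W, union_odot hU hV, odot_union hU hV⟩,
      fun v => by rw [fil_nil]; exact ⟨odot_univ _, univ_odot _⟩, fil_odot_fil,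
      fun P _ => Atom.compl_prod P⟩
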